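/- Fix a finite alphabet $\Sigma\ni 0,1$, and let $\Sigma^*$, $\Sigma^\omega$ be the sets of finite words and infinite sequences over $\Sigma$. Computability of functions on $\Sigma^*$ and $\Sigma^\omega$ is that of Type-2 Turing machines. A representation of a set $X$ is a partial surjective function $\delta:\subseteq\Sigma^\omega\to X$, and a notation of $X$ is a partial surjective function $\nu:\subseteq\Sigma^*\to X$. For representations of the same set, $\delta_1\le\delta_2$ means that some computable function $h$ satisfies $\delta_1(p)=\delta_2(h(p))$ for all $p\in\mathrm{dom}(\delta_1)$, and $\delta_1\equiv\delta_2$ means $\delta_1\le\delta_2$ and $\delta_2\le\delta_1$. Let $\iota(a_1\ldots a_n)=110a_10a_2\ldots0a_n011$ and $\langle w_1,\ldots,w_n\rangle=\iota(w_1)\cdots\iota(w_n)$. A sequence $p\in\Sigma^\omega$ is a list of all words (or tuples of words) $x$ with property $Q$ if, for all such $x$, $\iota(x)$ (respectively $\iota(\langle x\rangle)$) is a subword of $p$ if and only if $Q(x)$. Let $\nu_{\mathbb N}$, $\nu_{\mathbb Q}$ be the canonical notations of $\mathbb N$ and $\mathbb Q$; numbers in lists are given by their names. Let $\rho$ be the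 representation of $\mathbb R$ for which a name of $x$ is the interleaving $p(0)q(0)p(1)q(1)\ldots$ of a list $p$ of all $u$ with $\nu_{\mathbb Q}(u)<x$ and a list $q$ of all $u$ with $\nu_{\mathbb Q}(u)>x$. Let $(\Omega,\mathcal A,\mathcal R,\alpha)$ be a computable $\sigma$-algebra: $\mathcal R$ is a countable ring of subsets of $\Omega$ with $\bigcup\mathcal R=\Omega$, $\mathcal A$ is the $\sigma$-algebra generated by $\mathcal R$, and $\alpha:\subseteq\Sigma^*\to\mathcal R$ is a notation of $\mathcal R$ with recursive domain such that union and set difference on $\mathcal R$ are computable with respect to $\alpha$. Let $\mu$ be a computable measure on it: a measure on $\mathcal A$ that is finite on $\mathcal R$ and such that $R\mapsto\mu(R)$, $R\in\mathcal R$, is $(\alpha,\rho)$-computable. Put $[A]=\{B\in\mathcal A:\mu(A\,\Delta\,B)=0\}$ for $A\in\mathcal A$, $[\mathcal A]=\{[A]:A\in\mathcal A\}$ and $[\mathcal R]=\{[R]:R\in\mathcal R\}$. Let $F=(F_i)_{i\in\mathbb N}$ be a partition for $\alpha$: there is a computable $g:\mathbb N\to\Sigma^*$ with $F_i=\alpha(g(i))$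 for all $i$, the sets $F_i$ are pairwise disjoint and of finite measure, and $\bigcup_iF_i=\Omega$. Define $\beta(w)=[\alpha(w)]$ for $w\in\mathrm{dom}(\alpha)$ and $$\overline d([A],[B])=\sum_{i\in\mathbb N}2^{-i}\cdot\frac{\mu(F_i\cap(A\,\Delta\,B))}{1+\mu(F_i\cap(A\,\Delta\,B))}.$$ Define $\overline\zeta(p)=[A]$ if and only if $p$ is a list of all $(u,i,v,w)$ such that $\nu_{\mathbb Q}(u)<\mu(F_i\cap\alpha(v)\cap A)<\nu_{\mathbb Q}(w)$. Define $\overline\xi_C(p)=[A]$ if and only if $p=\iota(v_0)\iota(v_1)\iota(v_2)\ldots$ for words $v_i\in\mathrm{dom}(\beta)$ such that $\overline d(\beta(v_i),\beta(v_j))\le2^{-i}$ for all $i<j$ and $\beta(v_i)\to[A]$ in $\overline d$. **Theorem.** $([\mathcal A],\overline d,[\mathcal R],\beta)$ is a computable metric space; that is, $\overline d$ is a metric on $[\mathcal A]$, $[\mathcal R]$ is dense, $\beta$ is a notation of $[\mathcal R]$ with recursive domain, and $\overline d$ restricted to $[\mathcal R]$ is $(\beta,\beta,\rho)$-computable. Moreover,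 $\overline\zeta$ and the Cauchy representation $\overline\xi_C$ of this space are representations of $[\mathcal A]$, and $\overline\zeta\equiv\overline\xi_C$. -/

import Mathlib

open MeasureTheory Filter Topology
open scoped symmDiff

/-! ### Words, sequences, tupling and lists -/

/-- The finite alphabet `Σ`, with `k + 2` symbols; it contains the two distinct symbols `0`
and `1`. -/
abbrev Alphabet (k : ℕ) : Type := Fin (k + 2)

/-- Finite words `Σ*`. -/
abbrev Word (k : ℕ) : Type := List (Alphabet k)

/-- Infinite sequences `Σ^ω`. -/
abbrev InfSeq (k : ℕ) : Type := ℕ → Alphabet k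

/-- The wrapping function `ι(a₁ a₂ … aₙ) = 11 0a₁ 0a₂ … 0aₙ 011`. -/
def wrap {k : ℕ} (w : Word k) : Word k :=
  [1, 1] ++ w.flatMap (fun a => [0, a]) ++ [0, 1, 1]

/-- The tupling `⟨w₁, …, wₙ⟩ = ι(w₁) … ι(wₙ)` of words. -/
def tuple {k : ℕ} (ws : List (Word k)) : Word k := ws.flatMap wrap

/-- The finite word `u` occurs in `p` at position `i`. -/
def OccursAt {k : ℕ} (u : Word k) (p : InfSeq k) (i : ℕ) : Prop :=
  (List.range u.length).map (fun j => p (i + j)) = u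

/-- `u` is a subword of the infinite sequence `p`. -/
def IsSubword {k : ℕ} (u : Word k) (p : InfSeq k) : Prop := ∃ i, OccursAt u p i

/-- The word `w` is listed by `p`, i.e. `ι(w)` is a subword of `p`. -/
def Listed {k : ℕ} (w : Word k) (p : InfSeq k) : Prop := IsSubword (wrap w) p

/-- `p = ι(v 0) ι(v 1) ι(v 2) …`. -/
def EncodesSeq {k : ℕ} (p : InfSeq k) (v : ℕ → Word k) : Prop :=
  ∀ n, OccursAt (tuple ((List.range n).map v)) p 0

/-! ### Canonical notations of natural and rational numbers -/

/-- Value of a word read as a binary numeral, most significant bit first. -/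
def natVal {k : ℕ} (w : Word k) : ℕ := w.foldl (fun n a => 2 * n + a.val) 0

/-- `ν_ℕ(w) = n`: binary notation, with domain `{0} ∪ 1{0,1}*`. -/
def IsNatName {k : ℕ} (w : Word k) (n : ℕ) : Prop :=
  (w = [0] ∨ (w.head? = some 1 ∧ ∀ a ∈ w, a = 0 ∨ a = 1)) ∧ natVal w = n

/-- `ν_ℚ(w) = q`: `ν_ℚ⟨a, b, c⟩ = (ν_ℕ(a) - ν_ℕ(b)) / ν_ℕ(c)` where `ν_ℕ(c) ≠ 0`. -/
def IsRatName {k : ℕ} (w : Word k) (q : ℚ) : Prop :=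
  ∃ a b c : Word k, ∃ l m n : ℕ, IsNatName a l ∧ IsNatName b m ∧ IsNatName c n ∧ n ≠ 0 ∧
    w = tuple [a, b, c] ∧ q = ((l : ℚ) - (m : ℚ)) / (n : ℚ)

/-! ### Type-2 machines

A Type-2 machine has a one-way read-only input tape carrying an infinite sequence (or blanks only,
if there is no infinite input), a work memory, and a one-way write-only output tape.  Finite-word
inputs `x : X` are placed into the work memory at the beginning.  The contents of the work memory
are coded by a natural number, and the effect of one step is a recursive function of the memory and
of the symbol under the input head. -/

/-- A Type-2 machine with finite inputs from `X` and one (possibly blank) infinite input tape. -/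
structure TypeTwoMachine (k : ℕ) (X : Type) [Primcodable X] where
  /-- initial memory, computed from the finite input -/
  start : X → ℕ
  /-- new memory, whether the input head moves one cell forward, and the symbol that is written
  on the output tape in this step, if any -/
  step : ℕ → Option (Alphabet k) → ℕ × Bool × Option (Alphabet k)
  start_computable : Computable start
  step_computable : Computable₂ step

/-- A configuration: memory, position of the input head, and the output written so far. -/
structure TypeTwoMachine.Config (k : ℕ) where
  memory : ℕ
  head : ℕ
  output : Word k

/-- The configuration after `t` steps on the finite input `x` and the given input tape. -/
def TypeTwoMachine.run {k : ℕ} {X : Type} [Primcodable X] (M : TypeTwoMachine k X) (x : X)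
    (tape : ℕ → Option (Alphabet k)) : ℕ → TypeTwoMachine.Config k
  | 0 => ⟨M.start x, 0, []⟩
  | t + 1 =>
    let c := M.run x tape t
    let s := M.step c.memory (tape c.head)
    ⟨s.1, c.head + (if s.2.1 then 1 else 0), c.output ++ s.2.2.toList⟩

/-- The machine writes the infinite sequence `q` on its output tape. As the output tape is
one-way, this holds for at most one `q`. -/
def TypeTwoMachine.Writes {k : ℕ} {X : Type} [Primcodable X] (M : TypeTwoMachine k X) (x : X)
    (tape : ℕ → Option (Alphabet k)) (q : InfSeq k) : Prop :=
  ∀ n, ∃ t, (M.run x tape t).output[n]? = some (q n)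

/-- `f_M(p) = q`, for the partial function `f_M` on `Σ^ω` computed by `M`. -/
def TypeTwoMachine.MapsSeq {k : ℕ} (M : TypeTwoMachine k Unit) (p q : InfSeq k) : Prop :=
  M.Writes () (fun n => some (p n)) q

/-- `f_M(x) = q`, for the partial function `f_M` from finite inputs to `Σ^ω` computed by `M`. -/
def TypeTwoMachine.MapsFinite {k : ℕ} {X : Type} [Primcodable X] (M : TypeTwoMachine k X) (x : X)
    (q : InfSeq k) : Prop :=
  M.Writes x (fun _ => none) q

/-! ### Representations -/

/-- `δ p x`, read as `δ(p) = x`, is the graph of a representation: of a partial surjective function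
from `Σ^ω` onto `Y`. -/
def IsRepresentation {k : ℕ} {Y : Type*} (δ : InfSeq k → Y → Prop) : Prop :=
  (∀ p x y, δ p x → δ p y → x = y) ∧ ∀ x, ∃ p, δ p x

/-- `δ₁ ≤ δ₂`: some computable function `h` satisfies `δ₁(p) = δ₂(h(p))` for `p ∈ dom δ₁`. -/
def Reducible {k : ℕ} {Y : Type*} (δ₁ δ₂ : InfSeq k → Y → Prop) : Prop :=
  ∃ M : TypeTwoMachine k Unit, ∀ p x, δ₁ p x → ∃ q, M.MapsSeq p q ∧ δ₂ q x

/-- `δ₁ ≡ δ₂`. -/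
def EquivRep {k : ℕ} {Y : Type*} (δ₁ δ₂ : InfSeq k → Y → Prop) : Prop :=
  Reducible δ₁ δ₂ ∧ Reducible δ₂ δ₁

/-- `ρ_<(p) = x`: `p` is a list of all `u` such that `ν_ℚ(u) < x`. -/
def RhoLt {k : ℕ} (p : InfSeq k) (x : ℝ) : Prop :=
  ∀ u, Listed u p ↔ ∃ r : ℚ, IsRatName u r ∧ (r : ℝ) < x

/-- `ρ_>(p) = x`: `p` is a list of all `u` such that `ν_ℚ(u) > x`. -/
def RhoGt {k : ℕ} (p : InfSeq k) (x : ℝ) : Prop :=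
  ∀ u, Listed u p ↔ ∃ r : ℚ, IsRatName u r ∧ x < (r : ℝ)

/-- `ρ⟨p, q⟩ = x` iff `ρ_<(p) = x` and `ρ_>(q) = x`, where `⟨p, q⟩ = p(0) q(0) p(1) q(1) …`. -/
def Rho {k : ℕ} (r : InfSeq k) (x : ℝ) : Prop :=
  RhoLt (fun n => r (2 * n)) x ∧ RhoGt (fun n => r (2 * n + 1)) x

/-- A binary operation is `(ν, ν, ν)`-computable for the notation `ν`. -/
def NotationComputable₂ {k : ℕ} {Y : Type*} (ν : Word k →. Y) (op : Y → Y → Y) : Prop :=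
  ∃ f : Word k × Word k →. Word k, Partrec f ∧
    ∀ u v A B, A ∈ ν u → B ∈ ν v → ∃ w ∈ f (u, v), op A B ∈ ν w

/-- A real-valued function is `(ν, ρ)`-computable for the notation `ν`. -/
def RhoComputable {k : ℕ} {Y : Type*} (ν : Word k →. Y) (φ : Y → ℝ) : Prop :=
  ∃ M : TypeTwoMachine k (Word k), ∀ w A, A ∈ ν w → ∃ q, M.MapsFinite w q ∧ Rho q (φ A)

/-- A real-valued function of two arguments is `(ν, ν, ρ)`-computable for the notation `ν`. -/
def RhoComputable₂ {k : ℕ} {Y : Type*} (ν : Word k →. Y) (φ : Y → Y → ℝ) : Prop :=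
  ∃ M : TypeTwoMachine k (Word k × Word k),
    ∀ u v A B, A ∈ ν u → B ∈ ν v → ∃ q, M.MapsFinite (u, v) q ∧ Rho q (φ A B)

/-! ### Computable metric spaces -/

/-- `(Y, d, D, ν)` is a computable metric space: `d` is a metric on `Y`, `D` is dense, `ν` is a
notation of `D` with recursive domain, and `d` restricted to `D` is `(ν, ν, ρ)`-computable. -/
structure IsComputableMetricSpace {k : ℕ} {Y : Type*} (d : Y → Y → ℝ) (D : Set Y)
    (ν : Word k →. Y) : Prop where
  dist_eq_zero_iff : ∀ x y, d x y = 0 ↔ x = y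
  dist_comm : ∀ x y, d x y = d y x
  dist_triangle : ∀ x y z, d x z ≤ d x y + d y z
  dense : ∀ x, ∀ ε > 0, ∃ y ∈ D, d x y < ε
  notation_range : ∀ y, y ∈ D ↔ ∃ w, y ∈ ν w
  notation_dom : ComputablePred fun w => (ν w).Dom
  dist_computable : RhoComputable₂ ν d

/-- The Cauchy representation: `δ_C(p) = x` iff `p = ι(v 0) ι(v 1) …` where
`d(ν(v i), ν(v j)) ≤ 2⁻ⁱ` for `i < j`, and `x = lim ν(v i)`. -/
def CauchyRep {k : ℕ} {Y : Type*} (d : Y → Y → ℝ) (ν : Word k →. Y) (p : InfSeq k) (x : Y) :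
    Prop :=
  ∃ (v : ℕ → Word k) (y : ℕ → Y), EncodesSeq p v ∧ (∀ i, y i ∈ ν (v i)) ∧
    (∀ i j, i < j → d (y i) (y j) ≤ (2 : ℝ)⁻¹ ^ i) ∧
    Tendsto (fun i => d (y i) x) atTop (𝓝 0)

/-! ### Computable σ-algebras and computable measures -/

/-- A computable σ-algebra `(Ω, 𝒜, ℛ, α)`, where `𝒜` is the σ-algebra of the measurable sets. -/
structure ComputableSigmaAlgebra (k : ℕ) (Ω : Type*) [MeasurableSpace Ω] where
  /-- the ring `ℛ` -/
  sets : Set (Set Ω)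
  isSetRing : IsSetRing sets
  countable : sets.Countable
  sUnion_eq : ⋃₀ sets = Set.univ
  generateFrom_eq : MeasurableSpace.generateFrom sets = ‹MeasurableSpace Ω›
  /-- the notation `α` of the ring -/
  α : Word k →. Set Ω
  α_range : ∀ A, A ∈ sets ↔ ∃ w, A ∈ α w
  α_dom : ComputablePred fun w => (α w).Dom
  union_computable : NotationComputable₂ α (fun A B => A ∪ B)
  diff_computable : NotationComputable₂ α (fun A B => A \ B)

/-- `μ` is a computable measure. -/
structure ComputableSigmaAlgebra.IsComputableMeasure {k : ℕ} {Ω : Type*} [MeasurableSpace Ω]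
    (S : ComputableSigmaAlgebra k Ω) (μ : Measure Ω) : Prop where
  finite : ∀ R ∈ S.sets, μ R < ⊤
  computable : RhoComputable S.α (fun R => μ.real R)

/-- `F` is a partition (of `Ω`, into ring elements of finite measure) for the notation `α`. -/
structure ComputableSigmaAlgebra.IsPartition {k : ℕ} {Ω : Type*} [MeasurableSpace Ω]
    (S : ComputableSigmaAlgebra k Ω) (μ : Measure Ω) (F : ℕ → Set Ω) : Prop where
  computable : ∃ g : ℕ → Word k, Computable g ∧ ∀ i, F i ∈ S.α (g i)
  disjoint : ∀ i j, i ≠ j → F i ∩ F j = ∅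
  finite : ∀ i, μ (F i) < ⊤
  iUnion_eq : ⋃ i, F i = Set.univ

theorem ComputableSigmaAlgebra.measurableSet {k : ℕ} {Ω : Type*} [MeasurableSpace Ω]
    (S : ComputableSigmaAlgebra k Ω) {R : Set Ω} (hR : R ∈ S.sets) : MeasurableSet R := by
  have h := MeasurableSpace.measurableSet_generateFrom hR
  rwa [S.generateFrom_eq] at h

/-! ### Classes of measurable sets -/

/-- `A ∼ B` iff `μ(A Δ B) = 0`, on the measurable sets. -/
def nullSetoid {Ω : Type*} [MeasurableSpace Ω] (μ : Measure Ω) :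
    Setoid {A : Set Ω // MeasurableSet A} where
  r A B := μ (A.1 ∆ B.1) = 0
  iseqv :=
    { refl := fun A => by simp
      symm := fun {A B} h => by rwa [symmDiff_comm]
      trans := fun {A B C} h₁ h₂ => by
        rw [measure_symmDiff_eq_zero_iff] at *
        exact h₁.trans h₂ }

/-- The set `[𝒜]` of the classes of measurable sets. -/
def SetClass {Ω : Type*} [MeasurableSpace Ω] (μ : Measure Ω) : Type _ := Quotient (nullSetoid μ)

/-- The class `[A]`. -/
def SetClass.mk {Ω : Type*} [MeasurableSpace Ω] (μ : Measure Ω) (A : Set Ω)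
    (hA : MeasurableSet A) : SetClass μ :=
  Quotient.mk (nullSetoid μ) ⟨A, hA⟩

/-- `d̄(A, B) = ∑ᵢ 2⁻ⁱ · μ(Fᵢ ∩ (A Δ B)) / (1 + μ(Fᵢ ∩ (A Δ B)))`. -/
noncomputable def dBarSet {Ω : Type*} [MeasurableSpace Ω] (μ : Measure Ω) (F : ℕ → Set Ω)
    (A B : Set Ω) : ℝ :=
  ∑' i, μ.real (F i ∩ (A ∆ B)) / (1 + μ.real (F i ∩ (A ∆ B))) * (2 : ℝ)⁻¹ ^ i

theorem dBarSet_congr {Ω : Type*} [MeasurableSpace Ω] (μ : Measure Ω) (F : ℕ → Set Ω)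
    {A A' B B' : Set Ω} (hA : μ (A ∆ A') = 0) (hB : μ (B ∆ B') = 0) :
    dBarSet μ F A B = dBarSet μ F A' B' := by
  rw [measure_symmDiff_eq_zero_iff] at hA hB
  have h : ∀ i, μ.real (F i ∩ (A ∆ B)) = μ.real (F i ∩ (A' ∆ B')) := fun i =>
    measureReal_congr ((ae_eq_refl (F i)).inter (hA.symmDiff hB))
  simp only [dBarSet, h]

/-- The metric `d̄` on `[𝒜]`. -/
noncomputable def dBar {Ω : Type*} [MeasurableSpace Ω] (μ : Measure Ω) (F : ℕ → Set Ω) :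
    SetClass μ → SetClass μ → ℝ :=
  Quotient.lift₂ (s₁ := nullSetoid μ) (s₂ := nullSetoid μ) (fun A B => dBarSet μ F A.1 B.1)
    (fun _ _ _ _ hA hB => dBarSet_congr μ F hA hB)

/-- The set `[ℛ]` of the classes of ring elements. -/
def ComputableSigmaAlgebra.ringClasses {k : ℕ} {Ω : Type*} [MeasurableSpace Ω]
    (S : ComputableSigmaAlgebra k Ω) (μ : Measure Ω) : Set (SetClass μ) :=
  {c | ∃ (R : Set Ω) (hR : R ∈ S.sets), c = SetClass.mk μ R (S.measurableSet hR)}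

/-- The notation `β(w) = [α(w)]` of `[ℛ]`. -/
def ComputableSigmaAlgebra.β {k : ℕ} {Ω : Type*} [MeasurableSpace Ω]
    (S : ComputableSigmaAlgebra k Ω) (μ : Measure Ω) : Word k →. SetClass μ := fun w =>
  { Dom := (S.α w).Dom
    get := fun h => SetClass.mk μ ((S.α w).get h)
      (S.measurableSet ((S.α_range _).2 ⟨w, Part.get_mem h⟩)) }

/-- The partition-based representation: `ζ̄(p) = [A]` iff `p` is a list of all `(u, i, v, w)` such
that `ν_ℚ(u) < μ(Fᵢ ∩ α(v) ∩ A) < ν_ℚ(w)`; the number `i` is given by its `ν_ℕ`-name `n`. -/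
def ComputableSigmaAlgebra.ZetaBar {k : ℕ} {Ω : Type*} [MeasurableSpace Ω]
    (S : ComputableSigmaAlgebra k Ω) (μ : Measure Ω) (F : ℕ → Set Ω) (p : InfSeq k)
    (c : SetClass μ) : Prop :=
  ∃ (A : Set Ω) (hA : MeasurableSet A), c = SetClass.mk μ A hA ∧
    ∀ u n v w : Word k, Listed (tuple [u, n, v, w]) p ↔
      ∃ (a : ℚ) (i : ℕ) (R : Set Ω) (b : ℚ),
        IsRatName u a ∧ IsNatName n i ∧ R ∈ S.α v ∧ IsRatName w b ∧
        (a : ℝ) < μ.real (F i ∩ R ∩ A) ∧ μ.real (F i ∩ R ∩ A) < (b : ℝ)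

/-! The metric part rests on `t ↦ t / (1 + t)` being increasing, subadditive and bounded by `1` on
`t ≥ 0`. Hence `d̄` is a convergent weighted sum of pseudometrics, one for each `F i`, and it
separates classes because the `F i` cover `Ω`. The tail after `n` terms is at most `2 * 2⁻ⁿ`, so
closeness in `d̄` is closeness in measure on finitely many `F i`. There the measure is finite and
the generating ring approximates every measurable set (`exists_measureReal_lt`), which gives
density. The same tail bound makes `d̄` computable on the ring: dyadic approximations of the measure
give partial sums with a known error (`abs_distApprox_sub_le`).

From Cauchy names to `ζ̄`: if `d̄(V j, A) ≤ 2⁻ʲ` and `i < j`, then `μ(F i ∩ (V j ∆ A)) ≤ 2ⁱ⁺¹ / 2ʲ`.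
So `μ(F i ∩ R ∩ A)` differs by at most this much from `μ(F i ∩ R ∩ V j)`, the measure of a ring
element, and can be approximated with a known error.

From `ζ̄` to Cauchy names: `μ(F i ∩ (V ∆ A)) = μ(F i ∩ V) - μ(F i ∩ V ∩ A) + μ(F i ∩ (F i \ V) ∩
A)`. The first term is computable from a name of `V`, and the other two are bounded by entries of
the `ζ̄`-name. A finite part of the name can therefore certify that `V` is close to `A`, and density
guarantees that a search for such a `V` succeeds.

To get from these estimates to Type-2 machines, every task is phrased as a semidecidable relation
between the finite input, a prefix of the tape and the block to be written. Two general machines do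
the rest: one selects a suitable `j`-th block for every `j` (`exists_selectMachine`), the other
enumerates all suitable blocks (`exists_enumMachine`). The shape of `ι` ensures that a concatenation
of wrapped words lists these words and no others. -/

/-! ### Semidecidable predicates -/

section SemiDec

variable {α β γ : Type*} [Primcodable α] [Primcodable β] [Primcodable γ]

/-- A predicate is semidecidable if it is the projection of a computable relation. -/
def SemiDec (p : α → Prop) : Prop :=
  ∃ f : α → ℕ → Bool, Computable₂ f ∧ ∀ a, p a ↔ ∃ n, f a n = true

theorem SemiDec.of_iff {p q : α → Prop} (hp : SemiDec p) (h : ∀ a, q a ↔ p a) : SemiDec q := by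
  rwa [show q = p from funext fun a => propext (h a)]

theorem ComputablePred.semiDec {p : α → Prop} (hp : ComputablePred p) : SemiDec p := by
  obtain ⟨f, hf, rfl⟩ := ComputablePred.computable_iff.1 hp
  exact ⟨fun a _ => f a, hf.comp Computable.fst, fun a => by simp⟩

theorem PrimrecPred.semiDec {p : α → Prop} (hp : PrimrecPred p) : SemiDec p :=
  hp.computablePred.semiDec

theorem SemiDec.of_computable_eq [DecidableEq β] {f g : α → β} (hf : Computable f)
    (hg : Computable g) : SemiDec fun a => f a = g a := by
  refine ⟨fun a _ => decide (f a = g a), ?_, fun a => by simp⟩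
  exact (Primrec.eq.decide.to_comp.comp hf hg).comp Computable.fst

theorem SemiDec.of_computable_lt {f g : α → ℕ} (hf : Computable f)
    (hg : Computable g) : SemiDec fun a => f a < g a := by
  refine ⟨fun a _ => decide (f a < g a), ?_, fun a => by simp⟩
  exact (Primrec.nat_lt.decide.to_comp.comp hf hg).comp Computable.fst

theorem SemiDec.comp {p : β → Prop} (hp : SemiDec p) {g : α → β} (hg : Computable g) :
    SemiDec fun a => p (g a) := by
  obtain ⟨f, hf, h⟩ := hp
  exact ⟨fun a n => f (g a) n, hf.comp (hg.comp Computable.fst) Computable.snd, fun a => h _⟩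

/-- A witness for the conjunction is the pair of the two witnesses, coded as one number. -/
theorem SemiDec.and {p q : α → Prop} (hp : SemiDec p) (hq : SemiDec q) :
    SemiDec fun a => p a ∧ q a := by
  obtain ⟨f, hf, h⟩ := hp
  obtain ⟨g, hg, h'⟩ := hq
  refine ⟨fun a n => f a n.unpair.1 && g a n.unpair.2, ?_, fun a => ?_⟩
  · have hu := Computable.unpair.comp (Computable.snd (α := α))
    exact Primrec.and.to_comp.comp (hf.comp Computable.fst (Computable.fst.comp hu))
      (hg.comp Computable.fst (Computable.snd.comp hu))
  · beta_reduce
    rw [h, h']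
    constructor
    · rintro ⟨⟨m, hm⟩, n, hn⟩
      exact ⟨Nat.pair m n, by simp [hm, hn]⟩
    · rintro ⟨n, hn⟩
      rw [Bool.and_eq_true] at hn
      exact ⟨⟨_, hn.1⟩, _, hn.2⟩

theorem SemiDec.exists {p : α × β → Prop} (hp : SemiDec p) : SemiDec fun a => ∃ b, p (a, b) := by
  obtain ⟨f, hf, h⟩ := hp
  refine ⟨fun a n => ((Encodable.decode (α := β) n.unpair.1).map
    (fun b => f (a, b) n.unpair.2)).getD false, ?_, fun a => ?_⟩
  · have hu := Computable.unpair.comp (Computable.snd (α := α))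
    refine Computable.option_getD (Computable.option_map
      (Computable.decode.comp (Computable.fst.comp hu)) ?_) (Computable.const false)
    exact hf.comp ((Computable.fst.comp Computable.fst).pair Computable.snd)
      (Computable.snd.comp (hu.comp Computable.fst))
  · constructor
    · rintro ⟨b, hb⟩
      obtain ⟨n, hn⟩ := (h _).1 hb
      exact ⟨Nat.pair (Encodable.encode b) n, by simp [hn]⟩
    · rintro ⟨n, hn⟩
      cases hd : Encodable.decode (α := β) n.unpair.1 with
      | none => simp [hd] at hn
      | some b => exact ⟨b, (h _).2 ⟨n.unpair.2, by simpa [hd] using hn⟩⟩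

/-- The finitely many witnesses are guessed all at once as a list, so the bounded quantifier becomes
a single existential quantifier over lists followed by a recursive check. -/
theorem SemiDec.forall_lt {p : α × ℕ → Prop} (hp : SemiDec p) {N : α → ℕ} (hN : Computable N) :
    SemiDec fun a => ∀ i < N a, p (a, i) := by
  obtain ⟨f, hf, h⟩ := hp
  have key : SemiDec fun x : α × List ℕ =>
      Nat.rec (motive := fun _ => Bool) true
        (fun i b => b && f (x.1, i) (x.2.getD i 0)) (N x.1) = true := by
    refine SemiDec.of_computable_eq (Computable.nat_rec
      (h := fun (x : α × List ℕ) (y : ℕ × Bool) => y.2 && f (x.1, y.1) (x.2.getD y.1 0)) (hN.comp Computable.fst)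
      (Computable.const true) ?_) (Computable.const true)
    have h2 : Computable fun y : (α × List ℕ) × ℕ × Bool => y.2.1 :=
      Computable.fst.comp Computable.snd
    refine Primrec.and.to_comp.comp (Computable.snd.comp Computable.snd) (hf.comp
      ((Computable.fst.comp Computable.fst).pair h2) ?_)
    exact (Primrec.list_getD 0).to_comp.comp (Computable.snd.comp Computable.fst) h2
  refine key.exists.of_iff fun a => ?_
  have hrec : ∀ (l : List ℕ) (n : ℕ), Nat.rec (motive := fun _ => Bool) true
      (fun i b => b && f (a, i) (l.getD i 0)) n = true ↔
        ∀ i < n, f (a, i) (l.getD i 0) = true := by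
    intro l n
    induction n with
    | zero => simp
    | succ n ih =>
      simp only [Bool.and_eq_true, ih]
      constructor
      · rintro ⟨h₁, h₂⟩ i hi
        rcases Nat.lt_succ_iff_lt_or_eq.1 hi with hi | rfl
        exacts [h₁ i hi, h₂]
      · exact fun h' => ⟨fun i hi => h' i (by omega), h' n (by omega)⟩
  simp only [hrec]
  constructor
  · intro H
    have H' : ∀ i, ∃ n, i < N a → f (a, i) n = true := by
      intro i
      by_cases hi : i < N a
      · obtain ⟨n, hn⟩ := (h _).1 (H i hi)
        exact ⟨n, fun _ => hn⟩
      · exact ⟨0, fun h => absurd h hi⟩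
    choose w hw using H'
    refine ⟨(List.range (N a)).map w, fun i hi => ?_⟩
    have : ((List.range (N a)).map w).getD i 0 = w i := by simp [List.getD, hi]
    rw [this]
    exact hw i hi
  · rintro ⟨l, hl⟩ i hi
    exact (h _).2 ⟨_, hl i hi⟩

/-- The graph of a partial recursive function is semidecidable. -/
theorem Partrec.semiDec_graph {f : α →. β} (hf : Partrec f) :
    SemiDec fun x : α × β => x.2 ∈ f x.1 := by
  obtain ⟨c, hc⟩ := Nat.Partrec.Code.exists_code.1 hf
  refine ⟨fun x n => decide (Nat.Partrec.Code.evaln n c (Encodable.encode x.1) =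
    some (Encodable.encode x.2)), ?_, fun x => ?_⟩
  · refine Primrec.eq.decide.to_comp.comp (Nat.Partrec.Code.primrec_evaln.to_comp.comp
      ((Computable.snd.pair (Computable.const c)).pair
        (Computable.encode.comp (Computable.fst.comp Computable.fst))))
      (Computable.option_some.comp (Computable.encode.comp (Computable.snd.comp Computable.fst)))
  · have h1 : x.2 ∈ f x.1 ↔ Encodable.encode x.2 ∈ c.eval (Encodable.encode x.1) := by
      rw [hc]
      simp
    refine h1.trans (Nat.Partrec.Code.evaln_complete.trans ?_)
    simp

/-- Uniformization: a semidecidable relation that is total over a recursive set has a total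
computable choice function there. -/
theorem SemiDec.choose [Inhabited β] {p : α × β → Prop} (hp : SemiDec p) {D : α → Prop}
    (hD : ComputablePred D) (h : ∀ a, D a → ∃ b, p (a, b)) :
    ∃ f : α → β, Computable f ∧ ∀ a, D a → p (a, f a) := by
  classical
  obtain ⟨f, hf, hfp⟩ := hp
  obtain ⟨d, hd, rfl⟩ := ComputablePred.computable_iff.1 hD
  -- The number `n` proposes a candidate `b` together with a witness for it; unbounded search over
  -- `n` dovetails all such proposals.
  let s : α → ℕ → Option β := fun a n => (Encodable.decode (α := β) n.unpair.1).bind fun b =>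
    bif f (a, b) n.unpair.2 then some b else none
  have hs : Computable₂ s := by
    have hu := Computable.unpair.comp (Computable.snd (α := α))
    refine Computable.option_bind (Computable.decode.comp (Computable.fst.comp hu)) ?_
    refine Computable.cond (hf.comp ((Computable.fst.comp Computable.fst).pair Computable.snd)
      (Computable.snd.comp (hu.comp Computable.fst)))
      (Computable.option_some.comp Computable.snd) (Computable.const none)
  have hs' : ∀ a n b, s a n = some b → p (a, b) := by
    intro a n b hb
    cases hd : Encodable.decode (α := β) n.unpair.1 with
    | none => simp [s, hd] at hb
    | some b' =>
      cases hf' : f (a, b') n.unpair.2 with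
      | false => simp [s, hd, hf'] at hb
      | true =>
        have : b' = b := by simpa [s, hd, hf'] using hb
        exact this ▸ (hfp _).2 ⟨_, hf'⟩
  -- Outside the recursive set the search might not stop; answering `default` there keeps the
  -- function total.
  have hP : Partrec fun a => (bif d a then Nat.rfindOpt (s a) else Part.some default : Part β) :=
    Partrec.cond hd (Partrec.rfindOpt hs) (Computable.const default).partrec
  have hdom : ∀ a, (bif d a then Nat.rfindOpt (s a) else Part.some default : Part β).Dom := by
    intro a
    cases hda : d a with
    | false => simp
    | true =>
      obtain ⟨b, hb⟩ := h a hda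
      obtain ⟨n, hn⟩ := (hfp _).1 hb
      refine Nat.rfindOpt_dom.2 ⟨Nat.pair (Encodable.encode b) n, b, ?_⟩
      simp [s, hn]
  refine ⟨fun a => Part.get _ (hdom a), hP.of_eq_tot fun a => Part.get_mem _, fun a ha => ?_⟩
  have hm := Part.get_mem (hdom a)
  beta_reduce
  generalize Part.get _ (hdom a) = b at hm
  have ha' : d a = true := ha
  rw [ha'] at hm
  obtain ⟨n, hn⟩ := Nat.rfindOpt_spec hm
  exact hs' a n b hn

end SemiDec

/-! ### Machines that write a sequence of blocks -/

theorem List.IsPrefix.getElem?_of_eq_some {α : Type*} {l l' : List α} (h : l <+: l') {i : ℕ} {a : α}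
    (hi : l[i]? = some a) : l'[i]? = some a := by
  obtain ⟨r, rfl⟩ := h
  rw [List.getElem?_append_left (List.getElem?_eq_some_iff.1 hi).1, hi]

section Selection

variable {k : ℕ} {X V : Type} [Primcodable V]

/-- The part of the input tape that has been read after `n` moves of the head. -/
def tapePrefix {k : ℕ} (tape : ℕ → Option (Alphabet k)) (n : ℕ) : List (Option (Alphabet k)) :=
  (List.range n).map tape

/-- The candidate for the `j`-th block that is examined when the part `s` of the tape has been
read, and that is returned if the test `f` accepts it. -/
def selectCandidate (f : X × List (Option (Alphabet k)) × ℕ × V → ℕ → Bool) (x : X)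
    (s : List (Option (Alphabet k))) (j : ℕ) : Option V :=
  -- The time, which equals the length of the part read, decides what is examined: a prefix length,
  -- a candidate and a witness. Only the first component of the pairing is decoded, so every
  -- proposal recurs at arbitrarily late times.
  (Encodable.decode (α := ℕ × V × ℕ) s.length.unpair.1).bind fun c =>
    bif decide (c.1 ≤ s.length) && f (x, s.take c.1, j, c.2.1) c.2.2 then some c.2.1 else none

theorem selectCandidate_computable [Primcodable X] {f : X × List (Option (Alphabet k)) × ℕ × V → ℕ → Bool}
    (hf : Computable₂ f) : Computable fun y : X × List (Option (Alphabet k)) × ℕ =>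
      selectCandidate f y.1 y.2.1 y.2.2 := by
  have hs : Computable fun y : X × List (Option (Alphabet k)) × ℕ => y.2.1 :=
    Computable.fst.comp Computable.snd
  have hn := Computable.list_length.comp hs
  refine Computable.option_bind (Computable.decode.comp
    (Computable.fst.comp (Computable.unpair.comp hn))) ?_
  have hm : Computable fun z : (X × List (Option (Alphabet k)) × ℕ) × (ℕ × V × ℕ) => z.2.1 :=
    Computable.fst.comp Computable.snd
  have hv : Computable fun z : (X × List (Option (Alphabet k)) × ℕ) × (ℕ × V × ℕ) => z.2.2.1 :=
    Computable.fst.comp (Computable.snd.comp Computable.snd)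
  have ht : Computable fun z : (X × List (Option (Alphabet k)) × ℕ) × (ℕ × V × ℕ) => z.2.2.2 :=
    Computable.snd.comp (Computable.snd.comp Computable.snd)
  refine Computable.cond (Primrec.and.to_comp.comp
    (Primrec.nat_le.decide.to_comp.comp hm (hn.comp Computable.fst)) (hf.comp ?_ ht))
    (Computable.option_some.comp hv) (Computable.const none)
  exact (Computable.fst.comp Computable.fst).pair
    (((Primrec.list_take.to_comp.comp hm (hs.comp Computable.fst))).pair
      ((Computable.snd.comp (Computable.snd.comp Computable.fst)).pair hv))

/-- The transition function of the selection machine.  The memory holds the finite input, the part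
of the tape read so far, the number of selected blocks and the symbols still to be written. -/
def selectNext (f : X × List (Option (Alphabet k)) × ℕ × V → ℕ → Bool) (enc : V → Word k)
    (σ : X × List (Option (Alphabet k)) × ℕ × Word k) (o : Option (Alphabet k)) :
    (X × List (Option (Alphabet k)) × ℕ × Word k) × Option (Alphabet k) :=
  List.casesOn σ.2.2.2
    (Option.casesOn (selectCandidate f σ.1 σ.2.1 σ.2.2.1)
      ((σ.1, σ.2.1 ++ [o], σ.2.2.1, []), none)
      (fun v => ((σ.1, σ.2.1 ++ [o], σ.2.2.1 + 1, enc v), none)))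
    (fun c r => ((σ.1, σ.2.1 ++ [o], σ.2.2.1, r), some c))

theorem Computable.list_casesOn' {α β σ : Type*} [Primcodable α] [Primcodable β] [Primcodable σ]
    {f : α → List β} {g : α → σ} {h : α → β × List β → σ} (hf : Computable f)
    (hg : Computable g) (hh : Computable₂ h) :
    Computable fun a => @List.casesOn β (fun _ => σ) (f a) (g a) fun b l => h a (b, l) := by
  have h1 : Computable fun a => ((f a).head?).map fun b => (b, (f a).tail) :=
    Computable.option_map (Primrec.list_head?.to_comp.comp hf)
      (Computable.snd.pair (Primrec.list_tail.to_comp.comp (hf.comp Computable.fst)))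
  refine (Computable.option_casesOn h1 hg hh).of_eq fun a => ?_
  cases f a <;> rfl

theorem selectNext_computable [Primcodable X] {f : X × List (Option (Alphabet k)) × ℕ × V → ℕ → Bool}
    (hf : Computable₂ f) {enc : V → Word k} (henc : Computable enc) :
    Computable₂ (selectNext f enc) := by
  let T := (X × List (Option (Alphabet k)) × ℕ × Word k) × Option (Alphabet k)
  have h1 : Computable fun z : T => z.1.1 := Computable.fst.comp Computable.fst
  have h2 : Computable fun z : T => z.1.2.1 :=
    Computable.fst.comp (Computable.snd.comp Computable.fst)
  have h3 : Computable fun z : T => z.1.2.2.1 :=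
    Computable.fst.comp (Computable.snd.comp (Computable.snd.comp Computable.fst))
  have h4 : Computable fun z : T => z.1.2.2.2 :=
    Computable.snd.comp (Computable.snd.comp (Computable.snd.comp Computable.fst))
  have h5 : Computable fun z : T => z.1.2.1 ++ [z.2] :=
    Computable.list_concat.comp h2 Computable.snd
  have hc := (selectCandidate_computable hf).comp (h1.pair (h2.pair h3))
  refine Computable.list_casesOn' (f := fun z : T => z.1.2.2.2)
    (g := fun z : T => Option.casesOn (selectCandidate f z.1.1 z.1.2.1 z.1.2.2.1)
      ((z.1.1, z.1.2.1 ++ [z.2], z.1.2.2.1, []), none)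
      (fun v => ((z.1.1, z.1.2.1 ++ [z.2], z.1.2.2.1 + 1, enc v), none)))
    (h := fun z y => ((z.1.1, z.1.2.1 ++ [z.2], z.1.2.2.1, y.2), some y.1)) h4 ?_ ?_
  · refine Computable.option_casesOn hc ((h1.pair (h5.pair (h3.pair (Computable.const [])))).pair
      (Computable.const none)) ?_
    exact ((h1.comp Computable.fst).pair ((h5.comp Computable.fst).pair
      ((Computable.succ.comp (h3.comp Computable.fst)).pair
        (henc.comp Computable.snd)))).pair (Computable.const none)
  · exact ((h1.comp Computable.fst).pair ((h5.comp Computable.fst).pair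
      ((h3.comp Computable.fst).pair (Computable.snd.comp Computable.snd)))).pair
        (Computable.option_some.comp (Computable.fst.comp Computable.snd))

/-- The machine that writes `enc (v 0) enc (v 1) …`, where `v j` is the first candidate for the
`j`-th block that passes the test `f`. -/
def selectMachine [Primcodable X] (f : X × List (Option (Alphabet k)) × ℕ × V → ℕ → Bool) (hf : Computable₂ f)
    (enc : V → Word k) (henc : Computable enc) : TypeTwoMachine k X where
  start x := Encodable.encode ((x, [], 0, []) : X × List (Option (Alphabet k)) × ℕ × Word k)
  -- The head moves in every step, so exactly `t` cells are known after `t` steps. The default value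
  -- is never used in a run, as the memory is always a code.
  step m o := ((Encodable.decode (α := X × List (Option (Alphabet k)) × ℕ × Word k) m).map
    fun σ => (Encodable.encode (selectNext f enc σ o).1, true, (selectNext f enc σ o).2)).getD
      (0, true, none)
  start_computable := Computable.encode.comp (Computable.id.pair (Computable.const ([], 0, [])))
  step_computable := by
    refine Computable.option_getD (Computable.option_map
      (Computable.decode.comp Computable.fst) ?_) (Computable.const (0, true, none))
    have h := (selectNext_computable hf henc).comp
      (Computable.snd (α := ℕ × Option (Alphabet k)))
      (Computable.snd.comp Computable.fst)
    exact (Computable.encode.comp (Computable.fst.comp h)).pair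
      ((Computable.const true).pair (Computable.snd.comp h))

/-- The blocks selected, the symbols still to be written, and the output of the selection machine
after `t` steps. -/
def selectTrace (f : X × List (Option (Alphabet k)) × ℕ × V → ℕ → Bool) (enc : V → Word k) (x : X)
    (tape : ℕ → Option (Alphabet k)) : ℕ → List V × Word k × Word k
  | 0 => ([], [], [])
  | t + 1 =>
    let c := selectTrace f enc x tape t
    match c.2.1 with
    | [] =>
      match selectCandidate f x (tapePrefix tape t) c.1.length with
      | none => (c.1, [], c.2.2)
      | some v => (c.1 ++ [v], enc v, c.2.2)
    | a :: r => (c.1, r, c.2.2 ++ [a])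

theorem tapePrefix_succ (tape : ℕ → Option (Alphabet k)) (n : ℕ) :
    tapePrefix tape (n + 1) = tapePrefix tape n ++ [tape n] := by
  simp [tapePrefix, List.range_succ]

@[simp] theorem tapePrefix_length (tape : ℕ → Option (Alphabet k)) (n : ℕ) :
    (tapePrefix tape n).length = n := by
  simp [tapePrefix]

theorem tapePrefix_take (tape : ℕ → Option (Alphabet k)) {m n : ℕ} (h : m ≤ n) :
    (tapePrefix tape n).take m = tapePrefix tape m := by
  rw [tapePrefix, ← List.map_take, List.take_range, min_eq_left h]
  rfl

theorem tapePrefix_prefix (tape : ℕ → Option (Alphabet k)) {m n : ℕ} (h : m ≤ n) :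
    tapePrefix tape m <+: tapePrefix tape n := by
  rw [← tapePrefix_take tape h]
  exact List.take_prefix _ _

theorem selectMachine_run [Primcodable X] (f : X × List (Option (Alphabet k)) × ℕ × V → ℕ → Bool)
    (hf : Computable₂ f) (enc : V → Word k) (henc : Computable enc) (x : X)
    (tape : ℕ → Option (Alphabet k)) (t : ℕ) :
    (selectMachine f hf enc henc).run x tape t =
      ⟨Encodable.encode (x, tapePrefix tape t, (selectTrace f enc x tape t).1.length,
        (selectTrace f enc x tape t).2.1), t, (selectTrace f enc x tape t).2.2⟩ := by
  induction t with
  | zero => rfl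
  | succ t ih =>
    rw [TypeTwoMachine.run, ih, selectTrace, tapePrefix_succ]
    generalize selectTrace f enc x tape t = c
    obtain ⟨E, q, out⟩ := c
    cases q with
    | cons a r => simp [selectMachine, selectNext]
    | nil =>
      cases hc : selectCandidate f x (tapePrefix tape t) E.length with
      | none => simp [selectMachine, selectNext, hc]
      | some v => simp [selectMachine, selectNext, hc]

/-- Correctness of the machine: nothing but selected blocks is ever written or queued, and a block
is selected only after the test has accepted it on a genuine prefix of the tape. -/
theorem selectTrace_invariant (f : X × List (Option (Alphabet k)) × ℕ × V → ℕ → Bool)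
    (enc : V → Word k) (x : X) (tape : ℕ → Option (Alphabet k)) (t : ℕ) :
    (selectTrace f enc x tape t).2.2 ++ (selectTrace f enc x tape t).2.1 =
      (selectTrace f enc x tape t).1.flatMap enc ∧
    ∀ j v, (selectTrace f enc x tape t).1[j]? = some v →
      ∃ n i, f (x, tapePrefix tape n, j, v) i = true := by
  induction t with
  | zero => simp [selectTrace]
  | succ t ih =>
    rw [selectTrace]
    generalize selectTrace f enc x tape t = c at ih
    obtain ⟨E, q, out⟩ := c
    obtain ⟨ih1, ih2⟩ := ih
    cases q with
    | cons a r => exact ⟨by simpa using ih1, ih2⟩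
    | nil =>
      cases hc : selectCandidate f x (tapePrefix tape t) E.length with
      | none => exact ⟨by simpa [hc] using ih1, by simpa [hc] using ih2⟩
      | some v =>
        refine ⟨by simpa [hc] using ih1, fun j w hw => ?_⟩
        simp only at hw
        rcases lt_or_ge j E.length with hj | hj
        · rw [List.getElem?_append_left hj] at hw
          exact ih2 j w hw
        · rw [List.getElem?_append_right hj] at hw
          have hj' : j = E.length := by
            by_contra hne
            rw [List.getElem?_eq_none (by simp; omega)] at hw
            cases hw
          subst hj'
          have hvw : v = w := by simpa using hw
          subst hvw
          rw [selectCandidate, Option.bind_eq_some_iff] at hc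
          obtain ⟨⟨m, v', i⟩, -, h2⟩ := hc
          simp only [tapePrefix_length] at h2
          cases hb : decide (m ≤ t) && f (x, (tapePrefix tape t).take m, E.length, v') i with
          | false => simp [hb] at h2
          | true =>
            rw [hb] at h2
            rw [Bool.and_eq_true, decide_eq_true_eq] at hb
            rw [tapePrefix_take _ hb.1] at hb
            have : v' = v := by simpa using h2
            exact ⟨m, i, this ▸ hb.2⟩

theorem selectTrace_prefix (f : X × List (Option (Alphabet k)) × ℕ × V → ℕ → Bool)
    (enc : V → Word k) (x : X) (tape : ℕ → Option (Alphabet k)) {t t' : ℕ} (h : t ≤ t') :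
    (selectTrace f enc x tape t).1 <+: (selectTrace f enc x tape t').1 := by
  induction t', h using Nat.le_induction with
  | base => exact List.prefix_rfl
  | succ t' _ ih =>
    refine ih.trans ?_
    rw [selectTrace]
    generalize selectTrace f enc x tape t' = c
    obtain ⟨E, q, out⟩ := c
    cases q with
    | cons a r => exact List.prefix_rfl
    | nil =>
      cases hc : selectCandidate f x (tapePrefix tape t') E.length with
      | none => simp
      | some v => simp

/-- The queue of the selection machine gets empty, without any change of the selected blocks. -/
theorem selectTrace_flush (f : X × List (Option (Alphabet k)) × ℕ × V → ℕ → Bool)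
    (enc : V → Word k) (x : X) (tape : ℕ → Option (Alphabet k)) (t : ℕ) :
    ∃ t', t ≤ t' ∧ (selectTrace f enc x tape t').1 = (selectTrace f enc x tape t).1 ∧
      (selectTrace f enc x tape t').2.1 = [] := by
  generalize hq : (selectTrace f enc x tape t).2.1 = q
  induction q generalizing t with
  | nil => exact ⟨t, le_rfl, rfl, hq⟩
  | cons a r ih =>
    have h1 : selectTrace f enc x tape (t + 1) = ((selectTrace f enc x tape t).1, r,
        (selectTrace f enc x tape t).2.2 ++ [a]) := by
      rw [selectTrace]
      simp only [hq]
    obtain ⟨t', ht, he, hq'⟩ := ih (t + 1) (by rw [h1])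
    exact ⟨t', by omega, by rw [he, h1], hq'⟩

/-- Liveness of the machine. Once the queue is empty it stays empty until a candidate is accepted,
and each acceptable proposal comes up again at some later time. -/
theorem selectTrace_progress (f : X × List (Option (Alphabet k)) × ℕ × V → ℕ → Bool)
    (enc : V → Word k) (x : X) (tape : ℕ → Option (Alphabet k))
    (h : ∀ j, ∃ n v i, f (x, tapePrefix tape n, j, v) i = true) (j : ℕ) :
    ∃ t, j ≤ (selectTrace f enc x tape t).1.length ∧ (selectTrace f enc x tape t).2.1 = [] := by
  induction j with
  | zero =>
    obtain ⟨t, -, -, ht⟩ := selectTrace_flush f enc x tape 0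
    exact ⟨t, Nat.zero_le _, ht⟩
  | succ j ih =>
    obtain ⟨t, hj, hq⟩ := ih
    suffices H : ∃ t', j + 1 ≤ (selectTrace f enc x tape t').1.length by
      obtain ⟨t', ht'⟩ := H
      obtain ⟨t'', -, he, hq'⟩ := selectTrace_flush f enc x tape t'
      exact ⟨t'', he ▸ ht', hq'⟩
    rcases Nat.lt_or_ge j (selectTrace f enc x tape t).1.length with hlt | hge
    · exact ⟨t, hlt⟩
    have hlen : (selectTrace f enc x tape t).1.length = j := le_antisymm hge hj
    obtain ⟨n, v, i, hv⟩ := h j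
    let c := Encodable.encode (n, v, i)
    -- A time that proposes `(n, v, i)`, is not before `t`, and by which `n` cells have been read.
    let T := Nat.pair c (max t n)
    have hT : t ≤ T ∧ n ≤ T :=
      ⟨(le_max_left _ _).trans (Nat.right_le_pair _ _), (le_max_right _ _).trans (Nat.right_le_pair _ _)⟩
    by_contra H
    push Not at H
    have hstay : ∀ s, t ≤ s → (selectTrace f enc x tape s).1.length = j ∧
        (selectTrace f enc x tape s).2.1 = [] := by
      intro s hs
      induction s, hs using Nat.le_induction with
      | base => exact ⟨hlen, hq⟩
      | succ s hs ih =>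
        have hs' := H (s + 1)
        rw [selectTrace] at hs' ⊢
        generalize selectTrace f enc x tape s = c at ih hs'
        obtain ⟨E, q, out⟩ := c
        obtain ⟨hE, rfl⟩ : E.length = j ∧ q = [] := ih
        cases hc : selectCandidate f x (tapePrefix tape s) E.length with
        | none => simp [hE]
        | some v =>
          rw [hc] at hs'
          simp [hE] at hs'
    have hcand : selectCandidate f x (tapePrefix tape T) j = some v := by
      rw [selectCandidate, tapePrefix_length]
      have : (Encodable.decode T.unpair.1 : Option (ℕ × V × ℕ)) = some (n, v, i) := by
        simp [T, c]
      rw [this, Option.bind_some]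
      simp only [tapePrefix_take _ hT.2, hv, hT.2]
      rfl
    have hH := H (T + 1)
    obtain ⟨h1, h2⟩ := hstay T hT.1
    rw [selectTrace] at hH
    simp only [h1, h2, hcand] at hH
    simp [h1] at hH

/-! ### Infinite concatenations of words and the two general machines -/

theorem occursAt_zero_iff {u : Word k} {p : InfSeq k} :
    OccursAt u p 0 ↔ ∀ i a, u[i]? = some a → p i = a := by
  unfold OccursAt
  simp only [Nat.zero_add]
  constructor
  · intro h i a hi
    rw [← h] at hi
    rw [List.getElem?_map] at hi
    rcases Nat.lt_or_ge i u.length with hlt | hge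
    · simpa [List.getElem?_range hlt] using hi
    · simp [hge] at hi
  · intro h
    refine List.ext_getElem? fun i => ?_
    rw [List.getElem?_map]
    rcases Nat.lt_or_ge i u.length with hlt | hge
    · rw [List.getElem?_range hlt]
      simp [h i _ (List.getElem?_eq_getElem hlt), hlt]
    · simp [hge]

/-- The infinite concatenation of nonempty words. -/
theorem exists_seq_concat (e : ℕ → Word k) (he : ∀ n, e n ≠ []) :
    ∃ p : InfSeq k, ∀ n, OccursAt ((List.range n).flatMap e) p 0 := by
  have hlen : ∀ n, n ≤ ((List.range n).flatMap e).length := by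
    intro n
    induction n with
    | zero => simp
    | succ n ih =>
      have := List.length_pos_iff.2 (he n)
      simp only [List.range_succ, List.flatMap_append, List.length_append, List.flatMap_singleton]
      omega
  have hpre : ∀ m n, m ≤ n → (List.range m).flatMap e <+: (List.range n).flatMap e := by
    intro m n h
    induction n, h using Nat.le_induction with
    | base => exact List.prefix_rfl
    | succ n _ ih =>
      rw [List.range_succ, List.flatMap_append]
      exact ih.trans (List.prefix_append _ _)
  refine ⟨fun i => ((List.range (i + 1)).flatMap e).getD i 0, fun n => ?_⟩
  rw [occursAt_zero_iff]
  intro i a hi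
  have hi' : i < ((List.range (i + 1)).flatMap e).length := hlen (i + 1)
  have h1 : ((List.range (i + 1)).flatMap e)[i]? = some a := by
    rcases le_total n (i + 1) with h | h
    · exact (hpre _ _ h).getElem?_of_eq_some hi
    · have h2 := (hpre _ _ h).getElem?_of_eq_some (List.getElem?_eq_getElem hi')
      rw [List.getElem?_eq_getElem hi', ← h2, hi]
  simp [List.getD, h1]

/-- Selection machines: if the relation `R` is semidecidable in the finite input, a prefix of the
tape, the number of the block and the block, then a machine writes `enc (v 0) enc (v 1) …` for
some sequence `v` all of whose members satisfy the relation. -/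
theorem exists_selectMachine [Primcodable X] {R : X × List (Option (Alphabet k)) × ℕ × V → Prop} (hR : SemiDec R)
    {enc : V → Word k} (henc : Computable enc) (hne : ∀ v, enc v ≠ []) :
    ∃ M : TypeTwoMachine k X, ∀ x tape, (∀ j, ∃ n v, R (x, tapePrefix tape n, j, v)) →
      ∃ (v : ℕ → V) (q : InfSeq k), M.Writes x tape q ∧
        (∀ j, ∃ n, R (x, tapePrefix tape n, j, v j)) ∧
        ∀ n, OccursAt ((List.range n).flatMap fun j => enc (v j)) q 0 := by
  obtain ⟨f, hf, hfR⟩ := hR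
  refine ⟨selectMachine f hf enc henc, fun x tape hx => ?_⟩
  have hx' : ∀ j, ∃ n v i, f (x, tapePrefix tape n, j, v) i = true := by
    intro j
    obtain ⟨n, v, hv⟩ := hx j
    exact ⟨n, v, (hfR _).1 hv⟩
  have hprog := selectTrace_progress f enc x tape hx'
  choose T hT hTq using hprog
  -- The list of selected blocks only grows, so its entry `j` is the same at all times at which it
  -- exists.
  have hex : ∀ j, ∃ v, (selectTrace f enc x tape (T (j + 1))).1[j]? = some v := fun j =>
    ⟨_, List.getElem?_eq_getElem (lt_of_lt_of_le (Nat.lt_succ_self j) (hT (j + 1)))⟩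
  choose v hv using hex
  have htake : ∀ n, (selectTrace f enc x tape (T n)).1.take n = (List.range n).map v := by
    intro n
    refine List.ext_getElem? fun i => ?_
    rw [List.getElem?_map, List.getElem?_take]
    split_ifs with hi
    · rw [List.getElem?_range hi, Option.map_some]
      have hlen : i < (selectTrace f enc x tape (T n)).1.length := lt_of_lt_of_le hi (hT n)
      rcases le_total (T n) (T (i + 1)) with h | h
      · rw [← hv i, (selectTrace_prefix f enc x tape h).getElem?_of_eq_some
          (List.getElem?_eq_getElem hlen), List.getElem?_eq_getElem hlen]
      · exact (selectTrace_prefix f enc x tape h).getElem?_of_eq_some (hv i)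
    · simp [not_lt.1 hi]
  obtain ⟨q, hq⟩ := exists_seq_concat (fun j => enc (v j)) fun j => hne _
  refine ⟨v, q, fun n => ?_, fun j => ?_, hq⟩
  · refine ⟨T (n + 1), ?_⟩
    rw [selectMachine_run]
    have h1 := (selectTrace_invariant f enc x tape (T (n + 1))).1
    rw [hTq, List.append_nil] at h1
    simp only [h1]
    have h2 : ((List.range (n + 1)).flatMap fun j => enc (v j)) <+:
        (selectTrace f enc x tape (T (n + 1))).1.flatMap enc := by
      have : ((List.range (n + 1)).flatMap fun j => enc (v j)) =
          ((selectTrace f enc x tape (T (n + 1))).1.take (n + 1)).flatMap enc := by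
        rw [htake, List.flatMap_map]
      rw [this]
      conv_rhs => rw [← List.take_append_drop (n + 1) (selectTrace f enc x tape (T (n + 1))).1,
        List.flatMap_append]
      exact List.prefix_append _ _
    have h3 : n < ((List.range (n + 1)).flatMap fun j => enc (v j)).length := by
      clear * - hne
      induction n with
      | zero => simpa using List.length_pos_iff.2 (hne (v 0))
      | succ n ih =>
        have := List.length_pos_iff.2 (hne (v (n + 1)))
        rw [List.range_succ, List.flatMap_append, List.length_append, List.flatMap_singleton]
        omega
    rw [h2.getElem?_of_eq_some (List.getElem?_eq_getElem h3)]
    exact congrArg some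
      (occursAt_zero_iff.1 (hq (n + 1)) n _ (List.getElem?_eq_getElem h3)).symm
  · obtain ⟨n, i, h⟩ := (selectTrace_invariant f enc x tape (T (j + 1))).2 j (v j) (hv j)
    exact ⟨n, (hfR _).2 ⟨i, h⟩⟩

/-- Enumeration machines: if `Q` is semidecidable, and monotone in the prefix of the tape, then a
machine writes `enc (v 0) enc (v 1) …`, where `v` enumerates the objects that satisfy `Q` for some
prefix of the tape. -/
theorem exists_enumMachine [Primcodable X] {Q : X × List (Option (Alphabet k)) × V → Prop} (hQ : SemiDec Q)
    (hmono : ∀ x s s' v, s <+: s' → Q (x, s, v) → Q (x, s', v))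
    {enc : V → Word k} (henc : Computable enc) (hne : ∀ v, enc v ≠ []) :
    ∃ M : TypeTwoMachine k X, ∀ x tape, (∃ n v, Q (x, tapePrefix tape n, v)) →
      ∃ (v : ℕ → V) (q : InfSeq k), M.Writes x tape q ∧
        (∀ w, (∃ j, v j = w) ↔ ∃ n, Q (x, tapePrefix tape n, w)) ∧
        ∀ n, OccursAt ((List.range n).flatMap fun j => enc (v j)) q 0 := by
  classical
  have hQ' := hQ
  obtain ⟨f, hf, hfQ⟩ := hQ'
  let D := ℕ × V × ℕ
  -- The block number is read as a claim `(n, w, i)`: that `f` accepts `w` on the prefix of length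
  -- `n` with witness `i`. If the claim is true, the block has to be `w`; if it is false, or if the
  -- number codes no claim, any block satisfying `Q` will do. The claim is decidable once `n` cells
  -- have been read. Blocks are compared through their codes.
  let P : X × List (Option (Alphabet k)) × ℕ × V → D → Bool := fun y c =>
    decide (c.1 ≤ y.2.1.length) && (!f (y.1, y.2.1.take c.1, c.2.1) c.2.2 ||
      decide (Encodable.encode y.2.2.2 = Encodable.encode c.2.1))
  let R : X × List (Option (Alphabet k)) × ℕ × V → Prop := fun y =>
    Q (y.1, y.2.1, y.2.2.2) ∧ (((Encodable.decode (α := D) y.2.2.1).map (P y)).getD true) = true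
  have hR : SemiDec R := by
    have hv : Computable fun y : X × List (Option (Alphabet k)) × ℕ × V => y.2.2.2 :=
      Computable.snd.comp (Computable.snd.comp Computable.snd)
    have hj : Computable fun y : X × List (Option (Alphabet k)) × ℕ × V => y.2.2.1 :=
      Computable.fst.comp (Computable.snd.comp Computable.snd)
    have hs : Computable fun y : X × List (Option (Alphabet k)) × ℕ × V => y.2.1 :=
      Computable.fst.comp Computable.snd
    refine (hQ.comp (Computable.fst.pair (hs.pair hv))).and
      (SemiDec.of_computable_eq (Computable.option_getD
        (Computable.option_map (Computable.decode.comp hj) ?_) (Computable.const true))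
        (Computable.const true))
    let Z := (X × List (Option (Alphabet k)) × ℕ × V) × D
    have hm : Computable fun z : Z => z.2.1 := Computable.fst.comp Computable.snd
    have hw : Computable fun z : Z => z.2.2.1 :=
      Computable.fst.comp (Computable.snd.comp Computable.snd)
    have ht : Computable fun z : Z => z.2.2.2 :=
      Computable.snd.comp (Computable.snd.comp Computable.snd)
    have hs' : Computable fun z : Z => z.1.2.1 := hs.comp Computable.fst
    exact Primrec.and.to_comp.comp
      (Primrec.nat_le.decide.to_comp.comp hm (Computable.list_length.comp hs'))
      (Primrec.or.to_comp.comp (Primrec.not.to_comp.comp (hf.comp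
        ((Computable.fst.comp Computable.fst).pair
          ((Primrec.list_take.to_comp.comp hm hs').pair hw)) ht))
        (Primrec.eq.decide.to_comp.comp (Computable.encode.comp (hv.comp Computable.fst))
          (Computable.encode.comp hw)))
  obtain ⟨M, hM⟩ := exists_selectMachine hR henc hne
  refine ⟨M, fun x tape ⟨n₀, v₀, hv₀⟩ => ?_⟩
  have hx : ∀ j, ∃ n v, R (x, tapePrefix tape n, j, v) := by
    intro j
    cases hd : Encodable.decode (α := D) j with
    | none => exact ⟨n₀, v₀, hv₀, by simp [hd]⟩
    | some c =>
      obtain ⟨m, w, i⟩ := c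
      by_cases hmw : f (x, tapePrefix tape m, w) i = true
      · refine ⟨m, w, (hfQ _).2 ⟨i, hmw⟩, ?_⟩
        simp [hd, P]
      -- A false claim is answered by the filler `v₀`, on a prefix long enough to refute the claim;
      -- monotonicity keeps `v₀` admissible there.
      · refine ⟨max m n₀, v₀, hmono _ _ _ _ (tapePrefix_prefix tape (le_max_right _ _)) hv₀, ?_⟩
        simp [hd, P, tapePrefix_take _ (le_max_left m n₀), hmw]
  obtain ⟨v, q, hW, hv, hq⟩ := hM x tape hx
  refine ⟨v, q, hW, fun w => ⟨?_, ?_⟩, hq⟩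
  · rintro ⟨j, rfl⟩
    obtain ⟨n, hn⟩ := hv j
    exact ⟨n, hn.1⟩
  · rintro ⟨n, hn⟩
    obtain ⟨i, hi⟩ := (hfQ _).1 hn
    -- The block whose number codes the true claim about `w` is forced to be `w`.
    obtain ⟨N, -, hN⟩ := hv (Encodable.encode ((n, w, i) : D))
    refine ⟨Encodable.encode ((n, w, i) : D), ?_⟩
    simp only [Encodable.encodek, Option.map_some, Option.getD_some, P, Bool.and_eq_true,
      decide_eq_true_eq, tapePrefix_length, Bool.or_eq_true, Bool.not_eq_true'] at hN
    obtain ⟨hnN, hN⟩ := hN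
    rw [tapePrefix_take _ hnN, hi] at hN
    exact Encodable.encode_injective (hN.resolve_left (by simp))

end Selection

/-! ### Combinatorics of wrapped words -/

section Words

variable {k : ℕ}

theorem wrap_eq (w : Word k) :
    wrap w = 1 :: 1 :: (w.flatMap (fun a => [0, a]) ++ [0, 1, 1]) := rfl

theorem wrap_ne_nil (w : Word k) : wrap w ≠ [] := by simp [wrap_eq]

theorem tuple_cons (w : Word k) (l : List (Word k)) : tuple (w :: l) = wrap w ++ tuple l := rfl

theorem tuple_append (l l' : List (Word k)) : tuple (l ++ l') = tuple l ++ tuple l' :=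
  List.flatMap_append

theorem tuple_singleton (w : Word k) : tuple [w] = wrap w := by simp [tuple]

theorem length_le_length_tuple (l : List (Word k)) : l.length ≤ (tuple l).length := by
  induction l with
  | nil => simp
  | cons w l ih =>
    rw [tuple_cons, List.length_append, wrap_eq]
    simp only [List.length_cons]
    omega

/-- Each letter is preceded by the marker `0`. In the closing `011` the last `1` stands where the
next marker would be, so the end is recognised when reading from the left. -/
theorem wrapTail_append_inj : ∀ {w w' : Word k} {r r' : Word k},
    w.flatMap (fun a => [0, a]) ++ [0, 1, 1] ++ r = w'.flatMap (fun a => [0, a]) ++ [0, 1, 1] ++ r' →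
      w = w' ∧ r = r'
  | [], [], r, r', h => by simpa using h
  | [], a :: w', r, r', h => by cases w' <;> simp at h
  | a :: w, [], r, r', h => by cases w <;> simp at h
  | a :: w, b :: w', r, r', h => by
    simp only [List.flatMap_cons, List.cons_append, List.nil_append, List.cons.injEq,
      true_and] at h
    obtain ⟨h1, h2⟩ := wrapTail_append_inj (w := w) (w' := w') (by simpa using h.2)
    exact ⟨by rw [h.1, h1], h2⟩

theorem wrap_append_inj {w w' r r' : Word k} (h : wrap w ++ r = wrap w' ++ r') :
    w = w' ∧ r = r' := by
  simp only [wrap_eq, List.cons_append, List.cons.injEq, true_and] at h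
  exact wrapTail_append_inj h

theorem tuple_append_prefix {l l' : List (Word k)} {r r' : Word k}
    (h : tuple l ++ r = tuple l' ++ r') (hl : l.length ≤ l'.length) : l <+: l' := by
  induction l generalizing l' with
  | nil => exact List.nil_prefix
  | cons w l ih =>
    cases l' with
    | nil => simp at hl
    | cons w' l' =>
      rw [tuple_cons, tuple_cons, List.append_assoc, List.append_assoc] at h
      obtain ⟨rfl, h'⟩ := wrap_append_inj h
      exact List.cons_prefix_cons.2 ⟨rfl, ih h' (by simpa using hl)⟩

theorem tuple_injective {l l' : List (Word k)} (h : tuple l = tuple l') : l = l' := by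
  rcases le_total l.length l'.length with hl | hl
  · obtain ⟨m, rfl⟩ := tuple_append_prefix (r := []) (r' := []) (by simpa using h) hl
    rw [tuple_append] at h
    have h1 : tuple m = [] := by simpa using h
    cases m with
    | nil => simp
    | cons w m => simp [tuple_cons, wrap_ne_nil] at h1
  · obtain ⟨m, rfl⟩ := tuple_append_prefix (r := []) (r' := []) (by simpa using h.symm) hl
    rw [tuple_append] at h
    have h1 : tuple m = [] := by simpa using h
    cases m with
    | nil => simp
    | cons w m => simp [tuple_cons, wrap_ne_nil] at h1

/-- The pattern `110` does not begin in the middle of a wrapped word. -/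
theorem length_le_of_wrapTail_append : ∀ {w x a b : Word k},
    (x = [] ∨ ∃ y, x = 1 :: 1 :: y) →
    w.flatMap (fun a => [0, a]) ++ [0, 1, 1] ++ x = a ++ 1 :: 1 :: 0 :: b →
      (w.flatMap (fun a => [0, a]) ++ [0, 1, 1]).length ≤ a.length
  | w, x, [], b, _, h => by cases w <;> simp at h
  -- Starting at the first or second `1` of the closing `011`, the pattern would need a `0` where
  -- there is a `1` or the end of the word, since what follows is empty or begins with `11`.
  | [], x, [c], b, hx, h => by
    rcases hx with rfl | ⟨y, rfl⟩ <;> simp at h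
  | [], x, [c, d], b, hx, h => by
    rcases hx with rfl | ⟨y, rfl⟩ <;> simp at h
  | [], x, c :: d :: e :: a, b, hx, h => by simp
  | e :: w, x, [c], b, hx, h => by cases w <;> simp at h
  | e :: w, x, c :: d :: a, b, hx, h => by
    have := length_le_of_wrapTail_append (w := w) (a := a) (b := b) hx (by
      simp only [List.flatMap_cons, List.cons_append, List.nil_append, List.cons.injEq] at h
      simpa using h.2.2)
    simpa using this

theorem tuple_eq_nil_or (l : List (Word k)) : tuple l = [] ∨ ∃ y, tuple l = 1 :: 1 :: y := by
  cases l with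
  | nil => exact Or.inl rfl
  | cons w l => exact Or.inr ⟨_, rfl⟩

theorem wrap_eq' (w : Word k) : ∃ y, wrap w = 1 :: 1 :: 0 :: y := by
  cases w with
  | nil => exact ⟨_, rfl⟩
  | cons a w => exact ⟨_, rfl⟩

/-- A wrapped word that occurs in a tuple is one of the entries. -/
theorem mem_of_wrap_infix {l : List (Word k)} {w a b : Word k}
    (h : tuple l = a ++ wrap w ++ b) : w ∈ l := by
  induction l generalizing a with
  | nil =>
    have := congrArg List.length h
    simp [tuple, wrap_eq] at this
  | cons v l ih =>
    rw [tuple_cons] at h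
    obtain ⟨y, hy⟩ := wrap_eq' w
    -- An occurrence that starts within the first block starts at its beginning, because a wrapped
    -- word begins with `110`. All others lie in the remaining blocks.
    rcases Nat.lt_or_ge a.length (wrap v).length with hlt | hge
    · match a, h, hlt with
      | [], h, _ =>
        rw [List.nil_append] at h
        exact List.mem_cons.2 (Or.inl (wrap_append_inj h).1.symm)
      | [c], h, _ =>
        rw [hy, wrap_eq] at h
        cases v <;> simp at h
      | c :: d :: a, h, hlt =>
        exfalso
        rw [hy, wrap_eq] at h
        simp only [List.cons_append, List.cons.injEq] at h
        have := length_le_of_wrapTail_append (w := v) (a := a) (b := y ++ b) (tuple_eq_nil_or l)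
          (by simpa using h.2.2)
        rw [wrap_eq] at hlt
        simp only [List.length_cons] at hlt
        omega
    · obtain ⟨a', rfl⟩ : wrap v <+: a := by
        refine List.prefix_of_prefix_length_le (l₃ := wrap v ++ tuple l) (List.prefix_append _ _)
          ?_ hge
        rw [h, List.append_assoc]
        exact List.prefix_append _ _
      rw [List.append_assoc, List.append_assoc] at h
      exact List.mem_cons.2 (Or.inr (ih (a := a') (by
        rw [List.append_assoc]; exact List.append_cancel_left h)))

/-! ### Words that are listed by a sequence -/

theorem occursAt_iff_prefix {u : Word k} {p : InfSeq k} :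
    OccursAt u p 0 ↔ (List.range u.length).map p = u := by
  simp [OccursAt]

theorem occursAt_nil (p : InfSeq k) (i : ℕ) : OccursAt [] p i := rfl

theorem occursAt_cons {a : Alphabet k} {u : Word k} {p : InfSeq k} {i : ℕ} :
    OccursAt (a :: u) p i ↔ p i = a ∧ OccursAt u p (i + 1) := by
  unfold OccursAt
  rw [List.length_cons, List.range_succ_eq_map, List.map_cons, List.map_map, List.cons.injEq]
  refine and_congr (by simp) ?_
  rw [show (fun j => p (i + j)) ∘ Nat.succ = fun j => p (i + 1 + j) from
    funext fun j => congrArg p (by simp; omega)]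

theorem occursAt_append {u v : Word k} {p : InfSeq k} {i : ℕ} :
    OccursAt (u ++ v) p i ↔ OccursAt u p i ∧ OccursAt v p (i + u.length) := by
  induction u generalizing i with
  | nil => simp [occursAt_nil]
  | cons a u ih =>
    rw [List.cons_append, occursAt_cons, ih, occursAt_cons, and_assoc, List.length_cons,
      show i + 1 + u.length = i + (u.length + 1) by omega]

theorem occursAt_prefix (p : InfSeq k) (n : ℕ) : OccursAt ((List.range n).map p) p 0 := by
  simp [occursAt_iff_prefix]

theorem isSubword_iff {u : Word k} {p : InfSeq k} :
    IsSubword u p ↔ ∃ n a b, (List.range n).map p = a ++ u ++ b := by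
  constructor
  · rintro ⟨i, hi⟩
    have h : OccursAt ((List.range i).map p ++ u) p 0 :=
      occursAt_append.2 ⟨occursAt_prefix p i, by simpa using hi⟩
    refine ⟨((List.range i).map p ++ u).length, (List.range i).map p, [], ?_⟩
    rw [List.append_nil]
    exact occursAt_iff_prefix.1 h
  · rintro ⟨n, a, b, h⟩
    have h' := occursAt_prefix p n
    rw [h, occursAt_append, occursAt_append] at h'
    exact ⟨_, h'.1.2⟩

theorem OccursAt.eq_append {u : Word k} {p : InfSeq k} (h : OccursAt u p 0) {n : ℕ}
    (hn : n ≤ u.length) : ∃ b, u = (List.range n).map p ++ b := by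
  refine ⟨u.drop n, ?_⟩
  conv_lhs => rw [← List.take_append_drop n u]
  congr 1
  conv_lhs => rw [← occursAt_iff_prefix.1 h, ← List.map_take, List.take_range, min_eq_left hn]

theorem OccursAt.append_of_le {u v : Word k} {p : InfSeq k} (hu : OccursAt u p 0)
    (hv : OccursAt v p 0) (h : u.length ≤ v.length) : ∃ b, v = u ++ b := by
  obtain ⟨b, hb⟩ := hv.eq_append h
  exact ⟨b, by rwa [occursAt_iff_prefix.1 hu] at hb⟩

/-- The words listed by a sequence all of whose prefixes are prefixes of tuples. -/
theorem listed_iff_of_tuples {p : InfSeq k} {L : ℕ → List (Word k)}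
    (hL : ∀ n, OccursAt (tuple (L n)) p 0) (hlen : ∀ n, n ≤ (L n).length) {w : Word k} :
    Listed w p ↔ ∃ n, w ∈ L n := by
  constructor
  · rintro h
    obtain ⟨n, a, b, h⟩ := isSubword_iff.1 h
    obtain ⟨c, hc⟩ := (hL n).eq_append ((hlen n).trans (length_le_length_tuple _))
    refine ⟨n, mem_of_wrap_infix (a := a) (b := b ++ c) ?_⟩
    rw [hc, h]
    simp
  · rintro ⟨n, hn⟩
    obtain ⟨l, l', hl⟩ := List.append_of_mem hn
    refine isSubword_iff.2 ⟨(tuple (L n)).length, tuple l, tuple l', ?_⟩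
    rw [occursAt_iff_prefix.1 (hL n), hl, tuple_append, tuple_cons, List.append_assoc]

theorem EncodesSeq.listed_iff {p : InfSeq k} {v : ℕ → Word k} (h : EncodesSeq p v) {w : Word k} :
    Listed w p ↔ ∃ j, v j = w := by
  rw [listed_iff_of_tuples h (by simp)]
  constructor
  · rintro ⟨n, hn⟩
    obtain ⟨j, -, hj⟩ := List.mem_map.1 hn
    exact ⟨j, hj⟩
  · rintro ⟨j, rfl⟩
    exact ⟨j + 1, List.mem_map.2 ⟨j, by simp, rfl⟩⟩

theorem encodesSeq_iff_flatMap {p : InfSeq k} {v : ℕ → Word k} :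
    EncodesSeq p v ↔ ∀ n, OccursAt ((List.range n).flatMap fun j => wrap (v j)) p 0 := by
  simp [EncodesSeq, tuple, List.flatMap_map]

theorem exists_encodesSeq (v : ℕ → Word k) : ∃ p, EncodesSeq p v := by
  obtain ⟨p, hp⟩ := exists_seq_concat (fun n => wrap (v n)) fun n => wrap_ne_nil _
  exact ⟨p, encodesSeq_iff_flatMap.2 hp⟩

/-- Of two tuples that are both prefixes of `p`, one extends the other, and unique decoding compares
them entry by entry. A machine can therefore recover the encoded words from a finite part of its
tape. -/
theorem EncodesSeq.eq_of_occursAt {p : InfSeq k} {v : ℕ → Word k} (h : EncodesSeq p v)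
    {l : List (Word k)} {w : Word k} (hl : OccursAt (tuple (l ++ [w])) p 0) :
    w = v l.length := by
  have h1 := h (l.length + 1)
  have h2 : l ++ [w] <+: (List.range (l.length + 1)).map v := by
    rcases le_total (tuple (l ++ [w])).length (tuple ((List.range (l.length + 1)).map v)).length
      with hle | hle
    · obtain ⟨b, hb⟩ := hl.append_of_le h1 hle
      exact tuple_append_prefix (r := b) (r' := []) (by simpa using hb.symm) (by simp)
    · obtain ⟨b, hb⟩ := h1.append_of_le hl hle
      exact tuple_append_prefix (r := []) (r' := b) (by simpa using hb) (by simp)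
  have h3 := h2.getElem?_of_eq_some (i := l.length) (a := w) (by simp)
  simpa using h3.symm

theorem EncodesSeq.unique {p : InfSeq k} {v v' : ℕ → Word k} (h : EncodesSeq p v)
    (h' : EncodesSeq p v') : v = v' := by
  funext n
  have h1 := h' (n + 1)
  rw [List.range_succ, List.map_append] at h1
  simpa using (h.eq_of_occursAt h1).symm

/-! ### Interleaved lists -/

/-- The word `a(0) b(0) a(1) b(1) …`, for words `a` and `b` of the same length. -/
def interleave (a b : Word k) : Word k :=
  (List.range a.length).flatMap fun i => [a.getD i 0, b.getD i 0]

theorem interleave_cons (x y : Alphabet k) (a b : Word k) :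
    interleave (x :: a) (y :: b) = x :: y :: interleave a b := by
  simp [interleave, List.range_succ_eq_map, List.flatMap_map]

theorem interleave_append {a b a' b' : Word k} (h : a.length = b.length) :
    interleave (a ++ a') (b ++ b') = interleave a b ++ interleave a' b' := by
  induction a generalizing b with
  | nil =>
    obtain rfl : b = [] := List.length_eq_zero_iff.1 h.symm
    rfl
  | cons x a ih =>
    cases b with
    | nil => simp at h
    | cons y b =>
      rw [List.cons_append, List.cons_append, interleave_cons, interleave_cons,
        ih (by simpa using h)]
      rfl

theorem occursAt_interleave {a b : Word k} {q : InfSeq k} (h : a.length = b.length) {i : ℕ}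
    (hq : OccursAt (interleave a b) q (2 * i)) :
    OccursAt a (fun n => q (2 * n)) i ∧ OccursAt b (fun n => q (2 * n + 1)) i := by
  induction a generalizing b i with
  | nil =>
    obtain rfl : b = [] := List.length_eq_zero_iff.1 h.symm
    exact ⟨occursAt_nil _ _, occursAt_nil _ _⟩
  | cons x a ih =>
    cases b with
    | nil => simp at h
    | cons y b =>
      rw [interleave_cons, occursAt_cons, occursAt_cons] at hq
      obtain ⟨h1, h2⟩ := ih (i := i + 1) (by simpa using h) hq.2.2
      exact ⟨occursAt_cons.2 ⟨hq.1, h1⟩, occursAt_cons.2 ⟨hq.2.1, h2⟩⟩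

/-- Equally long wrappings of two words, interleaved. -/
def pairBlock (u : Word k × Word k) : Word k :=
  interleave (tuple ((List.range (wrap u.2).length).map fun _ => u.1))
    (tuple ((List.range (wrap u.1).length).map fun _ => u.2))

theorem length_tuple_const (n : ℕ) (w : Word k) :
    (tuple ((List.range n).map fun _ => w)).length = n * (wrap w).length := by
  induction n with
  | zero => simp [tuple]
  | succ n ih =>
    rw [List.range_succ, List.map_append, tuple_append, List.length_append, ih, List.map_singleton,
      tuple_singleton]
    ring

theorem pairBlock_ne_nil (u : Word k × Word k) : pairBlock u ≠ [] := by
  obtain ⟨y, hy⟩ : ∃ y, wrap u.1 = 1 :: y := ⟨_, rfl⟩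
  obtain ⟨z, hz⟩ : ∃ z, wrap u.2 = 1 :: z := ⟨_, rfl⟩
  rw [pairBlock, hy, hz, List.length_cons, List.length_cons, List.range_succ_eq_map,
    List.range_succ_eq_map, List.map_cons, List.map_cons, tuple_cons, tuple_cons, hy, hz]
  simp [interleave_cons]

/-- Repeating each word as often as the wrapping of the other is long gives both halves of a block
the same length. The even and the odd half of `q` are then themselves concatenations of wrapped
words, and repetition does not change what is listed. -/
theorem listed_of_pairBlocks {q : InfSeq k} {v : ℕ → Word k × Word k}
    (hq : ∀ n, OccursAt ((List.range n).flatMap fun j => pairBlock (v j)) q 0) :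
    (∀ w, Listed w (fun n => q (2 * n)) ↔ ∃ j, (v j).1 = w) ∧
      ∀ w, Listed w (fun n => q (2 * n + 1)) ↔ ∃ j, (v j).2 = w := by
  let L₁ : ℕ → List (Word k) := fun n =>
    (List.range n).flatMap fun j => (List.range (wrap (v j).2).length).map fun _ => (v j).1
  let L₂ : ℕ → List (Word k) := fun n =>
    (List.range n).flatMap fun j => (List.range (wrap (v j).1).length).map fun _ => (v j).2
  have hs₁ : ∀ n, L₁ (n + 1) =
      L₁ n ++ (List.range (wrap (v n).2).length).map fun _ => (v n).1 := fun n => by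
    simp [L₁, List.range_succ]
  have hs₂ : ∀ n, L₂ (n + 1) =
      L₂ n ++ (List.range (wrap (v n).1).length).map fun _ => (v n).2 := fun n => by
    simp [L₂, List.range_succ]
  have key : ∀ n, (tuple (L₁ n)).length = (tuple (L₂ n)).length ∧
      ((List.range n).flatMap fun j => pairBlock (v j)) =
        interleave (tuple (L₁ n)) (tuple (L₂ n)) := by
    intro n
    induction n with
    | zero => exact ⟨rfl, rfl⟩
    | succ n ih =>
      rw [hs₁, hs₂, tuple_append, tuple_append, interleave_append ih.1, ← ih.2]
      refine ⟨?_, ?_⟩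
      · rw [List.length_append, List.length_append, ih.1, length_tuple_const, length_tuple_const,
          Nat.mul_comm]
      · rw [List.range_succ, List.flatMap_append, List.flatMap_singleton]
        rfl
  have hocc := fun n => occursAt_interleave (i := 0) (key n).1 ((key n).2 ▸ hq n)
  have hpos : ∀ w : Word k, 1 ≤ (wrap w).length := fun w => List.length_pos_iff.2 (wrap_ne_nil w)
  have hlen₁ : ∀ n, n ≤ (L₁ n).length := by
    intro n
    induction n with
    | zero => simp
    | succ n ih =>
      have := hpos (v n).2
      rw [hs₁, List.length_append, List.length_map, List.length_range]
      omega
  have hlen₂ : ∀ n, n ≤ (L₂ n).length := by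
    intro n
    induction n with
    | zero => simp
    | succ n ih =>
      have := hpos (v n).1
      rw [hs₂, List.length_append, List.length_map, List.length_range]
      omega
  refine ⟨fun w => ?_, fun w => ?_⟩
  · rw [listed_iff_of_tuples (fun n => (hocc n).1) hlen₁]
    constructor
    · rintro ⟨n, hn⟩
      obtain ⟨j, -, hj⟩ := List.mem_flatMap.1 hn
      obtain ⟨i, -, hi⟩ := List.mem_map.1 hj
      exact ⟨j, hi⟩
    · rintro ⟨j, rfl⟩
      refine ⟨j + 1, List.mem_flatMap.2 ⟨j, by simp, List.mem_map.2 ⟨0, ?_, rfl⟩⟩⟩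
      exact List.mem_range.2 (hpos _)
  · rw [listed_iff_of_tuples (fun n => (hocc n).2) hlen₂]
    constructor
    · rintro ⟨n, hn⟩
      obtain ⟨j, -, hj⟩ := List.mem_flatMap.1 hn
      obtain ⟨i, -, hi⟩ := List.mem_map.1 hj
      exact ⟨j, hi⟩
    · rintro ⟨j, rfl⟩
      refine ⟨j + 1, List.mem_flatMap.2 ⟨j, by simp, List.mem_map.2 ⟨0, ?_, rfl⟩⟩⟩
      exact List.mem_range.2 (hpos _)

/-! ### Computability of the operations on words -/

theorem wrap_primrec : Primrec (wrap (k := k)) := by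
  have h : Primrec fun w : Word k => w.flatMap fun a => [0, a] :=
    Primrec.list_flatMap Primrec.id (Primrec.list_cons.comp (Primrec.const 0)
      (Primrec.list_cons.comp Primrec.snd (Primrec.const [])))
  exact Primrec.list_append.comp (Primrec.list_append.comp (Primrec.const [1, 1]) h)
    (Primrec.const [0, 1, 1])

theorem tuple_primrec : Primrec (tuple (k := k)) :=
  Primrec.list_flatMap Primrec.id (wrap_primrec.comp Primrec.snd)

theorem interleave_primrec : Primrec₂ (interleave (k := k)) := by
  refine Primrec.list_flatMap (Primrec.list_range.comp (Primrec.list_length.comp Primrec.fst)) ?_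
  exact Primrec.list_cons.comp
    ((Primrec.list_getD 0).comp (Primrec.fst.comp Primrec.fst) Primrec.snd)
    (Primrec.list_cons.comp
      ((Primrec.list_getD 0).comp (Primrec.snd.comp Primrec.fst) Primrec.snd) (Primrec.const []))

theorem pairBlock_primrec : Primrec (pairBlock (k := k)) := by
  refine interleave_primrec.comp (tuple_primrec.comp (Primrec.list_map (Primrec.list_range.comp
    (Primrec.list_length.comp (wrap_primrec.comp Primrec.snd))) (Primrec.fst.comp Primrec.fst)))
    (tuple_primrec.comp (Primrec.list_map (Primrec.list_range.comp
    (Primrec.list_length.comp (wrap_primrec.comp Primrec.fst))) (Primrec.snd.comp Primrec.fst)))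

theorem natVal_primrec : Primrec (natVal (k := k)) :=
  Primrec.list_foldl (h := fun _ (y : ℕ × Alphabet k) => 2 * y.1 + y.2.val) Primrec.id
    (Primrec.const 0) (Primrec.nat_add.comp
    (Primrec.nat_double.comp (Primrec.fst.comp Primrec.snd))
    (Primrec.fin_val.comp (Primrec.snd.comp Primrec.snd)))

theorem two_pow_primrec : Primrec fun n : ℕ => 2 ^ n := by
  refine (Primrec.nat_rec₁ (f := fun _ m : ℕ => 2 * m) 1
    (Primrec.nat_double.comp Primrec.snd)).of_eq fun n => ?_
  induction n with
  | zero => rfl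
  | succ n ih => rw [pow_succ, ← ih, Nat.mul_comm]

/-! ### Names of numbers -/

theorem IsNatName.unique {w : Word k} {m n : ℕ} (h : IsNatName w m) (h' : IsNatName w n) :
    m = n := h.2.symm.trans h'.2

theorem exists_isNatName (n : ℕ) : ∃ w : Word k, IsNatName w n := by
  induction n using Nat.strong_induction_on with
  | _ n ih =>
    rcases Nat.lt_or_ge n 2 with hn | hn
    · interval_cases n
      · exact ⟨[0], Or.inl rfl, rfl⟩
      · exact ⟨[1], Or.inr ⟨rfl, by simp⟩, by simp [natVal]⟩
    · obtain ⟨w, hw, hv⟩ := ih (n / 2) (by omega)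
      -- As `n / 2 ≥ 1`, its name is not the exceptional `[0]`, so a digit may be appended without
      -- creating a leading zero.
      have hw0 : w.head? = some 1 ∧ ∀ a ∈ w, a = 0 ∨ a = 1 := by
        refine hw.resolve_left fun h => ?_
        subst h
        simp [natVal] at hv
        omega
      obtain ⟨d, hd, hdv⟩ : ∃ d : Alphabet k, (d = 0 ∨ d = 1) ∧ d.val = n % 2 := by
        rcases Nat.mod_two_eq_zero_or_one n with h | h
        · exact ⟨0, Or.inl rfl, by rw [h]; rfl⟩
        · exact ⟨1, Or.inr rfl, by rw [h]; simp⟩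
      refine ⟨w ++ [d], Or.inr ⟨?_, ?_⟩, ?_⟩
      · rw [List.head?_append, hw0.1]
        rfl
      · intro a ha
        rcases List.mem_append.1 ha with ha | ha
        · exact hw0.2 a ha
        · rw [List.mem_singleton.1 ha]
          exact hd
      · rw [natVal, List.foldl_append]
        change 2 * natVal w + d.val = n
        rw [hv, hdv]
        omega

theorem IsRatName.unique {w : Word k} {q r : ℚ} (h : IsRatName w q) (h' : IsRatName w r) :
    q = r := by
  obtain ⟨a, b, c, l, m, n, ha, hb, hc, -, hw, rfl⟩ := h
  obtain ⟨a', b', c', l', m', n', ha', hb', hc', -, hw', rfl⟩ := h'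
  have := tuple_injective (hw.symm.trans hw')
  simp only [List.cons.injEq, and_true] at this
  obtain ⟨rfl, rfl, rfl⟩ := this
  rw [ha.unique ha', hb.unique hb', hc.unique hc']

theorem exists_isRatName (q : ℚ) : ∃ w : Word k, IsRatName w q := by
  obtain ⟨a, ha⟩ := exists_isNatName (k := k) q.num.toNat
  obtain ⟨b, hb⟩ := exists_isNatName (k := k) (-q.num).toNat
  obtain ⟨c, hc⟩ := exists_isNatName (k := k) q.den
  refine ⟨_, a, b, c, _, _, _, ha, hb, hc, q.den_nz, rfl, ?_⟩
  have h : ((q.num.toNat : ℚ)) - ((-q.num).toNat : ℚ) = (q.num : ℚ) := by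
    exact_mod_cast Int.toNat_sub_toNat_neg q.num
  rw [h, Rat.num_div_den]

theorem isNatName_semiDec : SemiDec fun x : Word k × ℕ => IsNatName x.1 x.2 := by
  have h1 : PrimrecPred fun w : Word k => ∀ a ∈ w, a = 0 ∨ a = 1 :=
    PrimrecPred.forall_mem_list ((Primrec.eq.comp Primrec.id (Primrec.const 0)).or
      (Primrec.eq.comp Primrec.id (Primrec.const 1)))
  have h2 : PrimrecPred fun w : Word k => w = [0] ∨ (w.head? = some 1 ∧ ∀ a ∈ w, a = 0 ∨ a = 1) :=
    (Primrec.eq.comp Primrec.id (Primrec.const [0])).or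
      ((Primrec.eq.comp Primrec.list_head? (Primrec.const (some 1))).and h1)
  exact ((h2.comp Primrec.fst).and
    (Primrec.eq.comp (natVal_primrec.comp Primrec.fst) Primrec.snd)).semiDec

variable {α : Type*} [Primcodable α]

/-- A semidecidable relation between a word and the numbers named by its three entries. -/
theorem ratName_semiDec_aux {u : α → Word k} (hu : Computable u)
    {P : α × ℕ × ℕ × ℕ → Prop} (hP : SemiDec P) :
    SemiDec fun x => ∃ a b c : Word k, ∃ l m n : ℕ, (IsNatName a l ∧ IsNatName b m ∧
      IsNatName c n ∧ 0 < n ∧ u x = tuple [a, b, c]) ∧ P (x, l, m, n) := by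
  have key : SemiDec fun y : α × (Word k × Word k × Word k × ℕ × ℕ × ℕ) =>
      (IsNatName y.2.1 y.2.2.2.2.1 ∧ IsNatName y.2.2.1 y.2.2.2.2.2.1 ∧
      IsNatName y.2.2.2.1 y.2.2.2.2.2.2 ∧ 0 < y.2.2.2.2.2.2 ∧
      u y.1 = tuple [y.2.1, y.2.2.1, y.2.2.2.1]) ∧ P (y.1, y.2.2.2.2.1, y.2.2.2.2.2) := by
    have s1 : Computable fun y : α × (Word k × Word k × Word k × ℕ × ℕ × ℕ) => y.2 := Computable.snd
    have s2 := Computable.snd.comp s1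
    have s3 := Computable.snd.comp s2
    have s4 := Computable.snd.comp s3
    have s5 := Computable.snd.comp s4
    have s6 := Computable.snd.comp s5
    have f1 := Computable.fst.comp s1
    have f2 := Computable.fst.comp s2
    have f3 := Computable.fst.comp s3
    have f4 := Computable.fst.comp s4
    have f5 := Computable.fst.comp s5
    refine SemiDec.and (((isNatName_semiDec.comp (f1.pair f4))).and
      ((isNatName_semiDec.comp (f2.pair f5)).and ((isNatName_semiDec.comp (f3.pair s6)).and
      ((SemiDec.of_computable_lt (Computable.const 0) s6).and
        (SemiDec.of_computable_eq (hu.comp Computable.fst) ?_)))))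
      (hP.comp (Computable.fst.pair s4))
    exact tuple_primrec.to_comp.comp (Computable.list_cons.comp f1 (Computable.list_cons.comp f2
      (Computable.list_cons.comp f3 (Computable.const []))))
  exact key.exists.of_iff fun x => ⟨fun ⟨a, b, c, l, m, n, h⟩ => ⟨(a, b, c, l, m, n), h⟩,
    fun ⟨⟨a, b, c, l, m, n⟩, h⟩ => ⟨a, b, c, l, m, n, h⟩⟩

/-- Clearing denominators turns the comparison into one of natural numbers. Writing the dyadic bound
as a difference `x - y` over `2 ^ n` allows negative bounds without integer arithmetic. -/
theorem ratName_lt_semiDec {u : α → Word k} (hu : Computable u) {x y n : α → ℕ}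
    (hx : Computable x) (hy : Computable y) (hn : Computable n) :
    SemiDec fun a => ∃ r : ℚ, IsRatName (u a) r ∧ (r : ℝ) < ((x a : ℝ) - y a) / 2 ^ n a := by
  have hl : Computable fun z : α × ℕ × ℕ × ℕ => z.2.1 := Computable.fst.comp Computable.snd
  have hm : Computable fun z : α × ℕ × ℕ × ℕ => z.2.2.1 :=
    Computable.fst.comp (Computable.snd.comp Computable.snd)
  have hd : Computable fun z : α × ℕ × ℕ × ℕ => z.2.2.2 :=
    Computable.snd.comp (Computable.snd.comp Computable.snd)
  have hp := two_pow_primrec.to_comp.comp (hn.comp (Computable.fst (β := ℕ × ℕ × ℕ)))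
  have add := Primrec.nat_add.to_comp
  have mul := Primrec.nat_mul.to_comp
  refine (ratName_semiDec_aux hu (SemiDec.of_computable_lt
    (add.comp (mul.comp hl hp) (mul.comp (hy.comp Computable.fst) hd))
    (add.comp (mul.comp (hx.comp Computable.fst) hd) (mul.comp hm hp)))).of_iff fun a => ?_
  have key : ∀ l m d : ℕ, 0 < d →
      (((((l : ℚ) - m) / d : ℚ) : ℝ) < ((x a : ℝ) - y a) / 2 ^ n a ↔
        l * 2 ^ n a + y a * d < x a * d + m * 2 ^ n a) := by
    intro l m d hd
    push_cast
    rw [div_lt_div_iff₀ (by positivity) (by positivity)]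
    rw [← Nat.cast_lt (α := ℝ)]
    push_cast
    constructor <;> intro h <;> linarith
  constructor
  · rintro ⟨r, ⟨a', b, c, l, m, d, ha, hb, hc, hd, hw, rfl⟩, hr⟩
    have hd' := Nat.pos_of_ne_zero hd
    exact ⟨a', b, c, l, m, d, ⟨ha, hb, hc, hd', hw⟩, (key l m d hd').1 hr⟩
  · rintro ⟨a', b, c, l, m, d, ⟨ha, hb, hc, hd, hw⟩, hr⟩
    exact ⟨_, ⟨a', b, c, l, m, d, ha, hb, hc, hd.ne', hw, rfl⟩, (key l m d hd).2 hr⟩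

theorem lt_ratName_semiDec {u : α → Word k} (hu : Computable u) {x y n : α → ℕ}
    (hx : Computable x) (hy : Computable y) (hn : Computable n) :
    SemiDec fun a => ∃ r : ℚ, IsRatName (u a) r ∧ ((x a : ℝ) - y a) / 2 ^ n a < (r : ℝ) := by
  have hl : Computable fun z : α × ℕ × ℕ × ℕ => z.2.1 := Computable.fst.comp Computable.snd
  have hm : Computable fun z : α × ℕ × ℕ × ℕ => z.2.2.1 :=
    Computable.fst.comp (Computable.snd.comp Computable.snd)
  have hd : Computable fun z : α × ℕ × ℕ × ℕ => z.2.2.2 :=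
    Computable.snd.comp (Computable.snd.comp Computable.snd)
  have hp := two_pow_primrec.to_comp.comp (hn.comp (Computable.fst (β := ℕ × ℕ × ℕ)))
  have add := Primrec.nat_add.to_comp
  have mul := Primrec.nat_mul.to_comp
  refine (ratName_semiDec_aux hu (SemiDec.of_computable_lt
    (add.comp (mul.comp (hx.comp Computable.fst) hd) (mul.comp hm hp))
    (add.comp (mul.comp hl hp) (mul.comp (hy.comp Computable.fst) hd)))).of_iff fun a => ?_
  have key : ∀ l m d : ℕ, 0 < d →
      (((x a : ℝ) - y a) / 2 ^ n a < ((((l : ℚ) - m) / d : ℚ) : ℝ) ↔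
        x a * d + m * 2 ^ n a < l * 2 ^ n a + y a * d) := by
    intro l m d hd
    push_cast
    rw [div_lt_div_iff₀ (by positivity) (by positivity)]
    rw [← Nat.cast_lt (α := ℝ)]
    push_cast
    constructor <;> intro h <;> linarith
  constructor
  · rintro ⟨r, ⟨a', b, c, l, m, d, ha, hb, hc, hd, hw, rfl⟩, hr⟩
    have hd' := Nat.pos_of_ne_zero hd
    exact ⟨a', b, c, l, m, d, ⟨ha, hb, hc, hd', hw⟩, (key l m d hd').1 hr⟩
  · rintro ⟨a', b, c, l, m, d, ⟨ha, hb, hc, hd, hw⟩, hr⟩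
    exact ⟨_, ⟨a', b, c, l, m, d, ha, hb, hc, hd.ne', hw, rfl⟩, (key l m d hd).2 hr⟩

end Words

/-! ### The metric on classes of measurable sets -/

section Metric

/-- Together with subadditivity this carries the triangle inequality from each `μ(F i ∩ (A ∆ B))` to
the summands of `d̄`. -/
theorem div_one_add_mono {x y : ℝ} (hx : 0 ≤ x) (h : x ≤ y) : x / (1 + x) ≤ y / (1 + y) := by
  rw [div_le_div_iff₀ (by linarith) (by linarith)]
  nlinarith

theorem div_one_add_subadd {x y : ℝ} (hx : 0 ≤ x) (hy : 0 ≤ y) :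
    (x + y) / (1 + (x + y)) ≤ x / (1 + x) + y / (1 + y) := by
  rw [add_div]
  refine add_le_add ?_ ?_ <;> gcongr <;> linarith

theorem div_one_add_le_self {x : ℝ} (hx : 0 ≤ x) : x / (1 + x) ≤ x :=
  div_le_self hx (by linarith)

theorem div_one_add_le_one {x : ℝ} (hx : 0 ≤ x) : x / (1 + x) ≤ 1 :=
  (div_le_one (by linarith)).2 (by linarith)

theorem div_one_add_nonneg {x : ℝ} (hx : 0 ≤ x) : 0 ≤ x / (1 + x) := by positivity

/-- The difference is `(x - y) / ((1 + x) * (1 + y))`, with a denominator at least `1`. So an error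
in the measure is not magnified in the summand. -/
theorem abs_div_one_add_sub_le {x y : ℝ} (hx : 0 ≤ x) (hy : 0 ≤ y) :
    |x / (1 + x) - y / (1 + y)| ≤ |x - y| := by
  have h : x / (1 + x) - y / (1 + y) = (x - y) / ((1 + x) * (1 + y)) := by
    field_simp
    ring
  rw [h, abs_div, abs_of_pos (by positivity : 0 < (1 + x) * (1 + y))]
  exact div_le_self (abs_nonneg _) (by nlinarith)

/-! ### The series for the distance: tails and local bounds -/

variable {Ω : Type*} [MeasurableSpace Ω] (μ : Measure Ω) (F : ℕ → Set Ω)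

/-- The `i`-th summand of `dBarSet`. -/
noncomputable def dBarTerm (A B : Set Ω) (i : ℕ) : ℝ :=
  μ.real (F i ∩ (A ∆ B)) / (1 + μ.real (F i ∩ (A ∆ B))) * (2 : ℝ)⁻¹ ^ i

theorem dBarTerm_nonneg (A B : Set Ω) (i : ℕ) : 0 ≤ dBarTerm μ F A B i :=
  mul_nonneg (div_one_add_nonneg measureReal_nonneg) (by positivity)

theorem dBarTerm_le (A B : Set Ω) (i : ℕ) : dBarTerm μ F A B i ≤ (2 : ℝ)⁻¹ ^ i :=
  mul_le_of_le_one_left (by positivity) (div_one_add_le_one measureReal_nonneg)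

theorem summable_inv_two_pow : Summable fun i : ℕ => (2 : ℝ)⁻¹ ^ i :=
  summable_geometric_of_lt_one (by norm_num) (by norm_num)

theorem dBarTerm_summable (A B : Set Ω) : Summable (dBarTerm μ F A B) :=
  Summable.of_nonneg_of_le (dBarTerm_nonneg μ F A B) (dBarTerm_le μ F A B) summable_inv_two_pow

theorem dBarSet_eq (A B : Set Ω) : dBarSet μ F A B = ∑' i, dBarTerm μ F A B i := rfl

theorem dBarTerm_le_dBarSet (A B : Set Ω) (i : ℕ) : dBarTerm μ F A B i ≤ dBarSet μ F A B :=
  (dBarTerm_summable μ F A B).le_tsum i fun j _ => dBarTerm_nonneg μ F A B j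

theorem sum_dBarTerm_le_dBarSet (A B : Set Ω) (n : ℕ) :
    ∑ i ∈ Finset.range n, dBarTerm μ F A B i ≤ dBarSet μ F A B :=
  (dBarTerm_summable μ F A B).sum_le_tsum _ fun j _ => dBarTerm_nonneg μ F A B j

theorem dBarSet_le_sum_dBarTerm_add (A B : Set Ω) (n : ℕ) :
    dBarSet μ F A B ≤ ∑ i ∈ Finset.range n, dBarTerm μ F A B i + 2 * (2 : ℝ)⁻¹ ^ n := by
  rw [dBarSet_eq, ← (dBarTerm_summable μ F A B).sum_add_tsum_nat_add n]
  refine add_le_add le_rfl ?_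
  have h1 : Summable fun i : ℕ => (2 : ℝ)⁻¹ ^ n * (2 : ℝ)⁻¹ ^ i :=
    summable_inv_two_pow.mul_left _
  have h2 : ∑' i, dBarTerm μ F A B (i + n) ≤ ∑' i : ℕ, (2 : ℝ)⁻¹ ^ n * (2 : ℝ)⁻¹ ^ i := by
    refine Summable.tsum_le_tsum (fun i => ?_) ((summable_nat_add_iff n).2
      (dBarTerm_summable μ F A B)) h1
    rw [← pow_add, add_comm n i]
    exact dBarTerm_le μ F A B _
  refine h2.trans (le_of_eq ?_)
  rw [tsum_mul_left, tsum_geometric_of_lt_one (by norm_num) (by norm_num)]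
  norm_num
  ring

theorem dBarSet_nonneg (A B : Set Ω) : 0 ≤ dBarSet μ F A B :=
  tsum_nonneg (dBarTerm_nonneg μ F A B)

theorem dBarSet_comm (A B : Set Ω) : dBarSet μ F A B = dBarSet μ F B A := by
  simp only [dBarSet, symmDiff_comm]

/-- The first `n` summands are at most `ε * 2⁻ⁱ`, and the tail is bounded by a geometric series. -/
theorem dBarSet_le_of_forall_lt {A B : Set Ω} {n : ℕ} {ε : ℝ} (hε : 0 ≤ ε)
    (h : ∀ i < n, μ.real (F i ∩ (A ∆ B)) ≤ ε) :
    dBarSet μ F A B ≤ 2 * ε + 2 * (2 : ℝ)⁻¹ ^ n := by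
  refine (dBarSet_le_sum_dBarTerm_add μ F A B n).trans (add_le_add ?_ le_rfl)
  calc ∑ i ∈ Finset.range n, dBarTerm μ F A B i
      ≤ ∑ i ∈ Finset.range n, ε * (2 : ℝ)⁻¹ ^ i := by
        refine Finset.sum_le_sum fun i hi => mul_le_mul_of_nonneg_right ?_ (by positivity)
        exact (div_one_add_le_self measureReal_nonneg).trans (h i (Finset.mem_range.1 hi))
    _ = ε * ∑ i ∈ Finset.range n, (2 : ℝ)⁻¹ ^ i := by rw [Finset.mul_sum]
    _ ≤ ε * 2 := by
        refine mul_le_mul_of_nonneg_left ?_ hε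
        refine (summable_inv_two_pow.sum_le_tsum _ fun j _ => by positivity).trans ?_
        rw [tsum_geometric_of_lt_one (by norm_num) (by norm_num)]
        norm_num
    _ = 2 * ε := mul_comm _ _

/-- A bound for the distance on one of the sets of the partition. -/
theorem measureReal_le_of_dBarSet_le {A B : Set Ω} {i j : ℕ} (hij : i < j)
    (h : dBarSet μ F A B ≤ (2 : ℝ)⁻¹ ^ j) :
    μ.real (F i ∩ (A ∆ B)) ≤ (2 : ℝ) ^ (i + 1) / 2 ^ j := by
  have h1 := (dBarTerm_le_dBarSet μ F A B i).trans h
  rw [dBarTerm] at h1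
  have hx : 0 ≤ μ.real (F i ∩ (A ∆ B)) := measureReal_nonneg
  generalize μ.real (F i ∩ (A ∆ B)) = x at *
  -- With `j = i + d + 1` the hypothesis says `x * 2 ^ (d + 1) ≤ 1 + x`. Since `2 ^ d ≥ 1`, the `x`
  -- on the right can be absorbed, leaving `x * 2 ^ d ≤ 1`, which is the bound.
  obtain ⟨d, rfl⟩ := Nat.exists_eq_add_of_lt hij
  rw [inv_pow, inv_pow, div_mul_eq_mul_div, div_le_iff₀ (by linarith), ← div_eq_mul_inv,
    div_le_iff₀ (by positivity)] at h1
  rw [le_div_iff₀ (by positivity)]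
  have hd : (1 : ℝ) ≤ 2 ^ d := one_le_pow₀ (by norm_num)
  have hi : (0 : ℝ) < 2 ^ i := by positivity
  have e1 : ((2 : ℝ) ^ (i + d + 1))⁻¹ * (1 + x) * 2 ^ i = (1 + x) / (2 ^ d * 2) := by
    rw [pow_succ, pow_add]
    field_simp
  rw [e1, le_div_iff₀ (by positivity)] at h1
  have e2 : x * 2 ^ (i + d + 1) = (x * (2 ^ d * 2)) * 2 ^ i := by ring
  rw [e2, pow_succ]
  have : x * (2 ^ d * 2) ≤ 2 := by nlinarith
  nlinarith

variable {μ F}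

theorem measureReal_inter_symmDiff_triangle {G : Set Ω} (hG : μ G < ⊤) (A B C : Set Ω) :
    μ.real (G ∩ (A ∆ C)) ≤ μ.real (G ∩ (A ∆ B)) + μ.real (G ∩ (B ∆ C)) := by
  refine le_trans (measureReal_mono ?_ ?_) (measureReal_union_le _ _)
  · rw [← Set.inter_union_distrib_left]
    exact Set.inter_subset_inter_right _ (symmDiff_triangle A B C)
  · exact ((measure_mono (Set.union_subset Set.inter_subset_left Set.inter_subset_left)).trans_lt
      hG).ne

theorem dBarSet_triangle (hF : ∀ i, μ (F i) < ⊤) (A B C : Set Ω) :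
    dBarSet μ F A C ≤ dBarSet μ F A B + dBarSet μ F B C := by
  rw [dBarSet_eq, dBarSet_eq, dBarSet_eq, ← (dBarTerm_summable μ F A B).tsum_add
    (dBarTerm_summable μ F B C)]
  refine Summable.tsum_le_tsum (fun i => ?_) (dBarTerm_summable μ F A C)
    ((dBarTerm_summable μ F A B).add (dBarTerm_summable μ F B C))
  rw [dBarTerm, dBarTerm, dBarTerm, ← add_mul]
  refine mul_le_mul_of_nonneg_right ?_ (by positivity)
  exact (div_one_add_mono measureReal_nonneg
    (measureReal_inter_symmDiff_triangle (hF i) A B C)).trans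
    (div_one_add_subadd measureReal_nonneg measureReal_nonneg)

theorem dBarSet_eq_zero_iff (hF : ∀ i, μ (F i) < ⊤) (hU : ⋃ i, F i = Set.univ) (A B : Set Ω) :
    dBarSet μ F A B = 0 ↔ μ (A ∆ B) = 0 := by
  constructor
  · intro h
    have h1 : ∀ i, μ (F i ∩ (A ∆ B)) = 0 := by
      intro i
      have h2 := dBarTerm_le_dBarSet μ F A B i
      rw [h, dBarTerm] at h2
      have hx : 0 ≤ μ.real (F i ∩ (A ∆ B)) := measureReal_nonneg
      have h3 : μ.real (F i ∩ (A ∆ B)) = 0 := by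
        generalize μ.real (F i ∩ (A ∆ B)) = x at *
        by_contra hne
        have : 0 < x := lt_of_le_of_ne hx (Ne.symm hne)
        have : 0 < x / (1 + x) * (2 : ℝ)⁻¹ ^ i := by positivity
        linarith
      exact (measureReal_eq_zero_iff
        ((measure_mono Set.inter_subset_left).trans_lt (hF i)).ne).1 h3
    have h2 : A ∆ B = ⋃ i, F i ∩ (A ∆ B) := by
      rw [← Set.iUnion_inter, hU, Set.univ_inter]
    rw [h2]
    exact measure_iUnion_null h1
  · intro h
    have h1 : ∀ i, dBarTerm μ F A B i = 0 := fun i => by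
      have : μ.real (F i ∩ (A ∆ B)) = 0 := by
        rw [measureReal_def, measure_mono_null Set.inter_subset_right h]
        rfl
      simp [dBarTerm, this]
    simp [dBarSet_eq, h1]

end Metric

/-! ### Ring elements and the partition -/

namespace ComputableSigmaAlgebra

variable {k : ℕ} {Ω : Type*} [MeasurableSpace Ω] {S : ComputableSigmaAlgebra k Ω} {μ : Measure Ω}
  {F : ℕ → Set Ω}

theorem mem_sets {w : Word k} {R : Set Ω} (h : R ∈ S.α w) : R ∈ S.sets := (S.α_range R).2 ⟨w, h⟩

theorem IsPartition.mem_sets (hF : S.IsPartition μ F) (i : ℕ) : F i ∈ S.sets := by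
  obtain ⟨g, -, hg⟩ := hF.computable
  exact S.mem_sets (hg i)

/-- The ring elements approximate every measurable set on finitely many sets of the partition. -/
theorem IsPartition.exists_measureReal_lt (hF : S.IsPartition μ F) {A : Set Ω}
    (hA : MeasurableSet A) (n : ℕ) {ε : ℝ} (hε : 0 < ε) :
    ∃ R ∈ S.sets, ∀ i < n, μ.real (F i ∩ (R ∆ A)) < ε := by
  -- Approximation by a generating ring is applied to the restriction of `μ` to `G`, which is finite
  -- even if `μ` is not.
  let G : Set Ω := ⋃ i ∈ Finset.range n, F i
  have hG : μ G < ⊤ := (measure_biUnion_finset_le _ _).trans_lt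
    (ENNReal.sum_lt_top.2 fun i _ => hF.finite i)
  have : IsFiniteMeasure (μ.restrict G) := ⟨by simpa using hG⟩
  obtain ⟨R, hR, hlt⟩ := exists_measure_symmDiff_lt_of_generateFrom_isSetRing
    (μ := μ.restrict G) S.isSetRing ⟨S.sets, S.countable, subset_rfl, by simp [S.sUnion_eq]⟩
    S.generateFrom_eq.symm hA (ENNReal.ofReal_pos.2 hε)
  refine ⟨R, hR, fun i hi => ?_⟩
  rw [Measure.restrict_apply ((S.measurableSet hR).symmDiff hA)] at hlt
  rw [measureReal_def]
  refine (ENNReal.lt_ofReal_iff_toReal_lt ?_).1 (lt_of_le_of_lt (measure_mono ?_) hlt)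
  · exact ((measure_mono Set.inter_subset_left).trans_lt (hF.finite i)).ne
  · rw [Set.inter_comm]
    exact Set.inter_subset_inter_right _
      (Set.subset_biUnion_of_mem (u := F) (Finset.mem_coe.2 (Finset.mem_range.2 hi)))

theorem IsPartition.exists_dBarSet_lt (hF : S.IsPartition μ F) {A : Set Ω}
    (hA : MeasurableSet A) {ε : ℝ} (hε : 0 < ε) : ∃ R ∈ S.sets, dBarSet μ F A R < ε := by
  obtain ⟨n, hn⟩ := exists_pow_lt_of_lt_one (show 0 < ε / 8 by positivity)
    (show (2 : ℝ)⁻¹ < 1 by norm_num)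
  obtain ⟨R, hR, h⟩ := hF.exists_measureReal_lt hA n (show 0 < ε / 8 by positivity)
  refine ⟨R, hR, ?_⟩
  rw [dBarSet_comm]
  have := dBarSet_le_of_forall_lt μ F (by positivity) fun i hi => (h i hi).le
  linarith

/-- The measures of the sets `F i ∩ R ∩ A` determine the class of `A`. -/
theorem IsPartition.symmDiff_null (hF : S.IsPartition μ F) {A B : Set Ω} (hA : MeasurableSet A)
    (hB : MeasurableSet B)
    (h : ∀ i, ∀ R ∈ S.sets, μ.real (F i ∩ R ∩ A) = μ.real (F i ∩ R ∩ B)) :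
    μ (A ∆ B) = 0 := by
  refine (dBarSet_eq_zero_iff hF.finite hF.iUnion_eq A B).1 (le_antisymm ?_ (dBarSet_nonneg _ _ _ _))
  refine le_of_forall_pos_le_add fun ε hε => ?_
  obtain ⟨n, hn⟩ := exists_pow_lt_of_lt_one (show 0 < ε / 8 by positivity)
    (show (2 : ℝ)⁻¹ < 1 by norm_num)
  have hnull : ∀ i, μ.real (F i ∩ (A ∆ B)) = 0 := by
    intro i
    have hmF := S.measurableSet (hF.mem_sets i)
    have hfin : ∀ C : Set Ω, μ (F i ∩ C) ≠ ⊤ := fun C =>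
      ((measure_mono Set.inter_subset_left).trans_lt (hF.finite i)).ne
    have : ∀ C : Set Ω, IsFiniteMeasure (μ.restrict (F i ∩ C)) := fun C =>
      ⟨by simpa using (hfin C).lt_top⟩
    -- Two finite measures that agree on a generating π-system and have the same total mass are
    -- equal. Evaluating them at `A \ B` and at `B \ A` then gives the two halves of the symmetric
    -- difference.
    have key : μ.restrict (F i ∩ A) = μ.restrict (F i ∩ B) := by
      have hset : ∀ R ∈ S.sets, μ (R ∩ (F i ∩ A)) = μ (R ∩ (F i ∩ B)) := by
        intro R hR
        have h1 := h i R hR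
        have e : ∀ C, F i ∩ R ∩ C = R ∩ (F i ∩ C) := fun C => by
          rw [Set.inter_comm (F i) R, Set.inter_assoc]
        rw [e, e, measureReal_def, measureReal_def, ENNReal.toReal_eq_toReal_iff'] at h1
        · exact h1
        · rw [← e, Set.inter_assoc]; exact hfin _
        · rw [← e, Set.inter_assoc]; exact hfin _
      refine ext_of_generate_finite S.sets S.generateFrom_eq.symm
        S.isSetRing.isSetSemiring.isPiSystem (fun R hR => ?_) ?_
      · rw [Measure.restrict_apply (S.measurableSet hR), Measure.restrict_apply (S.measurableSet hR)]
        exact hset R hR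
      -- The total masses agree because `F i` is itself a ring element.
      · have h1 := hset (F i) (hF.mem_sets i)
        rw [← Set.inter_assoc, ← Set.inter_assoc, Set.inter_self] at h1
        simpa using h1
    have h1 : μ (F i ∩ (A \ B)) = 0 := by
      have h2 := congrArg (fun ν : Measure Ω => ν (A \ B)) key
      simp only [Measure.restrict_apply (hA.diff hB)] at h2
      have e1 : A \ B ∩ (F i ∩ A) = F i ∩ (A \ B) := by ext; simp; tauto
      have e2 : A \ B ∩ (F i ∩ B) = ∅ := by ext; simp; tauto
      rw [e1, e2, measure_empty] at h2
      exact h2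
    have h1' : μ (F i ∩ (B \ A)) = 0 := by
      have h2 := congrArg (fun ν : Measure Ω => ν (B \ A)) key
      simp only [Measure.restrict_apply (hB.diff hA)] at h2
      have e1 : B \ A ∩ (F i ∩ B) = F i ∩ (B \ A) := by ext; simp; tauto
      have e2 : B \ A ∩ (F i ∩ A) = ∅ := by ext; simp; tauto
      rw [e1, e2, measure_empty] at h2
      exact h2.symm
    have h3 : μ (F i ∩ (A ∆ B)) = 0 := by
      rw [Set.symmDiff_def, Set.inter_union_distrib_left]
      exact measure_union_null h1 h1'
    rw [measureReal_def, h3]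
    rfl
  have := dBarSet_le_of_forall_lt μ F (A := A) (B := B) (n := n) le_rfl fun i _ => (hnull i).le
  linarith

end ComputableSigmaAlgebra

/-! ### The metric space and its representations -/

section Classes

variable {k : ℕ} {Ω : Type*} [MeasurableSpace Ω] {S : ComputableSigmaAlgebra k Ω} {μ : Measure Ω}
  {F : ℕ → Set Ω}

theorem SetClass.exists_rep (c : SetClass μ) :
    ∃ (A : Set Ω) (hA : MeasurableSet A), c = SetClass.mk μ A hA := by
  induction c using Quotient.ind with
  | _ A => exact ⟨A.1, A.2, rfl⟩

theorem SetClass.mk_eq_mk {A B : Set Ω} {hA : MeasurableSet A} {hB : MeasurableSet B} :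
    SetClass.mk μ A hA = SetClass.mk μ B hB ↔ μ (A ∆ B) = 0 :=
  ⟨fun h => Quotient.exact h, fun h => Quotient.sound h⟩

theorem dBar_mk {A B : Set Ω} (hA : MeasurableSet A) (hB : MeasurableSet B) :
    dBar μ F (SetClass.mk μ A hA) (SetClass.mk μ B hB) = dBarSet μ F A B := rfl

theorem dBar_comm (c d : SetClass μ) : dBar μ F c d = dBar μ F d c := by
  obtain ⟨A, hA, rfl⟩ := c.exists_rep
  obtain ⟨B, hB, rfl⟩ := d.exists_rep
  exact dBarSet_comm μ F A B

theorem dBar_nonneg (c d : SetClass μ) : 0 ≤ dBar μ F c d := by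
  obtain ⟨A, hA, rfl⟩ := c.exists_rep
  obtain ⟨B, hB, rfl⟩ := d.exists_rep
  exact dBarSet_nonneg μ F A B

theorem dBar_triangle (hF : ∀ i, μ (F i) < ⊤) (c d e : SetClass μ) :
    dBar μ F c e ≤ dBar μ F c d + dBar μ F d e := by
  obtain ⟨A, hA, rfl⟩ := c.exists_rep
  obtain ⟨B, hB, rfl⟩ := d.exists_rep
  obtain ⟨C, hC, rfl⟩ := e.exists_rep
  exact dBarSet_triangle hF A B C

theorem dBar_eq_zero_iff (hF : ∀ i, μ (F i) < ⊤) (hU : ⋃ i, F i = Set.univ) (c d : SetClass μ) :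
    dBar μ F c d = 0 ↔ c = d := by
  obtain ⟨A, hA, rfl⟩ := c.exists_rep
  obtain ⟨B, hB, rfl⟩ := d.exists_rep
  rw [dBar_mk, dBarSet_eq_zero_iff hF hU, SetClass.mk_eq_mk]

namespace ComputableSigmaAlgebra

theorem mem_β_iff {w : Word k} {c : SetClass μ} :
    c ∈ S.β μ w ↔ ∃ (R : Set Ω) (hR : R ∈ S.α w),
      c = SetClass.mk μ R (S.measurableSet (S.mem_sets hR)) := by
  constructor
  · rintro ⟨h, rfl⟩
    exact ⟨_, Part.get_mem (o := S.α w) h, rfl⟩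
  · rintro ⟨R, ⟨h, rfl⟩, rfl⟩
    exact ⟨h, rfl⟩

theorem mem_ringClasses_iff {c : SetClass μ} : c ∈ S.ringClasses μ ↔ ∃ w, c ∈ S.β μ w := by
  simp only [mem_β_iff]
  constructor
  · rintro ⟨R, hR, rfl⟩
    obtain ⟨w, hw⟩ := (S.α_range R).1 hR
    exact ⟨w, R, hw, rfl⟩
  · rintro ⟨w, R, hR, rfl⟩
    exact ⟨R, S.mem_sets hR, rfl⟩

theorem IsPartition.exists_dBar_lt (hF : S.IsPartition μ F) (c : SetClass μ) {ε : ℝ}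
    (hε : 0 < ε) : ∃ y ∈ S.ringClasses μ, dBar μ F c y < ε := by
  obtain ⟨A, hA, rfl⟩ := c.exists_rep
  obtain ⟨R, hR, h⟩ := hF.exists_dBarSet_lt hA hε
  exact ⟨_, ⟨R, hR, rfl⟩, h⟩

/-- If `d̄(y i, x) ≤ 2⁻ⁱ⁻¹` for all `i`, then `y` is a fast Cauchy sequence with the limit `x`. -/
theorem IsPartition.cauchy_of_dBar_le (hF : S.IsPartition μ F) {y : ℕ → SetClass μ}
    {x : SetClass μ} (h : ∀ i, dBar μ F (y i) x ≤ (2 : ℝ)⁻¹ ^ (i + 1)) :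
    (∀ i j, i < j → dBar μ F (y i) (y j) ≤ (2 : ℝ)⁻¹ ^ i) ∧
      Tendsto (fun i => dBar μ F (y i) x) atTop (𝓝 0) := by
  constructor
  · intro i j hij
    have h1 := dBar_triangle hF.finite (y i) x (y j)
    rw [dBar_comm x] at h1
    have h2 : (2 : ℝ)⁻¹ ^ (j + 1) ≤ (2 : ℝ)⁻¹ ^ (i + 1) :=
      pow_le_pow_of_le_one (by norm_num) (by norm_num) (by omega)
    have h3 : (2 : ℝ)⁻¹ ^ (i + 1) = (2 : ℝ)⁻¹ ^ i / 2 := by rw [pow_succ]; ring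
    linarith [h i, h j]
  · refine squeeze_zero (fun i => dBar_nonneg _ _) h ?_
    exact (tendsto_pow_atTop_nhds_zero_of_lt_one (by norm_num) (by norm_num)).comp
      (tendsto_add_atTop_nat 1)

/-- Let `j` tend to infinity in the triangle inequality through `y j`. -/
theorem IsPartition.dBar_le_of_cauchy (hF : S.IsPartition μ F) {y : ℕ → SetClass μ}
    {x : SetClass μ} (h : ∀ i j, i < j → dBar μ F (y i) (y j) ≤ (2 : ℝ)⁻¹ ^ i)
    (hx : Tendsto (fun i => dBar μ F (y i) x) atTop (𝓝 0)) (i : ℕ) :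
    dBar μ F (y i) x ≤ (2 : ℝ)⁻¹ ^ i := by
  have h1 : Tendsto (fun j => (2 : ℝ)⁻¹ ^ i + dBar μ F (y j) x) atTop (𝓝 ((2 : ℝ)⁻¹ ^ i + 0)) :=
    hx.const_add _
  rw [add_zero] at h1
  refine ge_of_tendsto h1 (eventually_atTop.2 ⟨i + 1, fun j hj => ?_⟩)
  exact (dBar_triangle hF.finite (y i) (y j) x).trans (add_le_add (h i j hj) le_rfl)

theorem IsPartition.cauchyRep_isRepresentation (hF : S.IsPartition μ F) :
    IsRepresentation (CauchyRep (dBar μ F) (S.β μ)) := by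
  constructor
  · rintro p x x' ⟨v, y, hp, hy, -, hx⟩ ⟨v', y', hp', hy', -, hx'⟩
    obtain rfl := hp.unique hp'
    obtain rfl : y = y' := funext fun i => Part.mem_unique (hy i) (hy' i)
    refine (dBar_eq_zero_iff hF.finite hF.iUnion_eq x x').1 (le_antisymm ?_ (dBar_nonneg _ _))
    have h := hx.add hx'
    rw [add_zero] at h
    refine ge_of_tendsto' h fun i => ?_
    rw [dBar_comm (y i) x]
    exact dBar_triangle hF.finite _ _ _
  · intro x
    have h : ∀ i : ℕ, ∃ (w : Word k) (c : SetClass μ), c ∈ S.β μ w ∧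
        dBar μ F c x ≤ (2 : ℝ)⁻¹ ^ (i + 1) := by
      intro i
      obtain ⟨c, hc, hlt⟩ := hF.exists_dBar_lt x (show (0 : ℝ) < 2⁻¹ ^ (i + 1) by positivity)
      obtain ⟨w, hw⟩ := mem_ringClasses_iff.1 hc
      exact ⟨w, c, hw, by rw [dBar_comm]; exact hlt.le⟩
    choose v y hy hd using h
    obtain ⟨p, hp⟩ := exists_encodesSeq v
    obtain ⟨h1, h2⟩ := hF.cauchy_of_dBar_le hd
    exact ⟨p, v, y, hp, hy, h1, h2⟩

/-- The words that a `ζ̄`-name of `[A]` lists. -/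
def zetaWords (S : ComputableSigmaAlgebra k Ω) (μ : Measure Ω) (F : ℕ → Set Ω) (A : Set Ω)
    (x : Word k) : Prop :=
  ∃ u n v w : Word k, x = tuple [u, n, v, w] ∧
    ∃ (a : ℚ) (i : ℕ) (R : Set Ω) (b : ℚ),
      IsRatName u a ∧ IsNatName n i ∧ R ∈ S.α v ∧ IsRatName w b ∧
      (a : ℝ) < μ.real (F i ∩ R ∩ A) ∧ μ.real (F i ∩ R ∩ A) < (b : ℝ)

/-- Only a nonempty set of words is the range of a sequence, and the enumeration machine needs some
word to write. -/
theorem exists_zetaWords (S : ComputableSigmaAlgebra k Ω) (μ : Measure Ω) (F : ℕ → Set Ω)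
    (A : Set Ω) : ∃ x, S.zetaWords μ F A x := by
  obtain ⟨v, hv⟩ := (S.α_range ∅).1 S.isSetRing.empty_mem
  obtain ⟨a, ha⟩ := exists_rat_lt (μ.real (F 0 ∩ ∅ ∩ A))
  obtain ⟨b, hb⟩ := exists_rat_gt (μ.real (F 0 ∩ ∅ ∩ A))
  obtain ⟨u, hu⟩ := exists_isRatName (k := k) a
  obtain ⟨w, hw⟩ := exists_isRatName (k := k) b
  obtain ⟨n, hn⟩ := exists_isNatName (k := k) 0
  exact ⟨_, u, n, v, w, rfl, a, 0, ∅, b, hu, hn, hv, hw, ha, hb⟩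

theorem zetaBar_of_encodesSeq {A : Set Ω} (hA : MeasurableSet A) {q : InfSeq k} {x : ℕ → Word k}
    (hq : EncodesSeq q x) (hx : ∀ w, (∃ j, x j = w) ↔ S.zetaWords μ F A w) :
    S.ZetaBar μ F q (SetClass.mk μ A hA) := by
  refine ⟨A, hA, rfl, fun u n v w => ?_⟩
  rw [hq.listed_iff, hx]
  constructor
  · rintro ⟨u', n', v', w', h, h'⟩
    have h := tuple_injective h
    simp only [List.cons.injEq, and_true] at h
    obtain ⟨rfl, rfl, rfl, rfl⟩ := h
    exact h'
  · exact fun h => ⟨u, n, v, w, rfl, h⟩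

/-- A name determines the rational cuts of all `μ(F i ∩ R ∩ A)`, and these numbers determine the
class of `A`. Names exist because the words to be listed form a nonempty countable set. -/
theorem IsPartition.zetaBar_isRepresentation (hF : S.IsPartition μ F) :
    IsRepresentation (S.ZetaBar μ F) := by
  constructor
  · rintro p c c' ⟨A, hA, rfl, h⟩ ⟨B, hB, rfl, h'⟩
    refine SetClass.mk_eq_mk.2 (hF.symmDiff_null hA hB ?_)
    have key : ∀ A B : Set Ω, (∀ u n v w : Word k, Listed (tuple [u, n, v, w]) p ↔
        ∃ (a : ℚ) (i : ℕ) (R : Set Ω) (b : ℚ),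
        IsRatName u a ∧ IsNatName n i ∧ R ∈ S.α v ∧ IsRatName w b ∧
        (a : ℝ) < μ.real (F i ∩ R ∩ A) ∧ μ.real (F i ∩ R ∩ A) < (b : ℝ)) →
        (∀ u n v w : Word k, Listed (tuple [u, n, v, w]) p ↔
        ∃ (a : ℚ) (i : ℕ) (R : Set Ω) (b : ℚ),
        IsRatName u a ∧ IsNatName n i ∧ R ∈ S.α v ∧ IsRatName w b ∧
        (a : ℝ) < μ.real (F i ∩ R ∩ B) ∧ μ.real (F i ∩ R ∩ B) < (b : ℝ)) →
        ∀ i, ∀ R ∈ S.sets, μ.real (F i ∩ R ∩ A) ≤ μ.real (F i ∩ R ∩ B) := by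
      intro A B h h' i R hR
      by_contra hlt
      obtain ⟨a, ha1, ha2⟩ := exists_rat_btwn (not_le.1 hlt)
      obtain ⟨b, hb⟩ := exists_rat_gt (μ.real (F i ∩ R ∩ A))
      obtain ⟨v, hv⟩ := (S.α_range R).1 hR
      obtain ⟨u, hu⟩ := exists_isRatName (k := k) a
      obtain ⟨w, hw⟩ := exists_isRatName (k := k) b
      obtain ⟨n, hn⟩ := exists_isNatName (k := k) i
      obtain ⟨a', i', R', b', hu', hn', hv', -, hlt', -⟩ :=
        (h' u n v w).1 ((h u n v w).2 ⟨a, i, R, b, hu, hn, hv, hw, ha2, hb⟩)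
      obtain rfl := hu.unique hu'
      obtain rfl := hn.unique hn'
      obtain rfl := Part.mem_unique hv hv'
      exact lt_asymm ha1 hlt'
    exact fun i R hR => le_antisymm (key A B h h' i R hR) (key B A h' h i R hR)
  · intro c
    obtain ⟨A, hA, rfl⟩ := c.exists_rep
    obtain ⟨x, hx⟩ := (Set.to_countable {w | S.zetaWords μ F A w}).exists_eq_range
      (S.exists_zetaWords μ F A)
    obtain ⟨p, hp⟩ := exists_encodesSeq x
    refine ⟨p, S.zetaBar_of_encodesSeq hA hp fun w => ?_⟩
    have : w ∈ {w | S.zetaWords μ F A w} ↔ w ∈ Set.range x := by rw [hx]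
    exact this.symm

end ComputableSigmaAlgebra

end Classes

/-! ### Machines without infinite input -/

section BlankTape

variable {k : ℕ} {X : Type} [Primcodable X]

/-- Memory and output after `t` steps of a machine whose input tape is blank. -/
def TypeTwoMachine.blankRun (M : TypeTwoMachine k X) (x : X) (t : ℕ) : ℕ × Word k :=
  Nat.rec (M.start x, []) (fun _ c =>
    ((M.step c.1 none).1, c.2 ++ (M.step c.1 none).2.2.toList)) t

/-- Every cell of a blank tape reads `none`, so the head position is irrelevant and the run is a
plain recursion on the number of steps. -/
theorem TypeTwoMachine.blankRun_computable (M : TypeTwoMachine k X) :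
    Computable₂ M.blankRun := by
  refine Computable.nat_rec (h := fun _ (y : ℕ × ℕ × Word k) =>
    ((M.step y.2.1 none).1, y.2.2 ++ (M.step y.2.1 none).2.2.toList)) Computable.snd
    ((M.start_computable.comp Computable.fst).pair (Computable.const [])) ?_
  have h1 : Computable fun z : (X × ℕ) × ℕ × ℕ × Word k => M.step z.2.2.1 none :=
    M.step_computable.comp (Computable.fst.comp (Computable.snd.comp Computable.snd))
      (Computable.const none)
  exact (Computable.fst.comp h1).pair (Computable.list_append.comp
    (Computable.snd.comp (Computable.snd.comp Computable.snd))
    (Primrec.optionToList.to_comp.comp (Computable.snd.comp (Computable.snd.comp h1))))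

theorem TypeTwoMachine.run_blank (M : TypeTwoMachine k X) (x : X) (t : ℕ) :
    (M.run x (fun _ => none) t).memory = (M.blankRun x t).1 ∧
      (M.run x (fun _ => none) t).output = (M.blankRun x t).2 := by
  induction t with
  | zero => exact ⟨rfl, rfl⟩
  | succ t ih =>
    simp only [TypeTwoMachine.run, ih.1, ih.2]
    exact ⟨rfl, rfl⟩

theorem TypeTwoMachine.run_output_prefix (M : TypeTwoMachine k X) (x : X)
    (tape : ℕ → Option (Alphabet k)) {t t' : ℕ} (h : t ≤ t') :
    (M.run x tape t).output <+: (M.run x tape t').output := by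
  induction t', h using Nat.le_induction with
  | base => exact List.prefix_rfl
  | succ t' _ ih => exact ih.trans (List.prefix_append _ _)

theorem TypeTwoMachine.Writes.output_getElem? {M : TypeTwoMachine k X} {x : X}
    {tape : ℕ → Option (Alphabet k)} {q : InfSeq k} (h : M.Writes x tape q) {t i : ℕ}
    (hi : i < (M.run x tape t).output.length) : (M.run x tape t).output[i]? = some (q i) := by
  obtain ⟨t', ht'⟩ := h i
  rcases le_total t t' with hle | hle
  · rw [← ht', (M.run_output_prefix x tape hle).getElem?_of_eq_some (List.getElem?_eq_getElem hi),
      List.getElem?_eq_getElem hi]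
  · exact (M.run_output_prefix x tape hle).getElem?_of_eq_some ht'

theorem TypeTwoMachine.Writes.exists_le_length {M : TypeTwoMachine k X} {x : X}
    {tape : ℕ → Option (Alphabet k)} {q : InfSeq k} (h : M.Writes x tape q) (n : ℕ) :
    ∃ t, n < (M.run x tape t).output.length := by
  obtain ⟨t, ht⟩ := h n
  exact ⟨t, (List.getElem?_eq_some_iff.1 ht).1⟩

/-- The subsequence of a word at the positions `2 i + d`. -/
def halfWord (d : ℕ) (o : Word k) : Word k :=
  (List.range (o.length / 2)).map fun i => o.getD (2 * i + d) 0

theorem halfWord_primrec (d : ℕ) : Primrec (halfWord (k := k) d) :=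
  Primrec.list_map (Primrec.list_range.comp (Primrec.nat_div.comp Primrec.list_length
    (Primrec.const 2))) ((Primrec.list_getD 0).comp Primrec.fst
    (Primrec.nat_add.comp (Primrec.nat_double.comp Primrec.snd) (Primrec.const d)))

/-- The word `u` is listed by the even (`d = 0`) or odd (`d = 1`) half of the output. -/
theorem TypeTwoMachine.MapsFinite.listed_half_iff {M : TypeTwoMachine k X} {x : X} {q : InfSeq k}
    (h : M.MapsFinite x q) {d : ℕ} (hd : d < 2) (u : Word k) :
    Listed u (fun n => q (2 * n + d)) ↔
      ∃ t a b, halfWord d (M.blankRun x t).2 = a ++ wrap u ++ b := by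
  have key : ∀ t, halfWord d (M.blankRun x t).2 =
      (List.range ((M.blankRun x t).2.length / 2)).map fun n => q (2 * n + d) := by
    intro t
    refine List.map_congr_left fun i hi => ?_
    rw [List.mem_range] at hi
    rw [← (M.run_blank x t).2] at hi ⊢
    have := h.output_getElem? (t := t) (i := 2 * i + d) (by omega)
    rw [List.getD, this]
    rfl
  rw [Listed, isSubword_iff]
  constructor
  · rintro ⟨n, a, b, hn⟩
    obtain ⟨t, ht⟩ := h.exists_le_length (2 * n)
    rw [(M.run_blank x t).2] at ht
    have hle : n ≤ (M.blankRun x t).2.length / 2 := by omega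
    obtain ⟨m, hm⟩ := Nat.exists_eq_add_of_le hle
    refine ⟨t, a, b ++ ((List.range m).map fun i => q (2 * (n + i) + d)), ?_⟩
    rw [key, hm, List.range_add, List.map_append, hn, List.map_map, List.append_assoc _ b]
    rfl
  · rintro ⟨t, a, b, ht⟩
    exact ⟨_, a, b, (key t).symm.trans ht⟩

theorem TypeTwoMachine.halfWord_semiDec (M : TypeTwoMachine k X) (d : ℕ) :
    SemiDec fun y : X × Word k => ∃ t a b, halfWord d (M.blankRun y.1 t).2 = a ++ wrap y.2 ++ b := by
  have h : SemiDec fun z : (X × Word k) × ℕ × Word k × Word k =>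
      halfWord d (M.blankRun z.1.1 z.2.1).2 = z.2.2.1 ++ wrap z.1.2 ++ z.2.2.2 := by
    have h2 : Computable fun z : (X × Word k) × ℕ × Word k × Word k => z.2.2 :=
      Computable.snd.comp Computable.snd
    refine SemiDec.of_computable_eq ((halfWord_primrec d).to_comp.comp (Computable.snd.comp
      (M.blankRun_computable.comp (Computable.fst.comp Computable.fst)
        (Computable.fst.comp Computable.snd)))) ?_
    exact Computable.list_append.comp (Computable.list_append.comp (Computable.fst.comp h2)
      (wrap_primrec.to_comp.comp (Computable.snd.comp Computable.fst))) (Computable.snd.comp h2)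
  exact h.exists.of_iff fun y => ⟨fun ⟨t, a, b, h⟩ => ⟨(t, a, b), h⟩,
    fun ⟨⟨t, a, b⟩, h⟩ => ⟨t, a, b, h⟩⟩

end BlankTape

/-! ### Total computable operations -/

section Effective

variable {k : ℕ}

/-- Uniformization applies to the graph of the partial realizer because the domain of the notation
is recursive; values on non-names are arbitrary. -/
theorem NotationComputable₂.exists_computable {Y : Type*} {ν : Word k →. Y} {op : Y → Y → Y}
    (h : NotationComputable₂ ν op) (hD : ComputablePred fun w => (ν w).Dom) :
    ∃ f : Word k × Word k → Word k, Computable f ∧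
      ∀ u v A B, A ∈ ν u → B ∈ ν v → op A B ∈ ν (f (u, v)) := by
  obtain ⟨f, hf, hfop⟩ := h
  obtain ⟨d, hd, hdD⟩ := ComputablePred.computable_iff.1 hD
  have hD₂ : ComputablePred fun x : Word k × Word k => (d x.1 && d x.2 : Bool) = true :=
    ComputablePred.computable_iff.2 ⟨_, Primrec.and.to_comp.comp (hd.comp Computable.fst)
      (hd.comp Computable.snd), rfl⟩
  have hdom : ∀ w, d w = true ↔ (ν w).Dom := fun w => by
    rw [show (ν w).Dom = _ from congrFun hdD w]
  have hex : ∀ x : Word k × Word k, (d x.1 && d x.2 : Bool) = true → ∃ w, w ∈ f x := by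
    intro x hx
    rw [Bool.and_eq_true, hdom, hdom] at hx
    obtain ⟨w, hw, -⟩ := hfop x.1 x.2 _ _ (Part.get_mem hx.1) (Part.get_mem hx.2)
    exact ⟨w, hw⟩
  obtain ⟨F, hF, hFf⟩ := hf.semiDec_graph.choose hD₂ hex
  refine ⟨F, hF, fun u v A B hA hB => ?_⟩
  obtain ⟨w, hw, hop⟩ := hfop u v A B hA hB
  have hmem : F (u, v) ∈ f (u, v) := hFf (u, v) (by
    rw [Bool.and_eq_true, hdom, hdom]
    exact ⟨(Part.dom_iff_mem.2 ⟨A, hA⟩), (Part.dom_iff_mem.2 ⟨B, hB⟩)⟩)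
  rwa [Part.mem_unique hmem hw]

/-- A real function that is computable in the sense of the representation `ρ` has dyadic
approximations that are total computable functions of the name and the precision. -/
theorem RhoComputable.exists_approx {Y : Type*} {ν : Word k →. Y} {φ : Y → ℝ}
    (h : RhoComputable ν φ) (hD : ComputablePred fun w => (ν w).Dom) (hφ : ∀ y, 0 ≤ φ y) :
    ∃ m : Word k × ℕ → ℕ, Computable m ∧
      ∀ w y, y ∈ ν w → ∀ n, |φ y * 2 ^ n - m (w, n)| ≤ 1 := by
  obtain ⟨M, hM⟩ := h
  have hcut : ∀ w y, y ∈ ν w → ∀ (x : ℝ), (x < φ y ↔ ∃ u, (∃ t a b,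
      halfWord 0 (M.blankRun w t).2 = a ++ wrap u ++ b) ∧
        ∃ r : ℚ, IsRatName u r ∧ x < r) ∧ (φ y < x ↔ ∃ u, (∃ t a b,
      halfWord 1 (M.blankRun w t).2 = a ++ wrap u ++ b) ∧
        ∃ r : ℚ, IsRatName u r ∧ (r : ℝ) < x) := by
    intro w y hy x
    obtain ⟨q, hq, hlt, hgt⟩ := hM w y hy
    simp only [← hq.listed_half_iff (show 0 < 2 by norm_num),
      ← hq.listed_half_iff (show 1 < 2 by norm_num)]
    constructor
    · constructor
      · intro hx
        obtain ⟨r, hr1, hr2⟩ := exists_rat_btwn hx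
        obtain ⟨u, hu⟩ := exists_isRatName (k := k) r
        exact ⟨u, (hlt u).2 ⟨r, hu, hr2⟩, r, hu, hr1⟩
      · rintro ⟨u, hu, r, hr, hxr⟩
        obtain ⟨r', hr', hlt'⟩ := (hlt u).1 hu
        obtain rfl := hr.unique hr'
        exact hxr.trans hlt'
    · constructor
      · intro hx
        obtain ⟨r, hr1, hr2⟩ := exists_rat_btwn hx
        obtain ⟨u, hu⟩ := exists_isRatName (k := k) r
        exact ⟨u, (hgt u).2 ⟨r, hu, hr1⟩, r, hu, hr2⟩
      · rintro ⟨u, hu, r, hr, hxr⟩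
        obtain ⟨r', hr', hlt'⟩ := (hgt u).1 hu
        obtain rfl := hr.unique hr'
        exact hlt'.trans hxr
  -- The value lies strictly between `(m - 1) / 2 ^ n` and `(m + 1) / 2 ^ n`. Both strict
  -- inequalities are confirmed by a rational that the machine has listed after finitely many steps.
  let P : (Word k × ℕ) × ℕ → Prop := fun z =>
    (∃ u, (∃ t a b, halfWord 0 (M.blankRun z.1.1 t).2 = a ++ wrap u ++ b) ∧
      ∃ r : ℚ, IsRatName u r ∧ ((z.2 : ℝ) - (1 : ℕ)) / 2 ^ z.1.2 < r) ∧
    (∃ u, (∃ t a b, halfWord 1 (M.blankRun z.1.1 t).2 = a ++ wrap u ++ b) ∧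
      ∃ r : ℚ, IsRatName u r ∧ (r : ℝ) < (((z.2 + 1 : ℕ) : ℝ) - (0 : ℕ)) / 2 ^ z.1.2)
  have hP : SemiDec P := by
    let Z := ((Word k × ℕ) × ℕ) × Word k
    have hw : Computable fun z : Z => z.1.1.1 :=
      Computable.fst.comp (Computable.fst.comp Computable.fst)
    have hn : Computable fun z : Z => z.1.1.2 :=
      Computable.snd.comp (Computable.fst.comp Computable.fst)
    have hm : Computable fun z : Z => z.1.2 := Computable.snd.comp Computable.fst
    refine SemiDec.and ?_ ?_
    · exact SemiDec.exists (((M.halfWord_semiDec 0).comp (hw.pair Computable.snd)).and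
        (lt_ratName_semiDec (u := fun z : Z => z.2) Computable.snd hm (Computable.const 1) hn))
    · exact SemiDec.exists (((M.halfWord_semiDec 1).comp (hw.pair Computable.snd)).and
        (ratName_lt_semiDec (u := fun z : Z => z.2) Computable.snd (Computable.succ.comp hm)
          (Computable.const 0) hn))
  obtain ⟨d, hd, hdD⟩ := ComputablePred.computable_iff.1 hD
  have hD₂ : ComputablePred fun x : Word k × ℕ => d x.1 = true :=
    ComputablePred.computable_iff.2 ⟨_, hd.comp Computable.fst, rfl⟩
  have hdom : ∀ w, d w = true ↔ (ν w).Dom := fun w => by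
    rw [show (ν w).Dom = _ from congrFun hdD w]
  obtain ⟨m, hm, hmP⟩ := hP.choose hD₂ (fun x hx => by
    obtain ⟨w, n⟩ := x
    have hy := Part.get_mem ((hdom w).1 hx)
    -- The floor satisfies both strict inequalities, so the search ends; natural numbers suffice
    -- since `φ` is nonnegative.
    refine ⟨⌊φ ((ν w).get ((hdom w).1 hx)) * 2 ^ n⌋₊, ((hcut w _ hy _).1).1 ?_,
      ((hcut w _ hy _).2).1 ?_⟩
    · rw [div_lt_iff₀ (by positivity)]
      have := Nat.floor_le (show 0 ≤ φ ((ν w).get ((hdom w).1 hx)) * 2 ^ n from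
        mul_nonneg (hφ _) (by positivity))
      push_cast
      linarith
    · rw [lt_div_iff₀ (by positivity)]
      have := Nat.lt_floor_add_one (φ ((ν w).get ((hdom w).1 hx)) * 2 ^ n)
      push_cast
      linarith)
  refine ⟨m, hm, fun w y hy n => ?_⟩
  obtain ⟨h1, h2⟩ := hmP (w, n) ((hdom w).2 (Part.dom_iff_mem.2 ⟨y, hy⟩))
  have h1 := ((hcut w y hy _).1).2 h1
  have h2 := ((hcut w y hy _).2).2 h2
  rw [div_lt_iff₀ (by positivity)] at h1
  rw [lt_div_iff₀ (by positivity)] at h2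
  push_cast at h1 h2
  rw [abs_le]
  constructor <;> linarith

end Effective

/-! ### Effective operations of a computable measure -/

/-- Total computable functions for the partition, the ring operations and the measure. -/
structure EffectiveOps {k : ℕ} {Ω : Type*} [MeasurableSpace Ω] (S : ComputableSigmaAlgebra k Ω)
    (μ : Measure Ω) (F : ℕ → Set Ω) where
  /-- names of the sets of the partition -/
  part : ℕ → Word k
  part_computable : Computable part
  mem_part : ∀ i, F i ∈ S.α (part i)
  /-- union -/
  union : Word k × Word k → Word k
  union_computable : Computable union
  mem_union : ∀ u v A B, A ∈ S.α u → B ∈ S.α v → A ∪ B ∈ S.α (union (u, v))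
  /-- difference -/
  diff : Word k × Word k → Word k
  diff_computable : Computable diff
  mem_diff : ∀ u v A B, A ∈ S.α u → B ∈ S.α v → A \ B ∈ S.α (diff (u, v))
  /-- approximations of the measure -/
  approx : Word k × ℕ → ℕ
  approx_computable : Computable approx
  abs_sub_approx_le : ∀ w R, R ∈ S.α w → ∀ n, |μ.real R * 2 ^ n - approx (w, n)| ≤ 1

section Dist

variable {k : ℕ} {Ω : Type*} [MeasurableSpace Ω] {S : ComputableSigmaAlgebra k Ω} {μ : Measure Ω}
  {F : ℕ → Set Ω}

theorem ComputableSigmaAlgebra.IsPartition.exists_effectiveOps (hF : S.IsPartition μ F)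
    (hμ : S.IsComputableMeasure μ) : Nonempty (EffectiveOps S μ F) := by
  obtain ⟨g, hg, hgF⟩ := hF.computable
  obtain ⟨un, hun, hun'⟩ := S.union_computable.exists_computable S.α_dom
  obtain ⟨di, hdi, hdi'⟩ := S.diff_computable.exists_computable S.α_dom
  obtain ⟨m, hm, hm'⟩ := hμ.computable.exists_approx S.α_dom fun _ => measureReal_nonneg
  exact ⟨⟨g, hg, hgF, un, hun, hun', di, hdi, hdi', m, hm, hm'⟩⟩

namespace EffectiveOps

variable (E : EffectiveOps S μ F)

/-- Intersection. -/
def inter (x : Word k × Word k) : Word k := E.diff (x.1, E.diff x)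

theorem inter_computable : Computable E.inter :=
  E.diff_computable.comp (Computable.fst.pair E.diff_computable)

theorem mem_inter {u v : Word k} {A B : Set Ω} (hA : A ∈ S.α u) (hB : B ∈ S.α v) :
    A ∩ B ∈ S.α (E.inter (u, v)) := by
  have := E.mem_diff _ _ _ _ hA (E.mem_diff _ _ _ _ hA hB)
  rwa [Set.sdiff_sdiff_right_self] at this

/-- A name of `F i ∩ (A ∆ B)`. -/
def partSymmDiff (x : (Word k × Word k) × ℕ) : Word k :=
  E.inter (E.part x.2, E.union (E.diff x.1, E.diff x.1.swap))

theorem partSymmDiff_computable : Computable E.partSymmDiff := by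
  have h : Computable fun x : (Word k × Word k) × ℕ => x.1 := Computable.fst
  exact E.inter_computable.comp ((E.part_computable.comp Computable.snd).pair
    (E.union_computable.comp ((E.diff_computable.comp h).pair
      (E.diff_computable.comp ((Computable.snd.comp h).pair (Computable.fst.comp h))))))

theorem mem_partSymmDiff {u v : Word k} {A B : Set Ω} (hA : A ∈ S.α u) (hB : B ∈ S.α v) (i : ℕ) :
    F i ∩ (A ∆ B) ∈ S.α (E.partSymmDiff ((u, v), i)) :=
  E.mem_inter (E.mem_part i)
    (E.mem_union _ _ _ _ (E.mem_diff _ _ _ _ hA hB) (E.mem_diff _ _ _ _ hB hA))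

/-- Approximation of `2 ^ p * dBarTerm μ F A B i`. -/
def termApprox (x : ((Word k × Word k) × ℕ) × ℕ) : ℕ :=
  2 ^ x.1.2 * E.approx (E.partSymmDiff (x.1.1, x.2), x.1.2) /
    ((2 ^ x.1.2 + E.approx (E.partSymmDiff (x.1.1, x.2), x.1.2)) * 2 ^ x.2)

theorem termApprox_computable : Computable E.termApprox := by
  have hp : Computable fun x : ((Word k × Word k) × ℕ) × ℕ => x.1.2 :=
    Computable.snd.comp Computable.fst
  have h2 := two_pow_primrec.to_comp.comp hp
  have hm : Computable fun x : ((Word k × Word k) × ℕ) × ℕ =>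
      E.approx (E.partSymmDiff (x.1.1, x.2), x.1.2) :=
    E.approx_computable.comp ((E.partSymmDiff_computable.comp
      ((Computable.fst.comp Computable.fst).pair Computable.snd)).pair hp)
  exact Primrec.nat_div.to_comp.comp (Primrec.nat_mul.to_comp.comp h2 hm)
    (Primrec.nat_mul.to_comp.comp (Primrec.nat_add.to_comp.comp h2 hm)
      (two_pow_primrec.to_comp.comp Computable.snd))

/-- The error `2⁻ⁱ` comes from the approximate measure, whose error `2⁻ᵖ` passes through the
`1`-Lipschitz map `t / (1 + t)`. The error `1` comes from rounding the quotient down. -/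
theorem abs_termApprox_sub_le {u v : Word k} {A B : Set Ω} (hA : A ∈ S.α u) (hB : B ∈ S.α v)
    (p i : ℕ) :
    |dBarTerm μ F A B i * 2 ^ p - E.termApprox (((u, v), p), i)| ≤ 1 + (2 : ℝ)⁻¹ ^ i := by
  have h := E.abs_sub_approx_le _ _ (E.mem_partSymmDiff hA hB i) p
  rw [dBarTerm, termApprox]
  have hx : 0 ≤ μ.real (F i ∩ (A ∆ B)) := measureReal_nonneg
  dsimp only
  generalize E.approx (E.partSymmDiff ((u, v), i), p) = m at h ⊢
  generalize μ.real (F i ∩ (A ∆ B)) = x at *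
  have hP : (0 : ℝ) < 2 ^ p := by positivity
  let T : ℝ := (m / 2 ^ p) / (1 + m / 2 ^ p) * (2 : ℝ)⁻¹ ^ i * 2 ^ p
  have hT : T = ((2 ^ p * m : ℕ) : ℝ) / (((2 ^ p + m) * 2 ^ i : ℕ) : ℝ) := by
    simp only [T]
    push_cast
    rw [inv_pow]
    field_simp
  have h1 : |x / (1 + x) * (2 : ℝ)⁻¹ ^ i * 2 ^ p - T| ≤ (2 : ℝ)⁻¹ ^ i := by
    have e : x / (1 + x) * (2 : ℝ)⁻¹ ^ i * 2 ^ p - T =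
        (x / (1 + x) - (m / 2 ^ p) / (1 + m / 2 ^ p)) * ((2 : ℝ)⁻¹ ^ i * 2 ^ p) := by
      simp only [T]; ring
    rw [e, abs_mul, abs_of_pos (show 0 < (2 : ℝ)⁻¹ ^ i * 2 ^ p by positivity)]
    have h2 := abs_div_one_add_sub_le hx (show (0 : ℝ) ≤ m / 2 ^ p by positivity)
    have h3 : |x - m / 2 ^ p| ≤ 1 / 2 ^ p := by
      rw [le_div_iff₀ hP]
      calc |x - m / 2 ^ p| * 2 ^ p = |x * 2 ^ p - m| := by
            rw [← abs_of_pos hP, ← abs_mul, abs_of_pos hP]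
            congr 1
            field_simp
        _ ≤ 1 := h
    calc |x / (1 + x) - (m / 2 ^ p) / (1 + m / 2 ^ p)| * ((2 : ℝ)⁻¹ ^ i * 2 ^ p)
        ≤ (1 / 2 ^ p) * ((2 : ℝ)⁻¹ ^ i * 2 ^ p) :=
          mul_le_mul_of_nonneg_right (h2.trans h3) (by positivity)
      _ = (2 : ℝ)⁻¹ ^ i := by field_simp
  have h4 : |T - ((2 ^ p * m / ((2 ^ p + m) * 2 ^ i) : ℕ) : ℝ)| ≤ 1 := by
    rw [hT, ← Nat.floor_div_eq_div (K := ℝ)]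
    have h5 : (0 : ℝ) ≤ ((2 ^ p * m : ℕ) : ℝ) / (((2 ^ p + m) * 2 ^ i : ℕ) : ℝ) := by positivity
    have h6 := Nat.floor_le h5
    have h7 := Nat.lt_floor_add_one (((2 ^ p * m : ℕ) : ℝ) / (((2 ^ p + m) * 2 ^ i : ℕ) : ℝ))
    rw [abs_le]
    constructor <;> linarith
  calc _ ≤ |x / (1 + x) * (2 : ℝ)⁻¹ ^ i * 2 ^ p - T| +
        |T - ((2 ^ p * m / ((2 ^ p + m) * 2 ^ i) : ℕ) : ℝ)| := abs_sub_le _ _ _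
    _ ≤ 1 + (2 : ℝ)⁻¹ ^ i := by linarith

/-- Approximation of `2 ^ p * dBarSet μ F A B`. -/
def distApprox (x : (Word k × Word k) × ℕ) : ℕ :=
  Nat.rec 0 (fun i s => s + E.termApprox (x, i)) x.2

theorem distApprox_computable : Computable E.distApprox := by
  refine Computable.nat_rec (h := fun (x : (Word k × Word k) × ℕ) (y : ℕ × ℕ) =>
    y.2 + E.termApprox (x, y.1)) Computable.snd (Computable.const 0) ?_
  exact Primrec.nat_add.to_comp.comp (Computable.snd.comp Computable.snd)
    (E.termApprox_computable.comp (Computable.fst.pair (Computable.fst.comp Computable.snd)))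

theorem distApprox_eq (x : (Word k × Word k) × ℕ) :
    E.distApprox x = ∑ i ∈ Finset.range x.2, E.termApprox (x, i) := by
  rw [distApprox]
  generalize x.2 = n
  induction n with
  | zero => rfl
  | succ n ih => rw [Finset.sum_range_succ, ← ih]

/-- Over the `p` summands the rounding errors add up to at most `p` and the measure errors to at
most `2`. The tail `2 * 2⁻ᵖ`, scaled by `2 ^ p`, contributes another `2`. -/
theorem abs_distApprox_sub_le {u v : Word k} {A B : Set Ω} (hA : A ∈ S.α u) (hB : B ∈ S.α v)
    (p : ℕ) : |dBarSet μ F A B * 2 ^ p - E.distApprox ((u, v), p)| ≤ p + 4 := by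
  have h1 := sum_dBarTerm_le_dBarSet μ F A B p
  have h2 := dBarSet_le_sum_dBarTerm_add μ F A B p
  have h3 : |(∑ i ∈ Finset.range p, dBarTerm μ F A B i) * 2 ^ p - E.distApprox ((u, v), p)| ≤
      p + 2 := by
    rw [distApprox_eq]
    push_cast
    rw [Finset.sum_mul, ← Finset.sum_sub_distrib]
    refine (Finset.abs_sum_le_sum_abs _ _).trans ((Finset.sum_le_sum fun i _ =>
      E.abs_termApprox_sub_le hA hB p i).trans ?_)
    rw [Finset.sum_add_distrib, Finset.sum_const, Finset.card_range, nsmul_eq_mul, mul_one]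
    refine add_le_add le_rfl
      ((summable_inv_two_pow.sum_le_tsum _ fun j _ => by positivity).trans ?_)
    rw [tsum_geometric_of_lt_one (by norm_num) (by norm_num)]
    norm_num
  have hP : (0 : ℝ) < 2 ^ p := by positivity
  have h4 : (2 : ℝ)⁻¹ ^ p * 2 ^ p = 1 := by rw [← mul_pow]; norm_num
  rw [abs_le] at h3 ⊢
  have h5 := mul_le_mul_of_nonneg_right h1 hP.le
  have h6 := mul_le_mul_of_nonneg_right h2 hP.le
  rw [add_mul] at h6
  constructor <;> nlinarith

end EffectiveOps

theorem exists_mul_div_two_pow_lt {ε : ℝ} (hε : 0 < ε) : ∃ p : ℕ, 2 * ((p : ℝ) + 4) / 2 ^ p < ε := by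
  have h1 : Tendsto (fun p : ℕ => (p : ℝ) ^ 1 / (2 : ℝ) ^ p) atTop (𝓝 0) :=
    tendsto_pow_const_div_const_pow_of_one_lt 1 (by norm_num)
  have h2 : Tendsto (fun p : ℕ => (p : ℝ) ^ 0 / (2 : ℝ) ^ p) atTop (𝓝 0) :=
    tendsto_pow_const_div_const_pow_of_one_lt 0 (by norm_num)
  have h3 := (h1.const_mul 2).add (h2.const_mul 8)
  simp only [mul_zero, add_zero] at h3
  obtain ⟨p, hp⟩ := (h3.eventually_lt_const hε).exists
  refine ⟨p, lt_of_le_of_lt (le_of_eq ?_) hp⟩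
  ring

/-- Cuts of a real number that is approximated with the precision `(p + 4) / 2 ^ p`. -/
theorem lt_iff_of_approx {d : ℝ} {D : ℕ → ℕ} (hD : ∀ p : ℕ, |d * 2 ^ p - D p| ≤ p + 4) (r : ℝ) :
    (r < d ↔ ∃ p, r < ((D p : ℝ) - (p + 4 : ℕ)) / 2 ^ p) ∧
      (d < r ↔ ∃ p, (((D p + (p + 4) : ℕ) : ℝ) - (0 : ℕ)) / 2 ^ p < r) := by
  have key : ∀ p, ((D p : ℝ) - (p + 4 : ℕ)) / 2 ^ p ≤ d ∧
      d ≤ (((D p + (p + 4) : ℕ) : ℝ) - (0 : ℕ)) / 2 ^ p ∧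
      d - 2 * ((p : ℝ) + 4) / 2 ^ p ≤ ((D p : ℝ) - (p + 4 : ℕ)) / 2 ^ p ∧
      (((D p + (p + 4) : ℕ) : ℝ) - (0 : ℕ)) / 2 ^ p ≤ d + 2 * ((p : ℝ) + 4) / 2 ^ p := by
    intro p
    have h := abs_le.1 (hD p)
    have hP : (0 : ℝ) < 2 ^ p := by positivity
    refine ⟨?_, ?_, ?_, ?_⟩
    · rw [div_le_iff₀ hP]; push_cast; linarith
    · rw [le_div_iff₀ hP]; push_cast; linarith
    · rw [le_div_iff₀ hP, sub_mul, div_mul_cancel₀ _ hP.ne']; push_cast; linarith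
    · rw [div_le_iff₀ hP, add_mul, div_mul_cancel₀ _ hP.ne']; push_cast; linarith
  constructor
  · constructor
    · intro h
      obtain ⟨p, hp⟩ := exists_mul_div_two_pow_lt (sub_pos.2 h)
      exact ⟨p, by linarith [(key p).2.2.1]⟩
    · rintro ⟨p, hp⟩
      exact hp.trans_le (key p).1
  · constructor
    · intro h
      obtain ⟨p, hp⟩ := exists_mul_div_two_pow_lt (sub_pos.2 h)
      exact ⟨p, by linarith [(key p).2.2.2]⟩
    · rintro ⟨p, hp⟩
      exact (key p).2.1.trans_lt hp

/-- The machine enumerates pairs of a lower and an upper rational bound and writes them interleaved.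
Bounds of both kinds exist, so every lower bound occurs in some pair, and likewise every upper
bound. -/
theorem EffectiveOps.dist_rhoComputable (E : EffectiveOps S μ F) :
    RhoComputable₂ (S.β μ) (dBar μ F) := by
  let Q : (Word k × Word k) × List (Option (Alphabet k)) × (Word k × Word k) → Prop := fun z =>
    (∃ p, ∃ r : ℚ, IsRatName z.2.2.1 r ∧
      (r : ℝ) < ((E.distApprox (z.1, p) : ℝ) - (p + 4 : ℕ)) / 2 ^ p) ∧
    (∃ p, ∃ r : ℚ, IsRatName z.2.2.2 r ∧
      (((E.distApprox (z.1, p) + (p + 4) : ℕ) : ℝ) - (0 : ℕ)) / 2 ^ p < r)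
  have hQ : SemiDec Q := by
    let Z := ((Word k × Word k) × List (Option (Alphabet k)) × (Word k × Word k)) × ℕ
    have hu : Computable fun z : Z => z.1.2.2 :=
      Computable.snd.comp (Computable.snd.comp Computable.fst)
    have hp : Computable fun z : Z => z.2 := Computable.snd
    have hD : Computable fun z : Z => E.distApprox (z.1.1, z.2) :=
      E.distApprox_computable.comp ((Computable.fst.comp Computable.fst).pair hp)
    have hp4 : Computable fun z : Z => z.2 + 4 :=
      Primrec.nat_add.to_comp.comp hp (Computable.const 4)
    exact (SemiDec.exists (ratName_lt_semiDec (u := fun z : Z => z.1.2.2.1)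
      (Computable.fst.comp hu) hD hp4 hp)).and
      (SemiDec.exists (lt_ratName_semiDec (u := fun z : Z => z.1.2.2.2) (Computable.snd.comp hu)
        (Primrec.nat_add.to_comp.comp hD hp4) (Computable.const 0) hp))
  obtain ⟨M, hM⟩ := exists_enumMachine hQ (fun _ _ _ _ _ h => h)
    (enc := pairBlock) pairBlock_primrec.to_comp pairBlock_ne_nil
  refine ⟨M, fun u v c c' hc hc' => ?_⟩
  obtain ⟨A, hA, rfl⟩ := ComputableSigmaAlgebra.mem_β_iff.1 hc
  obtain ⟨B, hB, rfl⟩ := ComputableSigmaAlgebra.mem_β_iff.1 hc'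
  rw [dBar_mk]
  have hcut := lt_iff_of_approx (E.abs_distApprox_sub_le hA hB)
  have hQ' : ∀ s a b, Q ((u, v), s, a, b) ↔
      (∃ r : ℚ, IsRatName a r ∧ (r : ℝ) < dBarSet μ F A B) ∧
      (∃ r : ℚ, IsRatName b r ∧ dBarSet μ F A B < (r : ℝ)) := by
    intro s a b
    simp only [(hcut _).1, (hcut _).2, Q]
    refine and_congr ⟨?_, ?_⟩ ⟨?_, ?_⟩
    · rintro ⟨p, r, hr, h⟩
      exact ⟨r, hr, p, h⟩
    · rintro ⟨r, hr, p, h⟩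
      exact ⟨p, r, hr, h⟩
    · rintro ⟨p, r, hr, h⟩
      exact ⟨r, hr, p, h⟩
    · rintro ⟨r, hr, p, h⟩
      exact ⟨p, r, hr, h⟩
  obtain ⟨r₁, hr₁⟩ := exists_rat_lt (dBarSet μ F A B)
  obtain ⟨r₂, hr₂⟩ := exists_rat_gt (dBarSet μ F A B)
  obtain ⟨a₁, ha₁⟩ := exists_isRatName (k := k) r₁
  obtain ⟨a₂, ha₂⟩ := exists_isRatName (k := k) r₂
  obtain ⟨x, q, hW, hx, hq⟩ := hM (u, v) (fun _ => none)
    ⟨0, (a₁, a₂), (hQ' _ _ _).2 ⟨⟨r₁, ha₁, hr₁⟩, r₂, ha₂, hr₂⟩⟩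
  obtain ⟨h1, h2⟩ := listed_of_pairBlocks hq
  refine ⟨q, hW, fun w => ?_, fun w => ?_⟩
  · rw [h1]
    constructor
    · rintro ⟨j, rfl⟩
      obtain ⟨n, hn⟩ := (hx _).1 ⟨j, rfl⟩
      exact ((hQ' _ _ _).1 hn).1
    · intro hw
      obtain ⟨j, hj⟩ := (hx (w, a₂)).2 ⟨0, (hQ' _ _ _).2 ⟨hw, r₂, ha₂, hr₂⟩⟩
      exact ⟨j, by rw [hj]⟩
  · rw [h2]
    constructor
    · rintro ⟨j, rfl⟩
      obtain ⟨n, hn⟩ := (hx _).1 ⟨j, rfl⟩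
      exact ((hQ' _ _ _).1 hn).2
    · intro hw
      obtain ⟨j, hj⟩ := (hx (a₁, w)).2 ⟨0, (hQ' _ _ _).2 ⟨⟨r₁, ha₁, hr₁⟩, hw⟩⟩
      exact ⟨j, by rw [hj]⟩

theorem ComputableSigmaAlgebra.IsPartition.isComputableMetricSpace (hF : S.IsPartition μ F)
    (hμ : S.IsComputableMeasure μ) :
    IsComputableMetricSpace (dBar μ F) (S.ringClasses μ) (S.β μ) where
  dist_eq_zero_iff := dBar_eq_zero_iff hF.finite hF.iUnion_eq
  dist_comm := dBar_comm
  dist_triangle := dBar_triangle hF.finite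
  dense c _ hε := hF.exists_dBar_lt c hε
  notation_range _ := mem_ringClasses_iff
  notation_dom := S.α_dom
  dist_computable := by
    obtain ⟨E⟩ := hF.exists_effectiveOps hμ
    exact E.dist_rhoComputable

end Dist

/-! ### Words on the input tape -/

section InputTape

variable {k : ℕ} {α : Type*} [Primcodable α]

theorem map_some_prefix_tapePrefix_iff {p : InfSeq k} {u : Word k} {n : ℕ} :
    u.map some <+: tapePrefix (fun n => some (p n)) n ↔ OccursAt u p 0 ∧ u.length ≤ n := by
  have h1 : tapePrefix (fun n => some (p n)) n = ((List.range n).map p).map some := by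
    simp [tapePrefix]
  rw [h1]
  constructor
  · intro h
    have hlen : u.length ≤ n := by simpa using h.length_le
    refine ⟨occursAt_iff_prefix.2 ?_, hlen⟩
    have h2 := List.prefix_iff_eq_take.1 h
    rw [← List.map_take, List.length_map, ← List.map_take, List.take_range, min_eq_left hlen] at h2
    exact (List.map_injective_iff.2 (Option.some_injective _) h2).symm
  · rintro ⟨h, hn⟩
    obtain ⟨m, rfl⟩ := Nat.exists_eq_add_of_le hn
    rw [List.range_add, List.map_append, occursAt_iff_prefix.1 h, List.map_append]
    exact List.prefix_append _ _

theorem prefix_semiDec {s : α → List (Option (Alphabet k))} {u : α → Word k} (hs : Computable s)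
    (hu : Computable u) : SemiDec fun z => (u z).map some <+: s z := by
  have hm : Computable fun w : Word k => w.map some :=
    (Primrec.list_map (g := fun _ a => some a) Primrec.id
      (Primrec.option_some.comp Primrec.snd)).to_comp
  exact SemiDec.exists (p := fun z : α × List (Option (Alphabet k)) =>
    (u z.1).map some ++ z.2 = s z.1) (SemiDec.of_computable_eq (Computable.list_append.comp
      (hm.comp (hu.comp Computable.fst)) Computable.snd) (hs.comp Computable.fst))

/-- The word `x` is listed by the part `s` of the input tape. -/
def ListedIn (x : Word k) (s : List (Option (Alphabet k))) : Prop :=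
  ∃ a : Word k, (a ++ wrap x).map some <+: s

theorem ListedIn.mono {x : Word k} {s s' : List (Option (Alphabet k))} (h : ListedIn x s)
    (hs : s <+: s') : ListedIn x s' := by
  obtain ⟨a, ha⟩ := h
  exact ⟨a, ha.trans hs⟩

theorem listed_iff_exists_listedIn {p : InfSeq k} {x : Word k} :
    Listed x p ↔ ∃ n, ListedIn x (tapePrefix (fun n => some (p n)) n) := by
  constructor
  · rintro ⟨i, hi⟩
    have h : OccursAt ((List.range i).map p ++ wrap x) p 0 :=
      occursAt_append.2 ⟨occursAt_prefix p i, by simpa using hi⟩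
    exact ⟨_, _, map_some_prefix_tapePrefix_iff.2 ⟨h, le_rfl⟩⟩
  · rintro ⟨n, a, ha⟩
    exact ⟨_, (occursAt_append.1 (map_some_prefix_tapePrefix_iff.1 ha).1).2⟩

theorem listedIn_semiDec {s : α → List (Option (Alphabet k))} {x : α → Word k} (hs : Computable s)
    (hx : Computable x) : SemiDec fun z => ListedIn (x z) (s z) :=
  SemiDec.exists (p := fun z : α × Word k => (z.2 ++ wrap (x z.1)).map some <+: s z.1)
    (prefix_semiDec (hs.comp Computable.fst) (Computable.list_append.comp Computable.snd
      (wrap_primrec.to_comp.comp (hx.comp Computable.fst))))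

theorem tuple_four_computable {u n v w : α → Word k} (hu : Computable u) (hn : Computable n)
    (hv : Computable v) (hw : Computable w) :
    Computable fun z => tuple [u z, n z, v z, w z] :=
  tuple_primrec.to_comp.comp (Computable.list_cons.comp hu (Computable.list_cons.comp hn
    (Computable.list_cons.comp hv (Computable.list_cons.comp hw (Computable.const [])))))

end InputTape

/-! ### The equivalence of the representations -/

section Reductions

variable {k : ℕ} {Ω : Type*} [MeasurableSpace Ω] {S : ComputableSigmaAlgebra k Ω} {μ : Measure Ω}
  {F : ℕ → Set Ω}

/-- Two sets that differ little on `G` also differ little on every part of `G`, uniformly in `R`. -/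
theorem abs_measureReal_inter_sub_le {G : Set Ω} (hG : μ G < ⊤) (R A B : Set Ω) :
    |μ.real (G ∩ R ∩ A) - μ.real (G ∩ R ∩ B)| ≤ μ.real (G ∩ (A ∆ B)) := by
  have key : ∀ A B : Set Ω, μ.real (G ∩ R ∩ A) ≤ μ.real (G ∩ R ∩ B) + μ.real (G ∩ (A ∆ B)) := by
    intro A B
    refine le_trans (measureReal_mono ?_ ?_) (measureReal_union_le _ _)
    · intro x hx
      by_cases hB : x ∈ B
      · exact Or.inl ⟨hx.1, hB⟩
      · exact Or.inr ⟨hx.1.1, Or.inl ⟨hx.2, hB⟩⟩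
    · refine ((measure_mono (Set.union_subset ?_ Set.inter_subset_left)).trans_lt hG).ne
      rw [Set.inter_assoc]
      exact Set.inter_subset_left
  have h1 := key A B
  have h2 := key B A
  rw [symmDiff_comm] at h2
  rw [abs_le]
  constructor <;> linarith

theorem exists_two_pow_mul_div_lt (c : ℝ) {ε : ℝ} (hε : 0 < ε) (n : ℕ) :
    ∃ j : ℕ, n ≤ j ∧ c / 2 ^ j < ε := by
  have h : Tendsto (fun j : ℕ => c * (2 : ℝ)⁻¹ ^ j) atTop (𝓝 (c * 0)) :=
    (tendsto_pow_atTop_nhds_zero_of_lt_one (by norm_num) (by norm_num)).const_mul c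
  rw [mul_zero] at h
  obtain ⟨j, hj, hn⟩ := ((h.eventually_lt_const hε).and (eventually_ge_atTop n)).exists
  exact ⟨j, hn, by rwa [inv_pow, ← div_eq_mul_inv] at hj⟩

/-- The `j`-th word of the Cauchy name is a ring element `V` close to `A`. The computable measure of
`F i ∩ R ∩ V` with a known margin confirms bounds of `μ(F i ∩ R ∩ A)`, and every strict bound is
confirmed for large `j`. -/
theorem EffectiveOps.cauchy_reducible_zeta (E : EffectiveOps S μ F) (hF : S.IsPartition μ F) :
    Reducible (CauchyRep (dBar μ F) (S.β μ)) (S.ZetaBar μ F) := by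
  -- The evidence consists of the four entries `u, n, v, w` of the tuple, the word for `V`, the
  -- number `i` named by `n`, and the list of words that precede `V` in the Cauchy name; the length
  -- of this list is `j`.
  let W := Word k × Word k × Word k × Word k × Word k × ℕ × List (Word k)
  let name : W → Word k := fun y => E.inter (E.inter (E.part y.2.2.2.2.2.1, y.2.2.1), y.2.2.2.2.1)
  let ap : W → ℕ := fun y => E.approx (name y, y.2.2.2.2.2.2.length)
  -- The error after scaling by `2 ^ j`: `1` for the approximate measure and `2 ^ (i + 1)` for
  -- replacing `A` by `V`, which requires `i < j`.
  let er : W → ℕ := fun y => 1 + 2 ^ (y.2.2.2.2.2.1 + 1)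
  let P : (Unit × List (Option (Alphabet k)) × Word k) × W → Prop := fun z =>
    z.1.2.2 = tuple [z.2.1, z.2.2.1, z.2.2.2.1, z.2.2.2.2.1] ∧
    IsNatName z.2.2.1 z.2.2.2.2.2.2.1 ∧ (S.α z.2.2.2.1).Dom ∧
    (tuple (z.2.2.2.2.2.2.2 ++ [z.2.2.2.2.2.1])).map some <+: z.1.2.1 ∧
    z.2.2.2.2.2.2.1 < z.2.2.2.2.2.2.2.length ∧
    (∃ r : ℚ, IsRatName z.2.1 r ∧
      (r : ℝ) < ((ap z.2 : ℝ) - er z.2) /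
        2 ^ z.2.2.2.2.2.2.2.length) ∧
    (∃ r : ℚ, IsRatName z.2.2.2.2.1 r ∧
      (((ap z.2 + er z.2 : ℕ) : ℝ) - (0 : ℕ)) / 2 ^ z.2.2.2.2.2.2.2.length < r)
  have hP : SemiDec P := by
    let Z := (Unit × List (Option (Alphabet k)) × Word k) × W
    have s0 : Computable fun z : Z => z.1.2 := Computable.snd.comp Computable.fst
    have t1 : Computable fun y : W => y.2 := Computable.snd
    have t2 := Computable.snd.comp t1
    have t3 := Computable.snd.comp t2
    have t4 := Computable.snd.comp t3
    have t5 := Computable.snd.comp t4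
    have t6 := Computable.snd.comp t5
    have hu : Computable fun y : W => y.1 := Computable.fst
    have hn := Computable.fst.comp t1
    have hv := Computable.fst.comp t2
    have hw := Computable.fst.comp t3
    have hV := Computable.fst.comp t4
    have hi := Computable.fst.comp t5
    have hj := Computable.list_length.comp t6
    have hname : Computable name := E.inter_computable.comp ((E.inter_computable.comp
      ((E.part_computable.comp hi).pair hv)).pair hV)
    have hap : Computable ap := E.approx_computable.comp (hname.pair hj)
    have her : Computable er := Primrec.nat_add.to_comp.comp (Computable.const 1)
      (two_pow_primrec.to_comp.comp (Computable.succ.comp hi))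
    have hz : Computable fun z : Z => z.2 := Computable.snd
    refine (SemiDec.of_computable_eq (Computable.snd.comp s0)
      ((tuple_four_computable hu hn hv hw).comp hz)).and
      ((isNatName_semiDec.comp ((hn.comp hz).pair (hi.comp hz))).and
      ((S.α_dom.semiDec.comp (hv.comp hz)).and
      ((prefix_semiDec (Computable.fst.comp s0) (tuple_primrec.to_comp.comp
        (Computable.list_concat.comp (t6.comp hz) (hV.comp hz)))).and
      ((SemiDec.of_computable_lt (hi.comp hz) (hj.comp hz)).and
      ((ratName_lt_semiDec (hu.comp hz) (hap.comp hz) (her.comp hz) (hj.comp hz)).and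
      (lt_ratName_semiDec (hw.comp hz) (Primrec.nat_add.to_comp.comp (hap.comp hz) (her.comp hz))
        (Computable.const 0) (hj.comp hz)))))))
  obtain ⟨M, hM⟩ := exists_enumMachine hP.exists (by
    rintro x s s' v hs ⟨y, h1, h2, h3, h4, h5⟩
    exact ⟨y, h1, h2, h3, h4.trans hs, h5⟩) (enc := wrap) wrap_primrec.to_comp wrap_ne_nil
  refine ⟨M, ?_⟩
  rintro p c ⟨v, y, hp, hy, hcau, hlim⟩
  have hd := hF.dBar_le_of_cauchy hcau hlim
  obtain ⟨A, hA, rfl⟩ := c.exists_rep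
  have hy' : ∀ j, ∃ V ∈ S.α (v j), dBarSet μ F V A ≤ (2 : ℝ)⁻¹ ^ j := by
    intro j
    obtain ⟨V, hV, he⟩ := ComputableSigmaAlgebra.mem_β_iff.1 (hy j)
    have := hd j
    rw [he, dBar_mk] at this
    exact ⟨V, hV, this⟩
  choose V hV hVd using hy'
  have hest : ∀ (i j : ℕ) (x : Word k) (R : Set Ω), i < j → R ∈ S.α x →
      |μ.real (F i ∩ R ∩ A) * 2 ^ j -
        E.approx (E.inter (E.inter (E.part i, x), v j), j)| ≤ 1 + 2 ^ (i + 1) := by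
    intro i j x R hij hR
    have h1 := E.abs_sub_approx_le _ _ (E.mem_inter (E.mem_inter (E.mem_part i) hR) (hV j)) j
    have h2 := (abs_measureReal_inter_sub_le (hF.finite i) R (V j) A).trans
      (measureReal_le_of_dBarSet_le μ F hij (hVd j))
    rw [le_div_iff₀ (by positivity), ← abs_of_pos (show (0 : ℝ) < 2 ^ j by positivity), ← abs_mul,
      sub_mul] at h2
    rw [abs_le] at h1 h2 ⊢
    constructor <;> linarith
  have hQ : ∀ x, (∃ n, ∃ y, P (((), tapePrefix (fun n => some (p n)) n, x), y)) ↔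
      S.zetaWords μ F A x := by
    intro x
    constructor
    · rintro ⟨N, ⟨u, n, x', w, V', i, l⟩, h1, hn, hx', hpre, hij, ⟨a, ha, hlt⟩, b, hb, hgt⟩
      -- The guessed words form a prefix of the tape, so unique decoding identifies the last of them
      -- as the entry with number `l.length`.
      obtain rfl : V' = v l.length :=
        hp.eq_of_occursAt (map_some_prefix_tapePrefix_iff.1 hpre).1
      have h2 := hest i l.length x' _ hij (Part.get_mem hx')
      rw [abs_le] at h2
      refine ⟨u, n, x', w, h1, a, i, _, b, ha, hn, Part.get_mem hx', hb, ?_, ?_⟩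
      · refine hlt.trans_le ?_
        rw [div_le_iff₀ (by positivity)]
        simp only [ap, er, name]
        push_cast
        linarith
      · refine lt_of_le_of_lt ?_ hgt
        rw [le_div_iff₀ (by positivity)]
        simp only [ap, er, name]
        push_cast
        linarith
    · rintro ⟨u, n, x', w, rfl, a, i, R, b, ha, hn, hR, hb, hlt, hgt⟩
      -- Twice the error must fit into both gaps: once because the approximation may be off, and
      -- once for the margin that the test demands.
      obtain ⟨j, hij, hj⟩ := exists_two_pow_mul_div_lt (2 * (1 + 2 ^ (i + 1)))
        (lt_min (sub_pos.2 hlt) (sub_pos.2 hgt)) (i + 1)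
      have h2 := hest i j x' R hij hR
      rw [abs_le] at h2
      rw [div_lt_iff₀ (by positivity)] at hj
      have hj1 := hj.trans_le (mul_le_mul_of_nonneg_right (min_le_left _ _) (by positivity))
      have hj2 := hj.trans_le (mul_le_mul_of_nonneg_right (min_le_right _ _) (by positivity))
      rw [sub_mul] at hj1 hj2
      refine ⟨(tuple ((List.range (j + 1)).map v)).length,
        (u, n, x', w, v j, i, (List.range j).map v), rfl, hn, Part.dom_iff_mem.2 ⟨R, hR⟩,
        map_some_prefix_tapePrefix_iff.2 ?_, by simpa using hij, ⟨a, ha, ?_⟩, b, hb, ?_⟩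
      · have := hp (j + 1)
        simp only [List.range_succ, List.map_append, List.map_singleton] at this ⊢
        exact ⟨this, le_rfl⟩
      · simp only [ap, er, name, List.length_map, List.length_range]
        rw [lt_div_iff₀ (by positivity)]
        push_cast
        linarith
      · simp only [ap, er, name, List.length_map, List.length_range]
        rw [div_lt_iff₀ (by positivity)]
        push_cast
        linarith
  obtain ⟨x₀, hx₀⟩ := S.exists_zetaWords μ F A
  obtain ⟨n₀, hn₀⟩ := (hQ x₀).2 hx₀
  obtain ⟨x, q, hW, hx, hq⟩ := hM () (fun n => some (p n)) ⟨n₀, x₀, hn₀⟩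
  exact ⟨q, hW, S.zetaBar_of_encodesSeq hA (encodesSeq_iff_flatMap.2 hq) fun w =>
    (hx w).trans (hQ w)⟩

/-- Evidence, in the part `s` of a `ζ̄`-name, that `(x - 1) / 2 ^ n` is a lower bound of the measure
on the `i`-th set of the partition and the set with the name `v`. -/
def ZetaLower (s : List (Option (Alphabet k))) (i : ℕ) (v : Word k) (x n : ℕ) : Prop :=
  ∃ u m w : Word k, ListedIn (tuple [u, m, v, w]) s ∧ IsNatName m i ∧
    ∃ r : ℚ, IsRatName u r ∧ ((x : ℝ) - (1 : ℕ)) / 2 ^ n < r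

/-- Evidence, in the part `s` of a `ζ̄`-name, that `(x + 1) / 2 ^ n` is an upper bound of the measure
on the `i`-th set of the partition and the set with the name `v`. -/
def ZetaUpper (s : List (Option (Alphabet k))) (i : ℕ) (v : Word k) (x n : ℕ) : Prop :=
  ∃ u m w : Word k, ListedIn (tuple [u, m, v, w]) s ∧ IsNatName m i ∧
    ∃ r : ℚ, IsRatName w r ∧ (r : ℝ) < (((x + 1 : ℕ) : ℝ) - (0 : ℕ)) / 2 ^ n

section

variable {α : Type*} [Primcodable α] {s : α → List (Option (Alphabet k))} {i x n : α → ℕ}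
  {v : α → Word k}

theorem zetaLower_semiDec (hs : Computable s) (hi : Computable i) (hv : Computable v)
    (hx : Computable x) (hn : Computable n) :
    SemiDec fun z => ZetaLower (s z) (i z) (v z) (x z) (n z) := by
  have h2 : Computable fun z : α × Word k × Word k × Word k => z.2.2 :=
    Computable.snd.comp Computable.snd
  have hu : Computable fun z : α × Word k × Word k × Word k => z.2.1 :=
    Computable.fst.comp Computable.snd
  have f : Computable fun z : α × Word k × Word k × Word k => z.1 := Computable.fst
  exact (((listedIn_semiDec (hs.comp f) (tuple_four_computable hu (Computable.fst.comp h2)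
    (hv.comp f) (Computable.snd.comp h2))).and
    ((isNatName_semiDec.comp ((Computable.fst.comp h2).pair (hi.comp f))).and
    (lt_ratName_semiDec hu (hx.comp f) (Computable.const 1) (hn.comp f)))).exists).of_iff
    fun z => ⟨fun ⟨u, m, w, h⟩ => ⟨(u, m, w), h⟩, fun ⟨⟨u, m, w⟩, h⟩ => ⟨u, m, w, h⟩⟩

theorem zetaUpper_semiDec (hs : Computable s) (hi : Computable i) (hv : Computable v)
    (hx : Computable x) (hn : Computable n) :
    SemiDec fun z => ZetaUpper (s z) (i z) (v z) (x z) (n z) := by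
  have h2 : Computable fun z : α × Word k × Word k × Word k => z.2.2 :=
    Computable.snd.comp Computable.snd
  have hu : Computable fun z : α × Word k × Word k × Word k => z.2.1 :=
    Computable.fst.comp Computable.snd
  have f : Computable fun z : α × Word k × Word k × Word k => z.1 := Computable.fst
  exact (((listedIn_semiDec (hs.comp f) (tuple_four_computable hu (Computable.fst.comp h2)
    (hv.comp f) (Computable.snd.comp h2))).and
    ((isNatName_semiDec.comp ((Computable.fst.comp h2).pair (hi.comp f))).and
    (ratName_lt_semiDec (Computable.snd.comp h2) (Computable.succ.comp (hx.comp f))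
      (Computable.const 0) (hn.comp f)))).exists).of_iff
    fun z => ⟨fun ⟨u, m, w, h⟩ => ⟨(u, m, w), h⟩, fun ⟨⟨u, m, w⟩, h⟩ => ⟨u, m, w, h⟩⟩

end

theorem ZetaLower.mono {s s' : List (Option (Alphabet k))} {i x n : ℕ} {v : Word k}
    (h : ZetaLower s i v x n) (hs : s <+: s') : ZetaLower s' i v x n := by
  obtain ⟨u, m, w, hl, h⟩ := h
  exact ⟨u, m, w, hl.mono hs, h⟩

theorem ZetaUpper.mono {s s' : List (Option (Alphabet k))} {i x n : ℕ} {v : Word k}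
    (h : ZetaUpper s i v x n) (hs : s <+: s') : ZetaUpper s' i v x n := by
  obtain ⟨u, m, w, hl, h⟩ := h
  exact ⟨u, m, w, hl.mono hs, h⟩

/-- The tuples that are listed by a `ζ̄`-name of the class of `A`. -/
def IsZetaList (S : ComputableSigmaAlgebra k Ω) (μ : Measure Ω) (F : ℕ → Set Ω) (p : InfSeq k)
    (A : Set Ω) : Prop :=
  ∀ u n v w : Word k, Listed (tuple [u, n, v, w]) p ↔
    ∃ (a : ℚ) (i : ℕ) (R : Set Ω) (b : ℚ),
      IsRatName u a ∧ IsNatName n i ∧ R ∈ S.α v ∧ IsRatName w b ∧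
      (a : ℝ) < μ.real (F i ∩ R ∩ A) ∧ μ.real (F i ∩ R ∩ A) < (b : ℝ)

theorem IsZetaList.exists_lower_iff {p : InfSeq k} {A : Set Ω} (h : IsZetaList S μ F p A) {i : ℕ}
    {v : Word k} {R : Set Ω} (hR : R ∈ S.α v) (x n : ℕ) :
    (∃ N, ZetaLower (tapePrefix (fun n => some (p n)) N) i v x n) ↔
      (x : ℝ) - 1 < μ.real (F i ∩ R ∩ A) * 2 ^ n := by
  have e : (x : ℝ) - 1 < μ.real (F i ∩ R ∩ A) * 2 ^ n ↔
      ((x : ℝ) - (1 : ℕ)) / 2 ^ n < μ.real (F i ∩ R ∩ A) := by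
    rw [div_lt_iff₀ (by positivity), Nat.cast_one]
  rw [e]
  constructor
  · rintro ⟨N, u, m, w, hl, hm, r, hr, hxr⟩
    obtain ⟨a, i', R', b, ha, hi', hR', -, hlt, -⟩ :=
      (h u m v w).1 (listed_iff_exists_listedIn.2 ⟨N, hl⟩)
    obtain rfl := hr.unique ha
    obtain rfl := hm.unique hi'
    obtain rfl := Part.mem_unique hR hR'
    exact hxr.trans hlt
  · intro hlt
    obtain ⟨a, ha1, ha2⟩ := exists_rat_btwn hlt
    -- Listed tuples carry bounds on both sides, so any upper bound is added to the lower bound of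
    -- interest.
    obtain ⟨b, hb⟩ := exists_rat_gt (μ.real (F i ∩ R ∩ A))
    obtain ⟨u, hu⟩ := exists_isRatName (k := k) a
    obtain ⟨w, hw⟩ := exists_isRatName (k := k) b
    obtain ⟨m, hm⟩ := exists_isNatName (k := k) i
    obtain ⟨N, hN⟩ := listed_iff_exists_listedIn.1
      ((h u m v w).2 ⟨a, i, R, b, hu, hm, hR, hw, ha2, hb⟩)
    exact ⟨N, u, m, w, hN, hm, a, hu, ha1⟩

theorem IsZetaList.exists_upper_iff {p : InfSeq k} {A : Set Ω} (h : IsZetaList S μ F p A) {i : ℕ}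
    {v : Word k} {R : Set Ω} (hR : R ∈ S.α v) (x n : ℕ) :
    (∃ N, ZetaUpper (tapePrefix (fun n => some (p n)) N) i v x n) ↔
      μ.real (F i ∩ R ∩ A) * 2 ^ n < x + 1 := by
  have e : μ.real (F i ∩ R ∩ A) * 2 ^ n < x + 1 ↔
      μ.real (F i ∩ R ∩ A) < (((x + 1 : ℕ) : ℝ) - (0 : ℕ)) / 2 ^ n := by
    rw [lt_div_iff₀ (by positivity)]
    push_cast
    rw [sub_zero]
  rw [e]
  constructor
  · rintro ⟨N, u, m, w, hl, hm, r, hr, hxr⟩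
    obtain ⟨a, i', R', b, -, hi', hR', hb, -, hgt⟩ :=
      (h u m v w).1 (listed_iff_exists_listedIn.2 ⟨N, hl⟩)
    obtain rfl := hr.unique hb
    obtain rfl := hm.unique hi'
    obtain rfl := Part.mem_unique hR hR'
    exact hgt.trans hxr
  · intro hlt
    obtain ⟨b, hb1, hb2⟩ := exists_rat_btwn hlt
    obtain ⟨a, ha⟩ := exists_rat_lt (μ.real (F i ∩ R ∩ A))
    obtain ⟨u, hu⟩ := exists_isRatName (k := k) a
    obtain ⟨w, hw⟩ := exists_isRatName (k := k) b
    obtain ⟨m, hm⟩ := exists_isNatName (k := k) i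
    obtain ⟨N, hN⟩ := listed_iff_exists_listedIn.1
      ((h u m v w).2 ⟨a, i, R, b, hu, hm, hR, hw, ha, hb1⟩)
    exact ⟨N, u, m, w, hN, hm, b, hw, hb2⟩

/-- The measure of `G ∩ (V ∆ A)` from the measures of intersections with `A`. -/
theorem measureReal_inter_symmDiff {G V A : Set Ω} (hG : μ G < ⊤) (hmG : MeasurableSet G)
    (hV : MeasurableSet V) (hA : MeasurableSet A) :
    μ.real (G ∩ (V ∆ A)) = μ.real (G ∩ V) - μ.real (G ∩ V ∩ A) + μ.real (G ∩ (G \ V) ∩ A) := by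
  have hfin : ∀ C : Set Ω, μ (G ∩ C) ≠ ⊤ := fun C =>
    ((measure_mono Set.inter_subset_left).trans_lt hG).ne
  have e1 : G ∩ (V ∆ A) = (G ∩ V) \ A ∪ G ∩ (G \ V) ∩ A := by
    ext x
    simp only [Set.mem_inter_iff, Set.mem_symmDiff, Set.mem_union, Set.mem_sdiff]
    tauto
  have hdisj : Disjoint ((G ∩ V) \ A) (G ∩ (G \ V) ∩ A) :=
    Set.disjoint_left.2 fun x hx hx' => hx.2 hx'.2
  rw [e1, measureReal_union hdisj ((hmG.inter (hmG.diff hV)).inter hA)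
    ((measure_mono Set.sdiff_subset).trans_lt (hfin V).lt_top).ne (by
      rw [Set.inter_assoc]; exact hfin _)]
  have := measureReal_inter_add_sdiff (μ := μ) (s := G ∩ V) hA (hfin V)
  linarith

/-- For each `j` the machine searches for a ring element that the name certifies to be close to `A`
on the first `j + 4` sets of the partition. Such a certificate is finite, so the condition is
semidecidable, and density provides a `V` that meets it. -/
theorem EffectiveOps.zeta_reducible_cauchy (E : EffectiveOps S μ F) (hF : S.IsPartition μ F) :
    Reducible (S.ZetaBar μ F) (CauchyRep (dBar μ F) (S.β μ)) := by
  let X := Unit × List (Option (Alphabet k)) × ℕ × Word k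
  -- At scale `2 ^ (j + 6)`, with `a` the approximation of `μ(F i ∩ V)`, the test `a + y < x + 6`
  -- gives at most `5` for `a - x + y`. The three errors of size `1` raise this to `8`, that is, to
  -- `2⁻⁽ʲ⁺³⁾`. Conversely, a set `V` within `2⁻⁽ʲ⁺⁶⁾` of `A` passes, since rounding then gives `a -
  -- x + y < 3`.
  let B : (X × ℕ) × ℕ × ℕ → Prop := fun z =>
    ZetaLower z.1.1.2.1 z.1.2 z.1.1.2.2.2 z.2.1 (z.1.1.2.2.1 + 6) ∧
    ZetaUpper z.1.1.2.1 z.1.2 (E.diff (E.part z.1.2, z.1.1.2.2.2)) z.2.2 (z.1.1.2.2.1 + 6) ∧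
    E.approx (E.inter (E.part z.1.2, z.1.1.2.2.2), z.1.1.2.2.1 + 6) + z.2.2 < z.2.1 + 6
  have hB : SemiDec B := by
    have h0 : Computable fun z : (X × ℕ) × ℕ × ℕ => z.1.1.2 :=
      Computable.snd.comp (Computable.fst.comp Computable.fst)
    have hs := Computable.fst.comp h0
    have hj6 : Computable fun z : (X × ℕ) × ℕ × ℕ => z.1.1.2.2.1 + 6 :=
      Primrec.nat_add.to_comp.comp (Computable.fst.comp (Computable.snd.comp h0))
        (Computable.const 6)
    have hv := Computable.snd.comp (Computable.snd.comp h0)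
    have hi : Computable fun z : (X × ℕ) × ℕ × ℕ => z.1.2 := Computable.snd.comp Computable.fst
    have hx : Computable fun z : (X × ℕ) × ℕ × ℕ => z.2.1 := Computable.fst.comp Computable.snd
    have hy : Computable fun z : (X × ℕ) × ℕ × ℕ => z.2.2 := Computable.snd.comp Computable.snd
    have hFv := (E.part_computable.comp hi).pair hv
    exact (zetaLower_semiDec hs hi hv hx hj6).and
      ((zetaUpper_semiDec hs hi (E.diff_computable.comp hFv) hy hj6).and
      (SemiDec.of_computable_lt (Primrec.nat_add.to_comp.comp (E.approx_computable.comp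
        ((E.inter_computable.comp hFv).pair hj6)) hy)
        (Primrec.nat_add.to_comp.comp hx (Computable.const 6))))
  have hR : SemiDec fun z : X => (S.α z.2.2.2).Dom ∧ ∀ i < z.2.2.1 + 4, ∃ y, B ((z, i), y) := by
    have hj : Computable fun z : X => z.2.2.1 + 4 := Primrec.nat_add.to_comp.comp
      (Computable.fst.comp (Computable.snd.comp Computable.snd)) (Computable.const 4)
    exact (S.α_dom.semiDec.comp (Computable.snd.comp (Computable.snd.comp Computable.snd))).and
      (hB.exists.forall_lt hj)
  obtain ⟨M, hM⟩ := exists_selectMachine hR (enc := wrap) wrap_primrec.to_comp wrap_ne_nil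
  refine ⟨M, ?_⟩
  rintro p c ⟨A, hA, rfl, hlist⟩
  have hlist : IsZetaList S μ F p A := hlist
  have hmeas : ∀ (V : Set Ω), V ∈ S.sets → ∀ i, μ.real (F i ∩ (V ∆ A)) =
      μ.real (F i ∩ V) - μ.real (F i ∩ V ∩ A) + μ.real (F i ∩ (F i \ V) ∩ A) := fun V hV i =>
    measureReal_inter_symmDiff (hF.finite i) (S.measurableSet (hF.mem_sets i))
      (S.measurableSet hV) hA
  obtain ⟨v, q, hW, hv, hq⟩ := hM () (fun n => some (p n)) (by
    intro j
    obtain ⟨V, hV, hVA⟩ := hF.exists_measureReal_lt hA (j + 4)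
      (show (0 : ℝ) < 1 / 2 ^ (j + 6) by positivity)
    obtain ⟨v, hv⟩ := (S.α_range V).1 hV
    -- The prefix length depends on `i`; monotonicity of the evidence lets the maximum over `i < j +
    -- 4` serve for all.
    have hbd : ∀ i, ∃ N, i < j + 4 → ∃ y,
        B ((((), tapePrefix (fun n => some (p n)) N, j, v), i), y) := by
      intro i
      by_cases hi : i < j + 4
      swap
      · exact ⟨0, fun h => absurd h hi⟩
      have h1 := hVA i hi
      rw [lt_div_iff₀ (by positivity), hmeas V hV, add_mul, sub_mul] at h1
      have hFV := E.mem_inter (E.mem_part i) hv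
      have hdV := E.mem_diff _ _ _ _ (E.mem_part i) hv
      have h2 := abs_le.1 (E.abs_sub_approx_le _ _ hFV (j + 6))
      let x := ⌊μ.real (F i ∩ V ∩ A) * 2 ^ (j + 6)⌋₊
      let y := ⌊μ.real (F i ∩ (F i \ V) ∩ A) * 2 ^ (j + 6)⌋₊
      have hx1 : (x : ℝ) ≤ μ.real (F i ∩ V ∩ A) * 2 ^ (j + 6) :=
        Nat.floor_le (mul_nonneg measureReal_nonneg (by positivity))
      have hx2 : μ.real (F i ∩ V ∩ A) * 2 ^ (j + 6) < x + 1 := Nat.lt_floor_add_one _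
      have hy1 : (y : ℝ) ≤ μ.real (F i ∩ (F i \ V) ∩ A) * 2 ^ (j + 6) :=
        Nat.floor_le (mul_nonneg measureReal_nonneg (by positivity))
      have hy2 : μ.real (F i ∩ (F i \ V) ∩ A) * 2 ^ (j + 6) < y + 1 := Nat.lt_floor_add_one _
      obtain ⟨N₁, hN₁⟩ := (hlist.exists_lower_iff hv x (j + 6)).2 (by linarith)
      obtain ⟨N₂, hN₂⟩ := (hlist.exists_upper_iff hdV y (j + 6)).2 hy2
      refine ⟨max N₁ N₂, fun _ => ⟨(x, y), hN₁.mono (tapePrefix_prefix _ (le_max_left _ _)),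
        hN₂.mono (tapePrefix_prefix _ (le_max_right _ _)), ?_⟩⟩
      rw [← Nat.cast_lt (α := ℝ)]
      push_cast
      linarith
    choose N hN using hbd
    refine ⟨(Finset.range (j + 4)).sup N, v, Part.dom_iff_mem.2 ⟨V, hv⟩, fun i hi => ?_⟩
    obtain ⟨y, h1, h2, h3⟩ := hN i hi
    have hle : N i ≤ (Finset.range (j + 4)).sup N := Finset.le_sup (Finset.mem_range.2 hi)
    exact ⟨y, h1.mono (tapePrefix_prefix _ hle), h2.mono (tapePrefix_prefix _ hle), h3⟩)
  have hdist : ∀ j, ∃ c, c ∈ S.β μ (v j) ∧ dBar μ F c (SetClass.mk μ A hA) ≤ (2 : ℝ)⁻¹ ^ (j + 1) := by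
    intro j
    obtain ⟨N, hdom, hN⟩ := hv j
    have hV := Part.get_mem hdom
    dsimp only at hdom hN hV
    generalize (S.α (v j)).get hdom = V at hV
    refine ⟨_, ComputableSigmaAlgebra.mem_β_iff.2 ⟨V, hV, rfl⟩, ?_⟩
    rw [dBar_mk]
    have hbd : ∀ i < j + 4, μ.real (F i ∩ (V ∆ A)) ≤ (2 : ℝ)⁻¹ ^ (j + 3) := by
      intro i hi
      obtain ⟨⟨x, y⟩, h1, h2, h3⟩ := hN i hi
      have h1 := (hlist.exists_lower_iff hV x (j + 6)).1 ⟨N, h1⟩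
      have h2 := (hlist.exists_upper_iff (E.mem_diff _ _ _ _ (E.mem_part i) hV) y (j + 6)).1 ⟨N, h2⟩
      have h4 := abs_le.1 (E.abs_sub_approx_le _ _ (E.mem_inter (E.mem_part i) hV) (j + 6))
      have h3' : E.approx (E.inter (E.part i, v j), j + 6) + y + 1 ≤ x + 6 := h3
      have h5 : ((E.approx (E.inter (E.part i, v j), j + 6) : ℕ) : ℝ) + y + 1 ≤ x + 6 := by
        exact_mod_cast h3'
      have h6 : μ.real (F i ∩ (V ∆ A)) * 2 ^ (j + 6) ≤ 8 := by
        rw [hmeas V (S.mem_sets hV), add_mul, sub_mul]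
        linarith
      have h7 : (2 : ℝ)⁻¹ ^ (j + 3) = 8 / 2 ^ (j + 6) := by
        rw [inv_pow, pow_add, pow_add]
        field_simp
        norm_num
      rw [h7, le_div_iff₀ (by positivity)]
      exact h6
    -- The bound is `2 * 2⁻⁽ʲ⁺³⁾ + 2 * 2⁻⁽ʲ⁺⁴⁾`, which is below `2⁻⁽ʲ⁺¹⁾`; this halved rate makes
    -- the selected sequence fast Cauchy.
    refine (dBarSet_le_of_forall_lt μ F (by positivity) hbd).trans ?_
    have hpos : (0 : ℝ) < 2⁻¹ ^ j := by positivity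
    rw [pow_add, pow_add, pow_add]
    nlinarith
  choose y hy hyd using hdist
  obtain ⟨h1, h2⟩ := hF.cauchy_of_dBar_le hyd
  exact ⟨q, hW, v, y, encodesSeq_iff_flatMap.2 hq, hy, h1, h2⟩

end Reductions

theorem theorem6p5 {k : ℕ} {Ω : Type*} [MeasurableSpace Ω] (S : ComputableSigmaAlgebra k Ω)
    (μ : Measure Ω) (hμ : S.IsComputableMeasure μ) (F : ℕ → Set Ω) (hF : S.IsPartition μ F) :
    IsComputableMetricSpace (dBar μ F) (S.ringClasses μ) (S.β μ) ∧
      IsRepresentation (CauchyRep (dBar μ F) (S.β μ)) ∧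
      IsRepresentation (S.ZetaBar μ F) ∧
      EquivRep (S.ZetaBar μ F) (CauchyRep (dBar μ F) (S.β μ)) := by
  obtain ⟨E⟩ := hF.exists_effectiveOps hμ
  exact ⟨hF.isComputableMetricSpace hμ, hF.cauchyRep_isRepresentation, hF.zetaBar_isRepresentation,
    E.zeta_reducible_cauchy hF, E.cauchy_reducible_zeta hF⟩
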